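/- **Setting.** Let $d,d'\ge 1$, $Y\subseteq\mathbb R^{d'}$ closed and convex, $Z=\mathbb R^d\times Y$, and let $f(x,y)$ have partial gradients on $Z$ such that $F=(\nabla_x f,-\nabla_y f)$ is $\ell$-Lipschitz on $Z$, $f(x,\cdot)$ is $\mu_y$-strongly concave on $Y$ for every $x$, and $f(\cdot,y)$ is $\rho$-weakly convex for every $y\in Y$, i.e. $\langle\nabla_xf(x',y),x-x'\rangle-\frac\rho2\|x-x'\|^2\le f(x,y)-f(x',y)$. Let $P(x)=\max_{y\in Y}f(x,y)$ be $L$-smooth, attain its minimum $P_*$, and satisfy the $\mu$-PL condition $\|\nabla P(x)\|^2\ge2\mu(P(x)-P_*)$. Here $\mu,\mu_y>0$ and $0<\rho\le\min\{\ell,\mu/8\}$. Let $z_0=(x_0,y_0)\in Z$ satisfy $\max_{y\in Y}f(x_0,y)-\min_{x}f(x,y_0)\le\epsilon_0$ (in particular $f(\cdot,y_0)$ is bounded below), with $\epsilon_0>0$, and let $\epsilon>0$. The samples $\xi^k_t$ are independent, and $\mathcal G(z;\xi^k_t)$ is integrable with mean $F(z)$ for every $z\in Z$. **Algorithm (PES-AdaGrad).**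 Let $\delta,\eta_0>0$, $\gamma=\mu/4$, $m=1/\sqrt{d+d'}$, $\lambda=\min\{\mu/8,\mu_y\}$, and, for $k\ge1$, $$\eta_k=\eta_0e^{-(k-1)/32},\qquad M_k=\frac{384\,m}{\eta_0\lambda}e^{(k-1)/32}.$$ Epoch $k$ starts at $z^k_1=z_{k-1}=(x_{k-1},y_{k-1})$ and works on $f_k(x,y)=f(x,y)+\frac\gamma2\|x-x_{k-1}\|^2$. In step $t$ it computes the stochastic gradient $g^k_t=\mathcal G(z^k_t;\xi^k_t)+(\gamma(x^k_t-x_{k-1}),0)$ of $f_k$ and sets $$z^k_{t+1}=\arg\min_{z\in Z}\Big\{\eta_k z^\top\Big(\frac1t\sum_{\tau=1}^tg^k_\tau\Big)+\frac1{2t}\big\langle z-z_{k-1},H^k_t(z-z_{k-1})\big\rangle\Big\},\qquad H^k_t=\delta I+\mathrm{diag}\big(\|g^k_{1:t,i}\|_2\big)_{i\le d+d'},$$ where $g^k_{1:t,i}=(g^k_{1,i},\dots,g^k_{t,i})$. It returns $z_k=\frac1{T_k}\sum_{t=1}^{T_k}z^k_t$. The epoch length $T_k$ is the least integer $n$ such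 that, almost surely, $$n\ \ge\ M_k\max\Big\{\frac{\delta+\max_i\|g^k_{1:n,i}\|_2}{m},\ m\sum_{i=1}^{d+d'}\|g^k_{1:n,i}\|_2\Big\}.$$ For $K\ge0$ let $\Delta_{K+1}=475\,(P(x_K)-P_*)+57\,\mathrm{Gap}_{K+1}(x_K,y_K)$, where $\mathrm{Gap}_{K+1}(x,y)=\max_{y'\in Y}f_{K+1}(x,y')-\min_{x'}f_{K+1}(x',y)$. **Theorem.** There is an absolute constant $C>0$ such that the following holds in the setting above. Let $\alpha\in(0,1/2]$ and $K\ge0$, and suppose that for all $1\le k\le K$, almost surely, $\|g^k_t\|_\infty\le\delta$ for $1\le t\le T_k$ and $\|g^k_{1:T_k,i}\|_2\le\delta T_k^\alpha$ for all $i$. 1. If $$1200\,\epsilon_0e^{-K/16}\le\epsilon\qquad\text{and}\qquad16\,\eta_0^2\lambda Ke^{-K/16}\le m^2\epsilon,\tag{$*$}$$ then $\Delta_{K+1}$ is integrable and $\mathbb E[\Delta_{K+1}]\le\epsilon$. 2. If $K$ is the least integer satisfying $(*)$, then $$\sum_{k=1}^KT_k\le C\Big(1+\max\Big\{\frac{\delta^2\epsilon_0}{\eta_0^2\min\{\mu,\mu_y\}^2\epsilon},\frac{\delta^2(d+d')}{\min\{\mu,\mu_y\}\epsilon}\Big\}^{\frac1{2(1-\alpha)}}\Big)\log\Big(2+\frac{\epsilon_0}\epsilon+\frac{\eta_0^2\min\{\mu,\mu_y\}(d+d')}{\epsilon}\Big).$$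 If moreover $\eta_0=\sqrt{\epsilon_0/((d+d')\min\{\mu,\mu_y\})}$, then the total iteration complexity is $$\sum_{k=1}^KT_k\le C\Big(1+\Big(\frac{\delta^2(d+d')}{\min\{\mu,\mu_y\}\,\epsilon}\Big)^{\frac1{2(1-\alpha)}}\Big)\log\Big(2+\frac{\epsilon_0}{\epsilon}\Big)=\widetilde O\Big(\Big(\frac{\delta^2(d+d')}{\min\{\mu,\mu_y\}\epsilon}\Big)^{\frac1{2(1-\alpha)}}\Big).$$ -/

import Mathlib

open MeasureTheory ProbabilityTheory
open scoped InnerProductSpace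

namespace PES

noncomputable section

/-- The space `ℝ^d`, with the Euclidean norm. -/
abbrev Vec (d : ℕ) : Type := EuclideanSpace ℝ (Fin d)

/-- Points `z = (x, y)` of `ℝ^d × ℝ^d'`. (The norm of the product type is never used: Euclidean
norms of pairs are written out.) -/
abbrev Pt (d d' : ℕ) : Type := Vec d × Vec d'

/-- The `d + d'` coordinates of `z = (x, y)`. -/
def coord {d d' : ℕ} (z : Pt d d') : Fin d ⊕ Fin d' → ℝ :=
  Sum.elim (fun i => z.1 i) (fun j => z.2 j)

/-! ### The min-max problem -/

/-- The feasible set `Z = ℝ^d × Y`. -/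
def feasible {d d' : ℕ} (Y : Set (Vec d')) : Set (Pt d d') := {z | z.2 ∈ Y}

/-- The primal function `P(x) = max_{y ∈ Y} f(x, y)`. -/
def primal {d d' : ℕ} (f : Vec d → Vec d' → ℝ) (Y : Set (Vec d')) (x : Vec d) : ℝ :=
  ⨆ y : Y, f x y

/-- The optimal value `P_* = min_x P(x)`. -/
def primalOpt {d d' : ℕ} (f : Vec d → Vec d' → ℝ) (Y : Set (Vec d')) : ℝ :=
  ⨅ x, primal f Y x

/-- The duality gap `max_{y' ∈ Y} h(x, y') - min_{x'} h(x', y)` of `z = (x, y)`. -/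
def gap {d d' : ℕ} (h : Vec d → Vec d' → ℝ) (Y : Set (Vec d')) (z : Pt d d') : ℝ :=
  (⨆ y' : Y, h z.1 y') - ⨅ x', h x' z.2

/-- The regularized objective `f(x, y) + (γ / 2) ‖x - c‖²`. -/
def proxObj {d d' : ℕ} (f : Vec d → Vec d' → ℝ) (γ : ℝ) (c : Vec d) (x : Vec d) (y : Vec d') : ℝ :=
  f x y + γ / 2 * ‖x - c‖ ^ 2

/-- The Lyapunov function `475 (P(x₀) - P_*) + 57 Gap(x₀, y₀)` at a restarting point
`z₀ = (x₀, y₀)`; the gap is that of `f(x, y) + (μ / 8) ‖x - x₀‖²`, i.e. `γ = μ / 4`. -/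
def lyapunov {d d' : ℕ} (f : Vec d → Vec d' → ℝ) (Y : Set (Vec d')) (μ : ℝ) (z₀ : Pt d d') : ℝ :=
  475 * (primal f Y z₀.1 - primalOpt f Y) + 57 * gap (proxObj f (μ / 4) z₀.1) Y z₀

/-! ### Assumptions -/

/-- Smoothness and strong concavity: `Y` is closed (it is convex by strong concavity), `gx`, `gy` are
the partial gradients of `f` on `ℝ^d × Y`, `F = (gx, -gy)` is `ℓ`-Lipschitz there, `f(x, ·)` is
`μy`-strongly concave on `Y`, and `P` is `L`-smooth with a minimizer. -/
structure SmoothStronglyConcave {d d' : ℕ} (f : Vec d → Vec d' → ℝ) (Y : Set (Vec d'))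
    (gx : Vec d → Vec d' → Vec d) (gy : Vec d → Vec d' → Vec d') (ℓ μy L : ℝ) : Prop where
  closed : IsClosed Y
  grad_x : ∀ x, ∀ y ∈ Y, HasGradientAt (fun x' => f x' y) (gx x y) x
  grad_y : ∀ x, ∀ y ∈ Y, HasGradientWithinAt (f x) (gy x y) Y y
  lipschitz : ∀ x x', ∀ y ∈ Y, ∀ y' ∈ Y,
    Real.sqrt (‖gx x y - gx x' y'‖ ^ 2 + ‖gy x y - gy x' y'‖ ^ 2) ≤
      ℓ * Real.sqrt (‖x - x'‖ ^ 2 + ‖y - y'‖ ^ 2)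
  strongConcave : ∀ x, StrongConcaveOn Y μy (f x)
  primal_differentiable : Differentiable ℝ (primal f Y)
  primal_smooth : ∀ x x', ‖gradient (primal f Y) x - gradient (primal f Y) x'‖ ≤ L * ‖x - x'‖
  primal_min : ∃ xs, ∀ x, primal f Y xs ≤ primal f Y x

/-- The initial point `z₀ = (x₀, y₀) ∈ ℝ^d × Y` has finite duality gap at most `ε₀`. -/
structure InitialGap {d d' : ℕ} (f : Vec d → Vec d' → ℝ) (Y : Set (Vec d')) (z₀ : Pt d d')
    (ε₀ : ℝ) : Prop where
  mem : z₀.2 ∈ Y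
  bddBelow : BddBelow (Set.range fun x => f x z₀.2)
  gap_le : gap f Y z₀ ≤ ε₀

/-- The primal function satisfies the `μ`-PL condition. -/
def PrimalPL {d d' : ℕ} (f : Vec d → Vec d' → ℝ) (Y : Set (Vec d')) (μ : ℝ) : Prop :=
  ∀ x, 2 * μ * (primal f Y x - primalOpt f Y) ≤ ‖gradient (primal f Y) x‖ ^ 2

/-- `f(·, y)` is `ρ`-weakly convex for every `y ∈ Y` (`gx` is the partial gradient in `x`). -/
def WeaklyConvexInX {d d' : ℕ} (f : Vec d → Vec d' → ℝ) (Y : Set (Vec d'))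
    (gx : Vec d → Vec d' → Vec d) (ρ : ℝ) : Prop :=
  ∀ y ∈ Y, ∀ x x', ⟪gx x' y, x - x'⟫_ℝ - ρ / 2 * ‖x - x'‖ ^ 2 ≤ f x y - f x' y

/-- Stochastic oracle: `ξ k t` is the sample used in step `t` of epoch `k`; the samples are
independent, and `G(z; ξ k t)` is an unbiased estimate of `F(z) = (gx z, -gy z)` for every
feasible `z`. -/
structure UnbiasedOracle {d d' : ℕ} {Ω Ξ : Type*} [MeasurableSpace Ω] [MeasurableSpace Ξ]
    (Pr : Measure Ω) (Y : Set (Vec d')) (gx : Vec d → Vec d' → Vec d)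
    (gy : Vec d → Vec d' → Vec d') (G : Pt d d' → Ξ → Pt d d') (ξ : ℕ → ℕ → Ω → Ξ) : Prop where
  measurable_G : Measurable (Function.uncurry G)
  measurable_sample : ∀ k t, Measurable (ξ k t)
  indep : iIndepFun (fun p : ℕ × ℕ => ξ p.1 p.2) Pr
  integrable : ∀ k t, ∀ z ∈ feasible Y, Integrable (fun ω => G z (ξ k t ω)) Pr
  unbiased : ∀ k t, ∀ z ∈ feasible Y, ∫ ω, G z (ξ k t ω) ∂Pr = (gx z.1 z.2, -gy z.1 z.2)

/-! ### The algorithm -/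

/-- A minimizer of `φ` over `S` (an arbitrary point if there is none). -/
def argminOn {α : Type*} [Nonempty α] (S : Set α) (φ : α → ℝ) : α :=
  Classical.epsilon fun z => z ∈ S ∧ ∀ w ∈ S, φ z ≤ φ w

/-- `s_{t,i} = ‖g_{1:t,i}‖₂`: the Euclidean norm of the `i`-th row of the matrix `[g_1, …, g_t]`. -/
def rowNorm {d d' : ℕ} (g : ℕ → Pt d d') (t : ℕ) (i : Fin d ⊕ Fin d') : ℝ :=
  Real.sqrt (∑ τ ∈ Finset.Icc 1 t, coord (g τ) i ^ 2)

/-- The objective `η zᵀ ((1/t) ∑_{τ ≤ t} g_τ) + (1/t) ψ_t(z)` of an AdaGrad step, where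
`ψ_t(z) = ½ ⟨z - z₀, H_t (z - z₀)⟩` and `H_t = δ I + diag(s_t)`. -/
def adaObjective {d d' : ℕ} (z₀ : Pt d d') (δ η : ℝ) (t : ℕ) (g : ℕ → Pt d d') (z : Pt d d') : ℝ :=
  η * ∑ i, coord z i * (1 / (t : ℝ) * ∑ τ ∈ Finset.Icc 1 t, coord (g τ) i) +
    1 / (t : ℝ) * (1 / 2 * ∑ i, (δ + rowNorm g t i) * (coord z i - coord z₀ i) ^ 2)

/-- The iterates of AdaGrad over `Z` from `z₀`, with stochastic gradient `g t z` of step `t` at `z`: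
`z_1 = z₀`, and `z_{t+1}` minimizes `adaObjective` over `Z`, with `g_τ = g τ z_τ` for
`1 ≤ τ ≤ t`. (Index `0` is not used.) -/
def adaIterate {d d' : ℕ} (Z : Set (Pt d d')) (g : ℕ → Pt d d' → Pt d d') (z₀ : Pt d d')
    (δ η : ℝ) : ℕ → Pt d d'
  | 0 => z₀
  | 1 => z₀
  | t + 2 => argminOn Z (adaObjective z₀ δ η (t + 1)
      (fun τ => if _h : τ ≤ t + 1 then g τ (adaIterate Z g z₀ δ η τ) else 0))
  termination_by t => t
  decreasing_by omega

/-- The stochastic gradient at `z` of `f_k(x, y) = f(x, y) + (γ / 2) ‖x - c‖²`. -/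
def proxGrad {d d' : ℕ} {Ξ : Type*} (G : Pt d d' → Ξ → Pt d d') (γ : ℝ) (c : Vec d) (s : Ξ)
    (z : Pt d d') : Pt d d' :=
  G z s + (γ • (z.1 - c), 0)

/-- The AdaGrad iterates `z_t` of the epoch that starts at `z₀ = (x₀, y₀)` and works on
`f(x, y) + (γ / 2) ‖x - x₀‖²`; `s t` is the sample of step `t`. -/
def epochIterate {d d' : ℕ} {Ξ : Type*} (Y : Set (Vec d')) (G : Pt d d' → Ξ → Pt d d') (γ δ η : ℝ)
    (s : ℕ → Ξ) (z₀ : Pt d d') (t : ℕ) : Pt d d' :=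
  adaIterate (feasible Y) (fun τ => proxGrad G γ z₀.1 (s τ)) z₀ δ η t

/-- The stochastic gradients `g_t` computed at the iterates of that epoch. -/
def epochGrad {d d' : ℕ} {Ξ : Type*} (Y : Set (Vec d')) (G : Pt d d' → Ξ → Pt d d') (γ δ η : ℝ)
    (s : ℕ → Ξ) (z₀ : Pt d d') (t : ℕ) : Pt d d' :=
  proxGrad G γ z₀.1 (s t) (epochIterate Y G γ δ η s z₀ t)

/-- PES-AdaGrad: the points `z_k = (x_k, y_k)`. Epoch `k` starts at `z_{k-1}`, runs `T k` steps
of AdaGrad with step size `η k`, and returns the average of its iterates `z_1, …, z_{T k}`. -/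
def pesPoint {d d' : ℕ} {Ξ : Type*} (Y : Set (Vec d')) (G : Pt d d' → Ξ → Pt d d') (γ δ : ℝ)
    (η : ℕ → ℝ) (T : ℕ → ℕ) (s : ℕ → ℕ → Ξ) (z₀ : Pt d d') : ℕ → Pt d d'
  | 0 => z₀
  | k + 1 => (1 / (T (k + 1) : ℝ)) • ∑ t ∈ Finset.Icc 1 (T (k + 1)),
      epochIterate Y G γ δ (η (k + 1)) (s (k + 1)) (pesPoint Y G γ δ η T s z₀ k) t

/-- `g^k_t`: the stochastic gradient of step `t` of epoch `k ≥ 1` of PES-AdaGrad. -/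
def pesGrad {d d' : ℕ} {Ξ : Type*} (Y : Set (Vec d')) (G : Pt d d' → Ξ → Pt d d') (γ δ : ℝ)
    (η : ℕ → ℝ) (T : ℕ → ℕ) (s : ℕ → ℕ → Ξ) (z₀ : Pt d d') (k t : ℕ) : Pt d d' :=
  epochGrad Y G γ δ (η k) (s k) (pesPoint Y G γ δ η T s z₀ (k - 1)) t

/-! ### Parameters -/

/-- `m = 1 / √(d + d')`. -/
def mPar (d d' : ℕ) : ℝ := 1 / Real.sqrt ((d : ℝ) + d')

/-- `λ = min {μ / 8, μy}`. -/
def lam (μ μy : ℝ) : ℝ := min (μ / 8) μy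

/-- `η_k = η₀ exp (-(k - 1) / 32)`. -/
def stepSize (η₀ : ℝ) (k : ℕ) : ℝ := η₀ * Real.exp (-((k : ℝ) - 1) / 32)

/-- `M_k = 384 m / (η₀ min {μ / 8, μy}) · exp ((k - 1) / 32)`. -/
def MPar (d d' : ℕ) (μ μy η₀ : ℝ) (k : ℕ) : ℝ :=
  384 * mPar d d' / (η₀ * lam μ μy) * Real.exp (((k : ℝ) - 1) / 32)

/-- `M max {(δ + max_i ‖g_{1:n,i}‖) / m, m ∑_i ‖g_{1:n,i}‖}`. -/
def epochLength {d d' : ℕ} (M δ : ℝ) (g : ℕ → Pt d d') (n : ℕ) : ℝ :=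
  M * max ((δ + ⨆ i, rowNorm g n i) / mPar d d') (mPar d d' * ∑ i, rowNorm g n i)

/-- `K` stages are enough: `exp (-K / 16) ≤ min {ε / (1200 ε₀), m² ε / (16 η₀² λ K)}`, with the
denominators cleared. -/
def EnoughStages (d d' : ℕ) (μ μy η₀ ε₀ ε : ℝ) (K : ℕ) : Prop :=
  1200 * ε₀ * Real.exp (-(K : ℝ) / 16) ≤ ε ∧
    16 * η₀ ^ 2 * lam μ μy * K * Real.exp (-(K : ℝ) / 16) ≤ mPar d d' ^ 2 * ε

end

end PES

namespace PES

/-! ### Minimizers of strongly convex functions -/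

/-! The proof is a restart argument. As γ = μ/4 and ρ ≤ μ/8, each regularized objective f_k is
λ-strongly convex in x and λ-strongly concave in y, and the regret of one AdaGrad epoch becomes a
contraction of the duality gap up to noise.

Inside an epoch, dual averaging with growing diagonal weights (`dualAveraging_regret`) bounds the
regret measured with the stochastic gradients g. The gap requires the field F and a comparison point
w that is a best response to the output. Such a w depends on the noise, so the sum of (F - g)·(z_t -
w) does not have mean zero. A second, unconstrained dual averaging process driven by F - g
(`ghostShift`, `ghost_regret`) absorbs the dependence on w. What is left is a drift of mean zero and
an energy whose mean is at most that of g (`integral_noise`). The rule for T_k turns all weights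
into multiples of ‖w - z₀‖² (`field_regret`), and strong convexity bounds the distance from z₀ to
the best responses by the gaps themselves (`gap_le_of_quadratic_regret`). Since M_k η_k = 384 m / λ,
the resulting factor is 1/192, with a remainder of mean at most η_k² λ / (192 m²) (`epoch_gap`,
`pes_epoch_gap`).

Across epochs, the PL inequality yields quadratic growth (`exists_min_near_of_PL`). Hence P - P_*
shrinks by a factor 1/3 up to the gap, and the squared move of x is controlled as well
(`primal_progress`). That move is the price of recentering the regularizer (`gap_recenter_le`). A
weighted sum of P - P_* and the gap therefore contracts (`lyapunov_step`). The noise, proportional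
to η_k², decays at the same rate e^{-1/16} that is used for the contraction, so it adds up to a
multiple of K e^{-K/16} (`pes_lyapunov`); this explains the two conditions of `EnoughStages`.

For the complexity, minimality of T_k means that the stopping inequality fails at T_k - 1 with
positive probability. With row norms at most δ T^α this is a self-bounding inequality for T_k
(`isLeast_epochLength_le`). These bounds grow geometrically in k, so the last epoch dominates, and
minimality of K bounds its exponential factor (`sum_epochLengths_le`). -/

theorem add_le_of_forall_segment {a b q : ℝ}
    (h : ∀ s ∈ Set.Ioo (0 : ℝ) 1, a ≤ (1 - s) * a + s * b - s * (1 - s) * q) : a + q ≤ b := by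
  have h1 : ∀ s ∈ Set.Ioo (0 : ℝ) 1, (1 - s) * q ≤ b - a := by
    intro s hs
    have := h s hs
    have hs0 := hs.1
    by_contra! hc
    nlinarith
  have ht : Filter.Tendsto (fun s : ℝ => (1 - s) * q) (nhdsWithin 0 (Set.Ioi 0)) (nhds ((1 - 0) * q)) := by
    apply Filter.Tendsto.mono_left _ nhdsWithin_le_nhds
    apply Continuous.tendsto
    fun_prop
  have := le_of_tendsto ht (b := b - a) (by
    filter_upwards [Ioo_mem_nhdsGT (show (0 : ℝ) < 1 by norm_num)] with s hs using h1 s hs)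
  linarith

theorem exists_isMinOn_of_quadratic_growth {E : Type*} [NormedAddCommGroup E] [ProperSpace E]
    {s : Set E} (hs : IsClosed s) {φ : E → ℝ} (hφ : ContinuousOn φ s) {w₀ : E} (hw₀ : w₀ ∈ s)
    {A B c : ℝ} (hc : 0 < c) (h : ∀ w ∈ s, A - B * ‖w - w₀‖ + c * ‖w - w₀‖ ^ 2 ≤ φ w) :
    ∃ x ∈ s, ∀ w ∈ s, φ x ≤ φ w := by
  obtain ⟨x, hx, hm⟩ := hφ.exists_isMinOn' hs hw₀ (by
    rw [Filter.eventually_inf_principal]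
    have ht : Filter.Tendsto (fun w => ‖w - w₀‖) (Filter.cocompact E) Filter.atTop := by
      simpa [dist_eq_norm] using tendsto_dist_right_cocompact_atTop w₀
    filter_upwards [ht.eventually_ge_atTop (1 + (|B| + |φ w₀ - A|) / c)] with w hw hws
    refine le_trans ?_ (h w hws)
    have h1 : (1 : ℝ) ≤ ‖w - w₀‖ := le_trans (by
      have : 0 ≤ (|B| + |φ w₀ - A|) / c := by positivity
      linarith) hw
    have h2 : |B| + |φ w₀ - A| ≤ c * ‖w - w₀‖ := by
      have : (|B| + |φ w₀ - A|) / c ≤ ‖w - w₀‖ := by linarith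
      rwa [div_le_iff₀' hc] at this
    have h3 : (|B| + |φ w₀ - A|) * ‖w - w₀‖ ≤ c * ‖w - w₀‖ * ‖w - w₀‖ := by gcongr
    have h4 : B * ‖w - w₀‖ ≤ |B| * ‖w - w₀‖ := by gcongr; exact le_abs_self B
    have h5 := le_abs_self (φ w₀ - A)
    have h6 : |φ w₀ - A| * 1 ≤ |φ w₀ - A| * ‖w - w₀‖ := by gcongr
    nlinarith)
  exact ⟨x, hx, fun w hw => hm hw⟩

theorem StrongConvexOn.add_sq_le_of_isMin {E : Type*} [NormedAddCommGroup E] [NormedSpace ℝ E]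
    {s : Set E} {m : ℝ} {φ : E → ℝ} (h : StrongConvexOn s m φ) {x w : E} (hx : x ∈ s) (hw : w ∈ s)
    (hmin : ∀ w ∈ s, φ x ≤ φ w) : φ x + m / 2 * ‖w - x‖ ^ 2 ≤ φ w := by
  apply add_le_of_forall_segment
  intro t ht
  obtain ⟨hs, hφ⟩ := h
  have h0 : 0 ≤ 1 - t := by linarith [ht.2]
  have h1 := hφ hx hw h0 ht.1.le (by ring)
  have h2 := hmin _ (hs hx hw h0 ht.1.le (by ring))
  simp only [smul_eq_mul] at h1
  rw [norm_sub_rev w x]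
  linarith

/-! ### Coordinates -/

section Coord

variable {d d' : ℕ}

/-- A coordinate of `z = (x, y)` as a continuous linear functional. -/
noncomputable def coordL (i : Fin d ⊕ Fin d') : Pt d d' →L[ℝ] ℝ :=
  Sum.elim
    (fun i => (EuclideanSpace.proj i : Vec d →L[ℝ] ℝ).comp (ContinuousLinearMap.fst ℝ (Vec d) (Vec d')))
    (fun j => (EuclideanSpace.proj j : Vec d' →L[ℝ] ℝ).comp (ContinuousLinearMap.snd ℝ (Vec d) (Vec d'))) i

theorem coordL_apply (i : Fin d ⊕ Fin d') (z : Pt d d') : coordL i z = coord z i := by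
  cases i <;> rfl

theorem coord_add (z w : Pt d d') (i) : coord (z + w) i = coord z i + coord w i := by
  simp [← coordL_apply]

theorem coord_sub (z w : Pt d d') (i) : coord (z - w) i = coord z i - coord w i := by
  simp [← coordL_apply]

theorem coord_smul (a : ℝ) (z : Pt d d') (i) : coord (a • z) i = a * coord z i := by
  simp [← coordL_apply]

@[fun_prop]
theorem continuous_coord (i : Fin d ⊕ Fin d') : Continuous fun z : Pt d d' => coord z i := by
  simpa [← coordL_apply] using (coordL (d := d) (d' := d') i).continuous

@[fun_prop]
theorem measurable_coord (i : Fin d ⊕ Fin d') : Measurable fun z : Pt d d' => coord z i :=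
  (continuous_coord i).measurable

theorem sum_coord_mul_coord (z w : Pt d d') :
    ∑ i, coord z i * coord w i = ⟪z.1, w.1⟫_ℝ + ⟪z.2, w.2⟫_ℝ := by
  simp [coord, Fintype.sum_sum_type, PiLp.inner_apply, mul_comm]

theorem sum_coord_sq (z : Pt d d') : ∑ i, coord z i ^ 2 = ‖z.1‖ ^ 2 + ‖z.2‖ ^ 2 := by
  simp [coord, Fintype.sum_sum_type, EuclideanSpace.real_norm_sq_eq]

theorem norm_sq_le_sum_coord_sq (z : Pt d d') : ‖z‖ ^ 2 ≤ ∑ i, coord z i ^ 2 := by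
  rw [sum_coord_sq, Prod.norm_def]
  rcases max_cases ‖z.1‖ ‖z.2‖ with h | h <;> rw [h.1] <;> nlinarith [sq_nonneg ‖z.1‖, sq_nonneg ‖z.2‖]

theorem convex_feasible {Y : Set (Vec d')} (hY : Convex ℝ Y) : Convex ℝ (feasible (d := d) Y) := by
  intro z hz w hw a b ha hb hab
  exact hY hz hw ha hb hab

theorem isClosed_feasible {Y : Set (Vec d')} (hY : IsClosed Y) : IsClosed (feasible (d := d) Y) :=
  hY.preimage continuous_snd

/-! ### Separable quadratics -/

/-- The separable quadratic `∑ᵢ (aᵢ zᵢ + (hᵢ / 2) (zᵢ - cᵢ)²)`. -/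
noncomputable def quadObj (a h c : Fin d ⊕ Fin d' → ℝ) (z : Pt d d') : ℝ :=
  ∑ i, (a i * coord z i + h i / 2 * (coord z i - c i) ^ 2)

theorem continuous_quadObj (a h c : Fin d ⊕ Fin d' → ℝ) : Continuous (quadObj a h c) := by
  unfold quadObj; fun_prop

theorem exists_isMinOn_quadObj {Y : Set (Vec d')} (hY : IsClosed Y) {δ : ℝ} (hδ : 0 < δ)
    {a h : Fin d ⊕ Fin d' → ℝ} (hh : ∀ i, δ ≤ h i) (c : Fin d ⊕ Fin d' → ℝ)
    {z₀ : Pt d d'} (hz₀ : z₀ ∈ feasible Y) :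
    ∃ z ∈ feasible Y, ∀ w ∈ feasible Y, quadObj a h c z ≤ quadObj a h c w := by
  -- With u = wᵢ - z₀ᵢ and v = z₀ᵢ - cᵢ, the inequality (u + 2v)² ≥ 0 gives (δ/2)(u + v)² ≥ (δ/4)u²
  -- - (δ/2)v². Half of (δ/4)u² pays for the linear term and the other half is the growth.
  have key : ∀ w, (∑ i, (a i * coord z₀ i - 2 * (a i ^ 2 / δ) - δ * (coord z₀ i - c i) ^ 2 / 2)) -
      0 * ‖w - z₀‖ + δ / 8 * ‖w - z₀‖ ^ 2 ≤ quadObj a h c w := by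
    intro w
    have h1 := norm_sq_le_sum_coord_sq (w - z₀)
    have h2 : δ / 8 * ‖w - z₀‖ ^ 2 ≤ δ / 8 * ∑ i, coord (w - z₀) i ^ 2 := by gcongr
    rw [Finset.mul_sum] at h2
    have h3 : (∑ i, (a i * coord z₀ i - 2 * (a i ^ 2 / δ) - δ * (coord z₀ i - c i) ^ 2 / 2)) +
      ∑ i, δ / 8 * coord (w - z₀) i ^ 2 ≤ quadObj a h c w := by
      rw [← Finset.sum_add_distrib]
      apply Finset.sum_le_sum
      intro i _
      rw [coord_sub]
      set u := coord w i - coord z₀ i with hu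
      set v := coord z₀ i - c i
      have e1 : coord w i - c i = u + v := by simp [u, v]
      have e2 : coord w i = u + coord z₀ i := by simp [u]
      rw [e1, e2]
      have h4 : δ / 2 * (u + v) ^ 2 ≤ h i / 2 * (u + v) ^ 2 := by
        have := hh i; gcongr
      have h5 : 0 ≤ a i * u + 2 * (a i ^ 2 / δ) + δ / 8 * u ^ 2 := by
        have : a i * u + 2 * (a i ^ 2 / δ) + δ / 8 * u ^ 2 = δ / 8 * (u + 4 * a i / δ) ^ 2 := by
          field_simp; ring
        rw [this]; positivity
      nlinarith [sq_nonneg (u + 2 * v)]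
    linarith
  exact exists_isMinOn_of_quadratic_growth (isClosed_feasible hY)
    (continuous_quadObj a h c).continuousOn hz₀ (by positivity) (fun w _ => key w)

theorem quadObj_add_le_of_isMin {Z : Set (Pt d d')} (hZ : Convex ℝ Z)
    {a h c : Fin d ⊕ Fin d' → ℝ} {z w : Pt d d'} (hz : z ∈ Z) (hw : w ∈ Z)
    (hmin : ∀ w ∈ Z, quadObj a h c z ≤ quadObj a h c w) :
    quadObj a h c z + ∑ i, h i / 2 * (coord w i - coord z i) ^ 2 ≤ quadObj a h c w := by
  apply add_le_of_forall_segment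
  intro t ht
  refine (hmin _ (hZ hz hw (a := 1 - t) (b := t) (by linarith [ht.2]) ht.1.le (by ring))).trans
    (le_of_eq ?_)
  simp only [quadObj, Finset.mul_sum, ← Finset.sum_add_distrib, ← Finset.sum_sub_distrib]
  refine Finset.sum_congr rfl fun i _ => ?_
  rw [coord_add, coord_smul, coord_smul]
  ring

/-! ### Dual averaging -/

/-- Regret of dual averaging with increasing diagonal regularizers. -/
theorem dualAveraging_regret {Z : Set (Pt d d')} (hZ : Convex ℝ Z) (g z : ℕ → Pt d d')
    (h : ℕ → Fin d ⊕ Fin d' → ℝ) {η : ℝ} {z₀ : Pt d d'} (hz₀ : z 1 = z₀)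
    (hmono : ∀ t i, h t i ≤ h (t + 1) i) (hpos : ∀ t i, 0 < h t i) (hmem : ∀ t, z (t + 1) ∈ Z)
    (hmin : ∀ t, ∀ w ∈ Z,
      quadObj (fun i => η * ∑ τ ∈ Finset.Icc 1 t, coord (g τ) i) (h t) (coord z₀) (z (t + 1)) ≤
      quadObj (fun i => η * ∑ τ ∈ Finset.Icc 1 t, coord (g τ) i) (h t) (coord z₀) w)
    (T : ℕ) {w : Pt d d'} (hw : w ∈ Z) :
    η * ∑ t ∈ Finset.Icc 1 T, ∑ i, coord (g t) i * (coord (z t) i - coord w i) ≤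
      ∑ i, h T i / 2 * (coord w i - coord z₀ i) ^ 2 +
        η ^ 2 / 2 * ∑ t ∈ Finset.Icc 1 T, ∑ i, coord (g t) i ^ 2 / h (t - 1) i := by
  set S : ℕ → Fin d ⊕ Fin d' → ℝ := fun t i => η * ∑ τ ∈ Finset.Icc 1 t, coord (g τ) i with hS
  -- The invariant compares with the minimum value of the current objective. In the induction step
  -- the strong convexity of the old objective at its minimizer supplies a quadratic term, and
  -- completing the square in the move from z_{n+1} to z_{n+2} costs exactly (η²/2) g²/h_n. The old
  -- weight h_n appears, hence the index t - 1.
  have key : ∀ T, η * ∑ t ∈ Finset.Icc 1 T, ∑ i, coord (g t) i * coord (z t) i -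
      η ^ 2 / 2 * ∑ t ∈ Finset.Icc 1 T, ∑ i, coord (g t) i ^ 2 / h (t - 1) i ≤
      quadObj (S T) (h T) (coord z₀) (z (T + 1)) := by
    intro T
    induction T with
    | zero => simp [quadObj, hS, hz₀]
    | succ n ih =>
      rw [Finset.sum_Icc_succ_top (by omega), Finset.sum_Icc_succ_top (by omega)]
      have h3 := quadObj_add_le_of_isMin hZ (hmem n) (hmem (n + 1)) (hmin n)
      have h4 : quadObj (S n) (h n) (coord z₀) (z (n + 1 + 1)) +
          η * ∑ i, coord (g (n + 1)) i * coord (z (n + 1 + 1)) i ≤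
          quadObj (S (n + 1)) (h (n + 1)) (coord z₀) (z (n + 1 + 1)) := by
        simp only [quadObj, Finset.mul_sum, ← Finset.sum_add_distrib]
        refine Finset.sum_le_sum fun i _ => ?_
        have e : S (n + 1) i = S n i + η * coord (g (n + 1)) i := by
          simp only [hS]; rw [Finset.sum_Icc_succ_top (by omega)]; ring
        have := hmono n i
        have h5 : h n i / 2 * (coord (z (n + 1 + 1)) i - coord z₀ i) ^ 2 ≤
          h (n + 1) i / 2 * (coord (z (n + 1 + 1)) i - coord z₀ i) ^ 2 := by gcongr
        rw [e]; linarith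
      have h6 : η * ∑ i, coord (g (n + 1)) i * coord (z (n + 1)) i -
          η ^ 2 / 2 * ∑ i, coord (g (n + 1)) i ^ 2 / h n i ≤
          η * ∑ i, coord (g (n + 1)) i * coord (z (n + 1 + 1)) i +
          ∑ i, h n i / 2 * (coord (z (n + 1 + 1)) i - coord (z (n + 1)) i) ^ 2 := by
        simp only [Finset.mul_sum, ← Finset.sum_add_distrib, ← Finset.sum_sub_distrib]
        refine Finset.sum_le_sum fun i _ => ?_
        have hp := hpos n i
        set u := coord (z (n + 1 + 1)) i
        set v := coord (z (n + 1)) i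
        set γ := coord (g (n + 1)) i
        have : 0 ≤ h n i / 2 * (u - v + η * γ / h n i) ^ 2 := by positivity
        have e : h n i / 2 * (u - v + η * γ / h n i) ^ 2 =
          h n i / 2 * (u - v) ^ 2 + η * (γ * u) - η * (γ * v) + η ^ 2 / 2 * (γ ^ 2 / h n i) := by
          field_simp; ring
        linarith
      simp only [Nat.add_sub_cancel]
      have hz : S n = fun i => η * ∑ τ ∈ Finset.Icc 1 n, coord (g τ) i := rfl
      rw [← hz] at h3
      linarith
  have h1 := (key T).trans (hmin T w hw)
  have h2 : quadObj (S T) (h T) (coord z₀) w =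
      η * ∑ t ∈ Finset.Icc 1 T, ∑ i, coord (g t) i * coord w i +
        ∑ i, h T i / 2 * (coord w i - coord z₀ i) ^ 2 := by
    rw [Finset.sum_comm]
    simp only [quadObj, hS, Finset.sum_add_distrib, Finset.mul_sum, Finset.sum_mul]
    simp only [mul_assoc]
  have hz : S T = fun i => η * ∑ τ ∈ Finset.Icc 1 T, coord (g τ) i := rfl
  rw [← hz, h2] at h1
  simp only [mul_sub, Finset.sum_sub_distrib]
  linarith

/-- Regret of unconstrained one-dimensional dual averaging, whose iterates are
`-η (n_1 + ⋯ + n_{t-1}) / h_{t-1}`. -/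
theorem scalar_dualAveraging_regret (n h : ℕ → ℝ) (η : ℝ)
    (hmono : ∀ t, h t ≤ h (t + 1)) (hpos : ∀ t, 0 < h t) (T : ℕ) (u : ℝ) :
    η * ∑ t ∈ Finset.Icc 1 T, n t * (-η * (∑ τ ∈ Finset.Icc 1 (t - 1), n τ) / h (t - 1) - u) ≤
      h T / 2 * u ^ 2 + η ^ 2 / 2 * ∑ t ∈ Finset.Icc 1 T, n t ^ 2 / h (t - 1) := by
  set N : ℕ → ℝ := fun t => ∑ τ ∈ Finset.Icc 1 t, n τ with hN
  -- The term -η² N²/(2h) is the minimum over u of η N u + h u²/2, so this is the same invariant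
  -- with the minimum in closed form.
  have key : ∀ T, η * ∑ t ∈ Finset.Icc 1 T, n t * (-η * N (t - 1) / h (t - 1)) ≤
      η ^ 2 / 2 * ∑ t ∈ Finset.Icc 1 T, n t ^ 2 / h (t - 1) - η ^ 2 / 2 * (N T ^ 2 / h T) := by
    intro T
    induction T with
    | zero => simp [hN]
    | succ k ih =>
      rw [Finset.sum_Icc_succ_top (by omega), Finset.sum_Icc_succ_top (by omega)]
      simp only [Nat.add_sub_cancel]
      have e : N (k + 1) = N k + n (k + 1) := by
        simp only [hN]; rw [Finset.sum_Icc_succ_top (by omega)]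
      have h1 : N (k + 1) ^ 2 / h (k + 1) ≤ N (k + 1) ^ 2 / h k :=
        div_le_div_of_nonneg_left (sq_nonneg _) (hpos k) (hmono k)
      have h2 : N (k + 1) ^ 2 / h k =
          N k ^ 2 / h k + 2 * (n (k + 1) * N k / h k) + n (k + 1) ^ 2 / h k := by
        rw [e]; field_simp [(hpos k).ne']; ring
      have h3 : η * (n (k + 1) * (-η * N k / h k)) = -η ^ 2 * (n (k + 1) * N k / h k) := by ring
      have h4 : η ^ 2 / 2 * (N (k + 1) ^ 2 / h (k + 1)) ≤ η ^ 2 / 2 * (N k ^ 2 / h k +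
          2 * (n (k + 1) * N k / h k) + n (k + 1) ^ 2 / h k) := by
        rw [← h2]; gcongr
      rw [mul_add, h3]
      nlinarith
  have h1 := key T
  have h2 : η * ∑ t ∈ Finset.Icc 1 T, n t * (-η * N (t - 1) / h (t - 1) - u) =
      η * ∑ t ∈ Finset.Icc 1 T, n t * (-η * N (t - 1) / h (t - 1)) - η * (N T * u) := by
    simp only [mul_sub, Finset.sum_sub_distrib, hN, Finset.sum_mul]
  have h3 : 0 ≤ h T / 2 * (u + η * N T / h T) ^ 2 := by
    have := hpos T; positivity
  have h4 : h T / 2 * (u + η * N T / h T) ^ 2 =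
      h T / 2 * u ^ 2 + η * (N T * u) + η ^ 2 / 2 * (N T ^ 2 / h T) := by
    have := (hpos T).ne'
    field_simp; ring
  rw [h2]
  linarith

/-! ### AdaGrad step sizes -/

theorem rowNorm_nonneg (g : ℕ → Pt d d') (t : ℕ) (i) : 0 ≤ rowNorm g t i := Real.sqrt_nonneg _

theorem rowNorm_zero (g : ℕ → Pt d d') (i) : rowNorm g 0 i = 0 := by simp [rowNorm]

theorem rowNorm_succ_sq (g : ℕ → Pt d d') (t : ℕ) (i) :
    rowNorm g (t + 1) i ^ 2 = rowNorm g t i ^ 2 + coord (g (t + 1)) i ^ 2 := by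
  unfold rowNorm
  rw [Real.sq_sqrt (Finset.sum_nonneg fun _ _ => sq_nonneg _),
    Real.sq_sqrt (Finset.sum_nonneg fun _ _ => sq_nonneg _), Finset.sum_Icc_succ_top (by omega)]

theorem rowNorm_mono (g : ℕ → Pt d d') (i) : Monotone fun t => rowNorm g t i := by
  apply monotone_nat_of_le_succ
  intro t
  have := rowNorm_succ_sq g t i
  exact (pow_le_pow_iff_left₀ (rowNorm_nonneg g t i) (rowNorm_nonneg g (t + 1) i) two_ne_zero).1
    (by nlinarith [sq_nonneg (coord (g (t + 1)) i)])

theorem rowNorm_congr {g g' : ℕ → Pt d d'} {t : ℕ} (h : ∀ τ ∈ Finset.Icc 1 t, g τ = g' τ) (i) :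
    rowNorm g t i = rowNorm g' t i := by
  unfold rowNorm
  rw [Finset.sum_congr rfl fun τ hτ => by rw [h τ hτ]]

/-- Telescoping: with s, s' the row norms before and after a step, g² = (s' - s)(s' + s). The bound
|g| ≤ δ gives s' ≤ δ + s, so s' + s is at most twice the denominator δ + s. This is why the weights
with one step of delay suffice. -/
theorem sum_sq_div_le_two_mul_rowNorm (g : ℕ → Pt d d') {δ : ℝ} (hδ : 0 < δ) (i) (T : ℕ)
    (hg : ∀ t ∈ Finset.Icc 1 T, |coord (g t) i| ≤ δ) :
    ∑ t ∈ Finset.Icc 1 T, coord (g t) i ^ 2 / (δ + rowNorm g (t - 1) i) ≤ 2 * rowNorm g T i := by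
  induction T with
  | zero => simp [rowNorm_zero]
  | succ n ih =>
    rw [Finset.sum_Icc_succ_top (by omega)]
    have h1 := ih fun t ht => hg t (Finset.Icc_subset_Icc_right (by omega) ht)
    have h2 := hg (n + 1) (by simp)
    have h3 := rowNorm_succ_sq g n i
    have h4 := rowNorm_nonneg g n i
    have h5 : rowNorm g n i ≤ rowNorm g (n + 1) i := rowNorm_mono g i (Nat.le_succ n)
    simp only [Nat.add_sub_cancel]
    suffices coord (g (n + 1)) i ^ 2 / (δ + rowNorm g n i) ≤
        2 * (rowNorm g (n + 1) i - rowNorm g n i) by linarith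
    rw [div_le_iff₀ (by linarith)]
    set s := rowNorm g n i
    set s' := rowNorm g (n + 1) i
    have h6 : s' ≤ δ + s := by
      refine (pow_le_pow_iff_left₀ (by linarith) (by linarith) two_ne_zero).1 ?_
      have : coord (g (n + 1)) i ^ 2 ≤ δ ^ 2 := sq_le_sq' (by linarith [abs_le.1 h2]) (abs_le.1 h2).2
      nlinarith
    nlinarith

end Coord

/-! ### The iterates of AdaGrad -/

section Iterates

theorem argminOn_spec {α : Type*} [Nonempty α] {S : Set α} {φ : α → ℝ}
    (h : ∃ z ∈ S, ∀ w ∈ S, φ z ≤ φ w) :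
    argminOn S φ ∈ S ∧ ∀ w ∈ S, φ (argminOn S φ) ≤ φ w :=
  Classical.epsilon_spec (p := fun z => z ∈ S ∧ ∀ w ∈ S, φ z ≤ φ w) h

theorem argminOn_congr {α : Type*} [Nonempty α] (S : Set α) {φ φ' : α → ℝ}
    (h : ∀ z w, φ z ≤ φ w ↔ φ' z ≤ φ' w) : argminOn S φ = argminOn S φ' := by
  unfold argminOn
  simp only [h]

variable {d d' : ℕ}

/-- The minimizer over `ℝ^d × Y` of the quadratic with linear part `p.1`, weights `δ + |p.2.1|`
and center `p.2.2`. -/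
noncomputable def quadArgmin (Y : Set (Vec d')) (δ : ℝ)
    (p : (Fin d ⊕ Fin d' → ℝ) × (Fin d ⊕ Fin d' → ℝ) × (Fin d ⊕ Fin d' → ℝ)) : Pt d d' :=
  argminOn (feasible Y) (quadObj p.1 (fun i => δ + |p.2.1 i|) p.2.2)

theorem quadArgmin_spec {Y : Set (Vec d')} (hY : IsClosed Y) (hne : Y.Nonempty) {δ : ℝ}
    (hδ : 0 < δ) (p : (Fin d ⊕ Fin d' → ℝ) × (Fin d ⊕ Fin d' → ℝ) × (Fin d ⊕ Fin d' → ℝ)) :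
    quadArgmin Y δ p ∈ feasible Y ∧ ∀ w ∈ feasible Y,
      quadObj p.1 (fun i => δ + |p.2.1 i|) p.2.2 (quadArgmin Y δ p) ≤
        quadObj p.1 (fun i => δ + |p.2.1 i|) p.2.2 w := by
  obtain ⟨y, hy⟩ := hne
  exact argminOn_spec (exists_isMinOn_quadObj hY hδ (fun i => by linarith [abs_nonneg (p.2.1 i)]) _
    (z₀ := (0, y)) hy)

/-- This is the source of measurability of the iterates, whose definition uses a choice operator.
Adding the strong minimality inequalities of two parameters bounds the distance of their minimizers
by 1/δ times the difference of the two gradients at one of them, and that difference is continuous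
in the parameters. The absolute value in the weights keeps them at least δ on the whole parameter
space. -/
theorem continuous_quadArgmin {Y : Set (Vec d')} (hY : IsClosed Y) (hYc : Convex ℝ Y)
    (hne : Y.Nonempty) {δ : ℝ} (hδ : 0 < δ) :
    Continuous (quadArgmin (d := d) Y δ) := by
  rw [continuous_iff_continuousAt]
  intro p₀
  set z := quadArgmin (d := d) Y δ p₀ with hz
  obtain ⟨hz1, hz2⟩ := quadArgmin_spec (d := d) hY hne hδ p₀
  let D : (Fin d ⊕ Fin d' → ℝ) × (Fin d ⊕ Fin d' → ℝ) × (Fin d ⊕ Fin d' → ℝ) →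
      Fin d ⊕ Fin d' → ℝ := fun p i => p.1 i + (δ + |p.2.1 i|) * (coord z i - p.2.2 i)
  have key : ∀ p, ‖quadArgmin Y δ p - z‖ ^ 2 ≤ ∑ i, (D p i - D p₀ i) ^ 2 / δ ^ 2 := by
    intro p
    obtain ⟨hw1, hw2⟩ := quadArgmin_spec (d := d) hY hne hδ p
    set w := quadArgmin Y δ p
    refine (norm_sq_le_sum_coord_sq _).trans ?_
    have h1 := quadObj_add_le_of_isMin (convex_feasible hYc) hw1 hz1 hw2
    have h2 := quadObj_add_le_of_isMin (convex_feasible hYc) hz1 hw1 hz2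
    have h3 := add_le_add h1 h2
    have h4 : 0 ≤ ∑ i, (δ / 2 * ((D p i - D p₀ i) ^ 2 / δ ^ 2) - δ / 2 * coord (w - z) i ^ 2) := by
      refine le_trans (sub_nonneg.2 h3) ?_
      simp only [quadObj, ← Finset.sum_add_distrib, ← Finset.sum_sub_distrib]
      refine Finset.sum_le_sum fun i _ => ?_
      simp only [coord_sub, D]
      rw [← hz]
      set u := coord w i
      set v := coord z i
      set r := |p.2.1 i|
      set r₀ := |p₀.2.1 i|
      set E := (p.1 i + (δ + r) * (v - p.2.2 i)) - (p₀.1 i + (δ + r₀) * (v - p₀.2.2 i)) with hE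
      have hr : 0 ≤ r := abs_nonneg _
      have e : δ / 2 * (E ^ 2 / δ ^ 2) = E ^ 2 / (2 * δ) := by field_simp
      rw [e]
      have h5 : 0 ≤ E ^ 2 / (2 * δ) + δ / 2 * (u - v) ^ 2 + (u - v) * E := by
        have : E ^ 2 / (2 * δ) + δ / 2 * (u - v) ^ 2 + (u - v) * E =
          δ / 2 * ((u - v) + E / δ) ^ 2 := by field_simp; ring
        rw [this]; positivity
      have h6 : 0 ≤ r * (u - v) ^ 2 := by positivity
      have h7 : (p.1 i * v + (δ + r) / 2 * (v - p.2.2 i) ^ 2 + (p₀.1 i * u + (δ + r₀) / 2 * (u - p₀.2.2 i) ^ 2)) -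
        ((p.1 i * u + (δ + r) / 2 * (u - p.2.2 i) ^ 2 + (δ + r) / 2 * (v - u) ^ 2) +
        (p₀.1 i * v + (δ + r₀) / 2 * (v - p₀.2.2 i) ^ 2 + (δ + r₀) / 2 * (u - v) ^ 2)) =
        -(u - v) * E - (δ + r) * (u - v) ^ 2 := by rw [hE]; ring
      rw [h7]; nlinarith
    rw [Finset.sum_sub_distrib, ← Finset.mul_sum, ← Finset.mul_sum] at h4
    have : δ / 2 * ∑ i, coord (w - z) i ^ 2 ≤ δ / 2 * ∑ i, (D p i - D p₀ i) ^ 2 / δ ^ 2 := by linarith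
    exact le_of_mul_le_mul_left this (by positivity)
  have hD : Continuous fun p => ∑ i, (D p i - D p₀ i) ^ 2 / δ ^ 2 := by
    simp only [D]; fun_prop
  have ht : Filter.Tendsto (fun p => Real.sqrt (∑ i, (D p i - D p₀ i) ^ 2 / δ ^ 2)) (nhds p₀)
      (nhds 0) := by
    have := (hD.sqrt).tendsto p₀
    simpa using this
  rw [ContinuousAt, tendsto_iff_norm_sub_tendsto_zero]
  exact squeeze_zero (fun _ => norm_nonneg _) (fun p => Real.le_sqrt_of_sq_le (key p)) ht

theorem adaObjective_eq (z₀ : Pt d d') (δ η : ℝ) (t : ℕ) (g : ℕ → Pt d d') (z : Pt d d') :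
    adaObjective z₀ δ η t g z = 1 / (t : ℝ) *
      quadObj (fun i => η * ∑ τ ∈ Finset.Icc 1 t, coord (g τ) i) (fun i => δ + |rowNorm g t i|)
        (coord z₀) z := by
  simp only [adaObjective, quadObj, Finset.sum_add_distrib, Finset.mul_sum, mul_add,
    abs_of_nonneg (rowNorm_nonneg g t _)]
  congr 1
  · refine Finset.sum_congr rfl fun i _ => ?_
    simp only [Finset.sum_mul, Finset.mul_sum]
    exact Finset.sum_congr rfl fun τ _ => by ring
  · exact Finset.sum_congr rfl fun i _ => by ring

/-- The factor 1/t does not change which points are minimizers, and the choice in `argminOn` depends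
only on that predicate, so the chosen points agree. -/
theorem adaIterate_add_two (Y : Set (Vec d')) (g : ℕ → Pt d d' → Pt d d') (z₀ : Pt d d')
    (δ η : ℝ) (t : ℕ) :
    adaIterate (feasible Y) g z₀ δ η (t + 2) = quadArgmin Y δ
      (fun i => η * ∑ τ ∈ Finset.Icc 1 (t + 1), coord (g τ (adaIterate (feasible Y) g z₀ δ η τ)) i,
        fun i => rowNorm (fun τ => g τ (adaIterate (feasible Y) g z₀ δ η τ)) (t + 1) i,
        coord z₀) := by
  rw [adaIterate, quadArgmin]
  apply argminOn_congr
  intro z w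
  rw [adaObjective_eq, adaObjective_eq, mul_le_mul_iff_right₀ (by positivity)]
  have e : ∀ τ ∈ Finset.Icc 1 (t + 1),
      (if _h : τ ≤ t + 1 then g τ (adaIterate (feasible Y) g z₀ δ η τ) else 0) =
        g τ (adaIterate (feasible Y) g z₀ δ η τ) := by
    intro τ hτ
    rw [dif_pos (Finset.mem_Icc.1 hτ).2]
  have e1 : ∀ i, ∑ τ ∈ Finset.Icc 1 (t + 1),
      coord (if _h : τ ≤ t + 1 then g τ (adaIterate (feasible Y) g z₀ δ η τ) else 0) i =
      ∑ τ ∈ Finset.Icc 1 (t + 1), coord (g τ (adaIterate (feasible Y) g z₀ δ η τ)) i :=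
    fun i => Finset.sum_congr rfl fun τ hτ => by rw [e τ hτ]
  simp only [e1, rowNorm_congr e]

theorem adaIterate_one (Z : Set (Pt d d')) (g : ℕ → Pt d d' → Pt d d') (z₀ : Pt d d')
    (δ η : ℝ) : adaIterate Z g z₀ δ η 1 = z₀ := by rw [adaIterate]

theorem adaIterate_spec {Y : Set (Vec d')} (hY : IsClosed Y) (g : ℕ → Pt d d' → Pt d d')
    {z₀ : Pt d d'} (hz₀ : z₀ ∈ feasible Y) {δ : ℝ} (hδ : 0 < δ) (η : ℝ) (t : ℕ) :
    adaIterate (feasible Y) g z₀ δ η (t + 1) ∈ feasible Y ∧ ∀ w ∈ feasible Y,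
      quadObj (fun i => η * ∑ τ ∈ Finset.Icc 1 t, coord (g τ (adaIterate (feasible Y) g z₀ δ η τ)) i)
        (fun i => δ + rowNorm (fun τ => g τ (adaIterate (feasible Y) g z₀ δ η τ)) t i) (coord z₀)
        (adaIterate (feasible Y) g z₀ δ η (t + 1)) ≤
      quadObj (fun i => η * ∑ τ ∈ Finset.Icc 1 t, coord (g τ (adaIterate (feasible Y) g z₀ δ η τ)) i)
        (fun i => δ + rowNorm (fun τ => g τ (adaIterate (feasible Y) g z₀ δ η τ)) t i) (coord z₀)
        w := by
  cases t with
  | zero =>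
    -- For t = 0 there is no linear part and all weights equal δ, so the starting point is itself
    -- the minimizer. The first iterate thus fits the general pattern.
    rw [zero_add, adaIterate_one]
    refine ⟨hz₀, fun w _ => ?_⟩
    simp only [quadObj, rowNorm_zero, Finset.Icc_eq_empty (show ¬ (1 ≤ 0) by omega),
      Finset.sum_empty, mul_zero, zero_mul, zero_add, sub_self, add_zero]
    refine Finset.sum_le_sum fun i _ => ?_
    have : 0 ≤ δ / 2 * (coord w i - coord z₀ i) ^ 2 := by positivity
    simpa using this
  | succ t =>
    rw [adaIterate_add_two]
    have h := quadArgmin_spec hY ⟨_, hz₀⟩ hδ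
      (fun i => η * ∑ τ ∈ Finset.Icc 1 (t + 1), coord (g τ (adaIterate (feasible Y) g z₀ δ η τ)) i,
        fun i => rowNorm (fun τ => g τ (adaIterate (feasible Y) g z₀ δ η τ)) (t + 1) i, coord z₀)
    simpa only [abs_of_nonneg (rowNorm_nonneg _ _ _)] using h

theorem adaIterate_mem {Y : Set (Vec d')} (hY : IsClosed Y) (g : ℕ → Pt d d' → Pt d d')
    {z₀ : Pt d d'} (hz₀ : z₀ ∈ feasible Y) {δ : ℝ} (hδ : 0 < δ) (η : ℝ) (t : ℕ) :
    adaIterate (feasible Y) g z₀ δ η t ∈ feasible Y := by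
  cases t with
  | zero => rw [adaIterate]; exact hz₀
  | succ t => exact (adaIterate_spec hY g hz₀ hδ η t).1

theorem pesPoint_mem {Ξ : Type*} {Y : Set (Vec d')} (hY : IsClosed Y) (hYc : Convex ℝ Y)
    (G : Pt d d' → Ξ → Pt d d') (γ : ℝ) {δ : ℝ} (hδ : 0 < δ) (η : ℕ → ℝ) (T : ℕ → ℕ)
    (s : ℕ → ℕ → Ξ) {z₀ : Pt d d'} (hz₀ : z₀ ∈ feasible Y) (k : ℕ)
    (hT : ∀ j ∈ Finset.Icc 1 k, 1 ≤ T j) :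
    pesPoint Y G γ δ η T s z₀ k ∈ feasible Y := by
  induction k with
  | zero => exact hz₀
  | succ k ih =>
    have h0 := ih fun j hj => hT j (Finset.Icc_subset_Icc_right (by omega) hj)
    have h1 := hT (k + 1) (by simp)
    rw [pesPoint, Finset.smul_sum]
    refine (convex_feasible hYc).sum_mem (fun _ _ => by positivity) ?_
      fun t _ => adaIterate_mem hY _ h0 hδ _ t
    have : (T (k + 1) : ℝ) ≠ 0 := by positivity
    simp [this]

/-! ### Measurability of the iterates -/

variable {Ω Ξ : Type*} [MeasurableSpace Ω] [MeasurableSpace Ξ]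

theorem measurable_rowNorm {g : Ω → ℕ → Pt d d'} {t : ℕ}
    (hg : ∀ τ ∈ Finset.Icc 1 t, Measurable fun ω => g ω τ) (i) :
    Measurable fun ω => rowNorm (g ω) t i := by
  unfold rowNorm
  refine Measurable.sqrt ?_
  exact Finset.measurable_fun_sum _ fun τ hτ => ((measurable_coord i).comp (hg τ hτ)).pow_const 2

theorem measurable_adaIterate {Y : Set (Vec d')} (hY : IsClosed Y) (hYc : Convex ℝ Y)
    (hne : Y.Nonempty) {δ : ℝ} (hδ : 0 < δ) (η : ℝ) {z₀ : Ω → Pt d d'} (hz₀ : Measurable z₀)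
    (g : Ω → ℕ → Pt d d' → Pt d d') (t : ℕ)
    (hg : ∀ τ, 1 ≤ τ → τ < t → Measurable fun p : Ω × Pt d d' => g p.1 τ p.2) :
    Measurable fun ω => adaIterate (feasible Y) (g ω) (z₀ ω) δ η t := by
  induction t using Nat.strong_induction_on with
  | _ t ih =>
    match t with
    | 0 => simpa only [adaIterate] using hz₀
    | 1 => simpa only [adaIterate] using hz₀
    | t + 2 =>
      have h1 : ∀ τ ∈ Finset.Icc 1 (t + 1), Measurable fun ω =>
          g ω τ (adaIterate (feasible Y) (g ω) (z₀ ω) δ η τ) := by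
        intro τ hτ
        rw [Finset.mem_Icc] at hτ
        exact (hg τ hτ.1 (by omega)).comp (measurable_id.prodMk
          (ih τ (by omega) fun τ' h1 h2 => hg τ' h1 (by omega)))
      simp only [adaIterate_add_two]
      refine (continuous_quadArgmin hY hYc hne hδ).measurable.comp ?_
      refine Measurable.prodMk ?_ (Measurable.prodMk ?_ ?_)
      · refine measurable_pi_lambda _ fun i => Measurable.const_mul ?_ _
        exact Finset.measurable_fun_sum _ fun τ hτ => (measurable_coord i).comp (h1 τ hτ)
      · exact measurable_pi_lambda _ fun i => measurable_rowNorm h1 i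
      · exact measurable_pi_lambda _ fun i => (measurable_coord i).comp hz₀

theorem measurable_proxGrad {G : Pt d d' → Ξ → Pt d d'} (hG : Measurable (Function.uncurry G))
    (γ : ℝ) : Measurable fun p : Vec d × Ξ × Pt d d' => proxGrad G γ p.1 p.2.1 p.2.2 := by
  unfold proxGrad
  have h1 : Measurable fun p : Vec d × Ξ × Pt d d' => G p.2.2 p.2.1 :=
    hG.comp (f := fun p : Vec d × Ξ × Pt d d' => (p.2.2, p.2.1)) (by fun_prop)
  have h2 : Measurable fun p : Vec d × Ξ × Pt d d' => (γ • (p.2.2.1 - p.1), (0 : Vec d')) := by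
    fun_prop
  exact h1.add h2

theorem measurable_epochIterate {Y : Set (Vec d')} (hY : IsClosed Y) (hYc : Convex ℝ Y)
    (hne : Y.Nonempty) {G : Pt d d' → Ξ → Pt d d'} (hG : Measurable (Function.uncurry G))
    (γ : ℝ) {δ : ℝ} (hδ : 0 < δ) (η : ℝ) {s : ℕ → Ω → Ξ} {z₀ : Ω → Pt d d'}
    (hz₀ : Measurable z₀) (t : ℕ) (hs : ∀ τ, 1 ≤ τ → τ < t → Measurable (s τ)) :
    Measurable fun ω => epochIterate Y G γ δ η (fun τ => s τ ω) (z₀ ω) t := by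
  unfold epochIterate
  refine measurable_adaIterate hY hYc hne hδ η hz₀ _ t fun τ h1 h2 => ?_
  have := hs τ h1 h2
  exact (measurable_proxGrad hG γ).comp
    (f := fun p : Ω × Pt d d' => ((z₀ p.1).1, s τ p.1, p.2)) (by fun_prop)

theorem measurable_epochGrad {Y : Set (Vec d')} (hY : IsClosed Y) (hYc : Convex ℝ Y)
    (hne : Y.Nonempty) {G : Pt d d' → Ξ → Pt d d'} (hG : Measurable (Function.uncurry G))
    (γ : ℝ) {δ : ℝ} (hδ : 0 < δ) (η : ℝ) {s : ℕ → Ω → Ξ} {z₀ : Ω → Pt d d'}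
    (hz₀ : Measurable z₀) (t : ℕ) (ht : 1 ≤ t) (hs : ∀ τ, 1 ≤ τ → τ ≤ t → Measurable (s τ)) :
    Measurable fun ω => epochGrad Y G γ δ η (fun τ => s τ ω) (z₀ ω) t := by
  unfold epochGrad
  have h1 := measurable_epochIterate hY hYc hne hG γ hδ η hz₀ t fun τ a b => hs τ a b.le
  have h2 := hs t ht le_rfl
  exact (measurable_proxGrad hG γ).comp (f := fun ω : Ω => ((z₀ ω).1, s t ω,
    epochIterate Y G γ δ η (fun τ => s τ ω) (z₀ ω) t)) (by fun_prop)

theorem measurable_pesPoint {Y : Set (Vec d')} (hY : IsClosed Y) (hYc : Convex ℝ Y)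
    (hne : Y.Nonempty) {G : Pt d d' → Ξ → Pt d d'} (hG : Measurable (Function.uncurry G))
    (γ : ℝ) {δ : ℝ} (hδ : 0 < δ) (η : ℕ → ℝ) (T : ℕ → ℕ) {s : ℕ → ℕ → Ω → Ξ} (z₀ : Pt d d')
    (k : ℕ) (hs : ∀ j ≤ k, ∀ t, Measurable (s j t)) :
    Measurable fun ω => pesPoint Y G γ δ η T (fun j t => s j t ω) z₀ k := by
  induction k with
  | zero => simp only [pesPoint]; fun_prop
  | succ k ih =>
    simp only [pesPoint]
    have h : Measurable fun ω => ∑ t ∈ Finset.Icc 1 (T (k + 1)),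
        epochIterate Y G γ δ (η (k + 1)) (fun t => s (k + 1) t ω)
          (pesPoint Y G γ δ η T (fun j t => s j t ω) z₀ k) t :=
      Finset.measurable_fun_sum _ fun t _ => measurable_epochIterate hY hYc hne hG γ hδ _
        (ih fun j hj => hs j (by omega)) t fun τ _ _ => hs _ le_rfl τ
    exact h.const_smul (1 / (T (k + 1) : ℝ))

end Iterates

/-! ### Strong convexity and gradients -/

theorem le_derivWithin_of_le_slope {u : ℝ → ℝ} {u' : ℝ} (hu : HasDerivWithinAt u u' (Set.Ioo 0 1) 0)
    {m : ℝ → ℝ} (hm : Continuous m) (h : ∀ s ∈ Set.Ioo (0 : ℝ) 1, u 0 + s * m s ≤ u s) :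
    m 0 ≤ u' := by
  rw [hasDerivWithinAt_iff_tendsto_slope' (by simp), nhdsWithin_Ioo_eq_nhdsGT one_pos] at hu
  have hm' : Filter.Tendsto m (nhdsWithin 0 (Set.Ioi 0)) (nhds (m 0)) :=
    hm.tendsto 0 |>.mono_left nhdsWithin_le_nhds
  refine le_of_tendsto_of_tendsto hm' hu ?_
  filter_upwards [Ioo_mem_nhdsGT (show (0 : ℝ) < 1 by norm_num)] with s hs
  rw [slope_def_field, sub_zero, le_div_iff₀ hs.1]
  linarith [h s hs]

/-- Strong concavity on the segment bounds the slope at time t from below, with quadratic term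
weighted by 1 - t; let t tend to 0. Only the derivative within `s` along the segment enters, so `y`
may lie on the boundary. -/
theorem StrongConcaveOn.le_add_inner_gradient {E : Type*} [NormedAddCommGroup E]
    [InnerProductSpace ℝ E] [CompleteSpace E] {s : Set E} {m : ℝ} {φ : E → ℝ}
    (h : StrongConcaveOn s m φ) {y y' v : E} (hy : y ∈ s) (hy' : y' ∈ s)
    (hv : HasGradientWithinAt φ v s y) :
    φ y' ≤ φ y + ⟪v, y' - y⟫_ℝ - m / 2 * ‖y' - y‖ ^ 2 := by
  obtain ⟨hs, hφ⟩ := h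
  have hline : HasDerivWithinAt (fun t : ℝ => y + t • (y' - y)) (y' - y) (Set.Ioo 0 1) 0 := by
    simpa using (((hasDerivAt_id (0 : ℝ)).smul_const (y' - y)).const_add y).hasDerivWithinAt
  have hmaps : Set.MapsTo (fun t : ℝ => y + t • (y' - y)) (Set.Ioo 0 1) s := by
    intro t ht
    have := hs hy hy' (a := 1 - t) (b := t) (by linarith [ht.2]) ht.1.le (by ring)
    convert this using 1
    module
  have hd := HasFDerivWithinAt.comp_hasDerivWithinAt_of_eq (0 : ℝ) hv.hasFDerivWithinAt hline hmaps
    (by simp)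
  have := le_derivWithin_of_le_slope hd
    (m := fun t => φ y' - φ y + (1 - t) * (m / 2 * ‖y' - y‖ ^ 2)) (by fun_prop) (by
      intro t ht
      have h1 := hφ hy hy' (by linarith [ht.2] : 0 ≤ 1 - t) ht.1.le (by ring)
      have e : (1 - t) • y + t • y' = y + t • (y' - y) := by module
      rw [e, norm_sub_rev y y'] at h1
      simp only [smul_eq_mul] at h1
      simp only [Function.comp_apply, zero_smul, add_zero]
      linarith)
  simp only [InnerProductSpace.toDual_apply_apply] at this
  linarith

theorem strongConvexOn_univ_of_inner_le {E : Type*} [NormedAddCommGroup E] [InnerProductSpace ℝ E]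
    {m : ℝ} {φ : E → ℝ} {v : E → E}
    (h : ∀ x x', φ x' + ⟪v x', x - x'⟫_ℝ + m / 2 * ‖x - x'‖ ^ 2 ≤ φ x) :
    StrongConvexOn Set.univ m φ := by
  refine ⟨convex_univ, fun x _ w _ a b ha hb hab => ?_⟩
  obtain rfl : a = 1 - b := by linarith
  set u := (1 - b) • x + b • w with hu
  have h1 := h x u
  have h2 := h w u
  have e1 : x - u = b • (x - w) := by rw [hu]; module
  have e2 : w - u = (-(1 - b)) • (x - w) := by rw [hu]; module
  rw [e1, inner_smul_right, norm_smul, mul_pow, Real.norm_eq_abs, sq_abs] at h1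
  rw [e2, inner_smul_right, norm_smul, mul_pow, Real.norm_eq_abs, sq_abs] at h2
  simp only [smul_eq_mul]
  have h3 := mul_le_mul_of_nonneg_left h1 ha
  have h4 := mul_le_mul_of_nonneg_left h2 hb
  nlinarith

/-- Quadratic growth from the Polyak–Łojasiewicz inequality. -/
theorem exists_min_near_of_PL {E : Type*} [NormedAddCommGroup E] [InnerProductSpace ℝ E]
    [FiniteDimensional ℝ E] {P : E → ℝ} {Ps μ c : ℝ} (hd : Differentiable ℝ P) (hmin : ∀ x, Ps ≤ P x)
    (hPL : ∀ x, 2 * μ * (P x - Ps) ≤ ‖gradient P x‖ ^ 2) (hc : 0 < c) (hcμ : 2 * c ^ 2 < μ) (x : E) :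
    ∃ u, P u = Ps ∧ c ^ 2 * ‖u - x‖ ^ 2 ≤ P x - Ps := by
  -- A variational argument replaces the gradient flow. Below the value Ps excluded, PL says that
  -- the square root of P - Ps has slope at least √(μ/2) > c, so a minimizer of this penalized
  -- function can only sit where P = Ps. Comparing its value with that at x gives the distance
  -- bound.
  have hcont : Continuous fun u => Real.sqrt (P u - Ps) + c * ‖u - x‖ := by
    have := hd.continuous; fun_prop
  obtain ⟨u, hu⟩ := hcont.exists_forall_le (by
    refine Filter.tendsto_atTop_mono (f := fun u => c * ‖u - x‖)
      (fun u => by linarith [Real.sqrt_nonneg (P u - Ps)]) ?_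
    refine Filter.Tendsto.const_mul_atTop hc ?_
    simpa [dist_eq_norm] using tendsto_dist_right_cocompact_atTop x)
  have hux := hu x
  simp only [sub_self, norm_zero, mul_zero, add_zero] at hux
  have heq : P u = Ps := by
    by_contra hne
    have hpos : 0 < P u - Ps := by
      rcases (hmin u).lt_or_eq with h | h
      · linarith
      · exact absurd h.symm hne
    set v := gradient P u with hv
    have hg : HasDerivAt (fun t : ℝ => Real.sqrt (P (u + t • (-v)) - Ps))
        (-(‖v‖ ^ 2) / (2 * Real.sqrt (P u - Ps))) 0 := by
      have hline : HasDerivAt (fun t : ℝ => u + t • (-v)) (-v) 0 := by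
        simpa using ((hasDerivAt_id (0 : ℝ)).smul_const (-v)).const_add u
      have h1 := HasFDerivAt.comp_hasDerivAt_of_eq (0 : ℝ) (hd u).hasGradientAt.hasFDerivAt hline (by simp)
      have h2 : HasDerivAt (fun t : ℝ => P (u + t • (-v)) - Ps) (-(‖v‖ ^ 2)) 0 := by
        have := h1.sub_const Ps
        simpa [InnerProductSpace.toDual_apply_apply, ← hv] using this
      have := h2.sqrt (by simpa using hpos.ne')
      simpa using this
    have h3 := le_derivWithin_of_le_slope hg.hasDerivWithinAt (m := fun _ => -(c * ‖v‖))
      continuous_const (by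
        intro t ht
        have h4 := hu (u + t • (-v))
        have h5 : ‖u + t • (-v) - x‖ ≤ ‖u - x‖ + t * ‖v‖ := by
          have : u + t • (-v) - x = (u - x) + t • (-v) := by abel
          rw [this]
          refine (norm_add_le _ _).trans ?_
          rw [norm_smul, norm_neg, Real.norm_of_nonneg ht.1.le]
        have h6 : c * ‖u + t • (-v) - x‖ ≤ c * (‖u - x‖ + t * ‖v‖) := by gcongr
        simp only [zero_smul, add_zero]
        linarith)
    have hs := Real.sqrt_pos.2 hpos
    rw [le_div_iff₀ (by positivity)] at h3
    have h7 := hPL u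
    have h8 := Real.sq_sqrt hpos.le
    rw [← hv] at h7
    set r := Real.sqrt (P u - Ps)
    have hv0 : 0 < ‖v‖ := by
      rcases (norm_nonneg v).lt_or_eq with h | h
      · exact h
      · rw [← h] at h7; nlinarith [sq_nonneg c]
    have h9 : ‖v‖ ≤ 2 * c * r := by
      by_contra! hcon
      nlinarith
    have h10 : ‖v‖ ^ 2 ≤ (2 * c * r) ^ 2 := by gcongr
    nlinarith
  refine ⟨u, heq, ?_⟩
  rw [heq, sub_self, Real.sqrt_zero, zero_add] at hux
  have h0 := Real.sq_sqrt (sub_nonneg.2 (hmin x))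
  rw [← mul_pow, ← h0]
  gcongr

/-! ### The regularized min-max problem -/

section Problem

variable {d d' : ℕ} {f : Vec d → Vec d' → ℝ} {Y : Set (Vec d')}
  {gx : Vec d → Vec d' → Vec d} {gy : Vec d → Vec d' → Vec d'} {ℓ L ρ μy γ : ℝ}

theorem SmoothStronglyConcave.convex (hS : SmoothStronglyConcave f Y gx gy ℓ μy L) : Convex ℝ Y :=
  (hS.strongConcave 0).1

theorem SmoothStronglyConcave.continuousOn (hS : SmoothStronglyConcave f Y gx gy ℓ μy L)
    (x : Vec d) : ContinuousOn (f x) Y :=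
  fun y hy => (hS.grad_y x y hy).continuousWithinAt

theorem SmoothStronglyConcave.proxObj_le (hS : SmoothStronglyConcave f Y gx gy ℓ μy L) (γ : ℝ)
    (c x : Vec d) {y y' : Vec d'} (hy : y ∈ Y) (hy' : y' ∈ Y) :
    proxObj f γ c x y' ≤ proxObj f γ c x y + ⟪gy x y, y' - y⟫_ℝ - μy / 2 * ‖y' - y‖ ^ 2 := by
  have := StrongConcaveOn.le_add_inner_gradient (hS.strongConcave x) hy hy' (hS.grad_y x y hy)
  unfold proxObj; linarith

theorem WeaklyConvexInX.le_proxObj (hW : WeaklyConvexInX f Y gx ρ) (γ : ℝ) (c x x' : Vec d)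
    {y : Vec d'} (hy : y ∈ Y) :
    proxObj f γ c x' y + ⟪gx x' y + γ • (x' - c), x - x'⟫_ℝ + (γ - ρ) / 2 * ‖x - x'‖ ^ 2 ≤
      proxObj f γ c x y := by
  have h := hW y hy x x'
  have e : x - c = (x' - c) + (x - x') := by abel
  unfold proxObj
  rw [e, norm_add_sq_real, inner_add_left, inner_smul_left]
  simp only [conj_trivial]
  linarith

theorem WeaklyConvexInX.strongConvexOn (hW : WeaklyConvexInX f Y gx ρ) (γ : ℝ) (c : Vec d)
    {y : Vec d'} (hy : y ∈ Y) : StrongConvexOn Set.univ (γ - ρ) fun x => proxObj f γ c x y :=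
  strongConvexOn_univ_of_inner_le fun x x' => hW.le_proxObj γ c x x' hy

theorem SmoothStronglyConcave.exists_max (hS : SmoothStronglyConcave f Y gx gy ℓ μy L)
    (hμy : 0 < μy) (hne : Y.Nonempty) (γ : ℝ) (c x : Vec d) :
    ∃ y ∈ Y, ∀ y' ∈ Y, proxObj f γ c x y' + μy / 2 * ‖y' - y‖ ^ 2 ≤ proxObj f γ c x y := by
  obtain ⟨y₀, hy₀⟩ := hne
  obtain ⟨y, hy, hm⟩ := exists_isMinOn_of_quadratic_growth (φ := fun y => -f x y) hS.closed
    (hS.continuousOn x).neg hy₀ (A := -f x y₀) (B := ‖gy x y₀‖) (c := μy / 2) (by positivity) (by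
      intro w hw
      have h1 := StrongConcaveOn.le_add_inner_gradient (hS.strongConcave x) hy₀ hw (hS.grad_y x y₀ hy₀)
      have h2 := real_inner_le_norm (gy x y₀) (w - y₀)
      linarith)
  refine ⟨y, hy, fun y' hy' => ?_⟩
  have h0 : StrongConvexOn Y μy fun y => -f x y := UniformConcaveOn.neg (hS.strongConcave x)
  have h1 := StrongConvexOn.add_sq_le_of_isMin h0 hy hy' hm
  unfold proxObj; linarith

theorem exists_min (hS : SmoothStronglyConcave f Y gx gy ℓ μy L) (hW : WeaklyConvexInX f Y gx ρ)
    (hργ : ρ < γ) (c : Vec d) {y : Vec d'} (hy : y ∈ Y) :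
    ∃ x, ∀ x', proxObj f γ c x y + (γ - ρ) / 2 * ‖x' - x‖ ^ 2 ≤ proxObj f γ c x' y := by
  have hcont : Continuous fun x => proxObj f γ c x y := by
    have : Continuous fun x => f x y :=
      continuous_iff_continuousAt.2 fun x => (hS.grad_x x y hy).continuousAt
    unfold proxObj; fun_prop
  obtain ⟨x, -, hm⟩ := exists_isMinOn_of_quadratic_growth (φ := fun x => proxObj f γ c x y)
    isClosed_univ hcont.continuousOn (Set.mem_univ c) (A := proxObj f γ c c y)
    (B := ‖gx c y + γ • (c - c)‖) (c := (γ - ρ) / 2) (by linarith) (by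
      intro w _
      have h1 := hW.le_proxObj γ c w c hy
      have h2 := neg_le_of_abs_le (abs_real_inner_le_norm (gx c y + γ • (c - c)) (w - c))
      linarith)
  exact ⟨x, fun x' => StrongConvexOn.add_sq_le_of_isMin (hW.strongConvexOn γ c hy)
    (Set.mem_univ x) (Set.mem_univ x') hm⟩

theorem bddAbove_proxObj (hS : SmoothStronglyConcave f Y gx gy ℓ μy L)
    (hμy : 0 < μy) (hne : Y.Nonempty) (γ : ℝ) (c x : Vec d) :
    BddAbove (Set.range fun y : Y => proxObj f γ c x y) := by
  obtain ⟨y, -, h⟩ := hS.exists_max hμy hne γ c x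
  refine ⟨proxObj f γ c x y, ?_⟩
  rintro _ ⟨y', rfl⟩
  have := h y' y'.2
  have h2 : 0 ≤ μy / 2 * ‖(y' : Vec d') - y‖ ^ 2 := by positivity
  simp only; linarith

theorem bddBelow_proxObj (hS : SmoothStronglyConcave f Y gx gy ℓ μy L)
    (hW : WeaklyConvexInX f Y gx ρ) (hργ : ρ < γ) (c : Vec d) {y : Vec d'} (hy : y ∈ Y) :
    BddBelow (Set.range fun x => proxObj f γ c x y) := by
  obtain ⟨x, h⟩ := exists_min hS hW hργ c hy
  refine ⟨proxObj f γ c x y, ?_⟩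
  rintro _ ⟨x', rfl⟩
  have := h x'
  have h1 : 0 < γ - ρ := by linarith
  have h2 : 0 ≤ (γ - ρ) / 2 * ‖x' - x‖ ^ 2 := by positivity
  simp only; linarith

theorem iSup_proxObj (hS : SmoothStronglyConcave f Y gx gy ℓ μy L)
    (hμy : 0 < μy) (hne : Y.Nonempty) (γ : ℝ) (c x : Vec d) :
    ⨆ y : Y, proxObj f γ c x y = primal f Y x + γ / 2 * ‖x - c‖ ^ 2 := by
  have := bddAbove_proxObj hS hμy hne 0 c x
  simp only [proxObj, zero_div, zero_mul, add_zero] at this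
  have : Nonempty Y := hne.to_subtype
  unfold primal proxObj
  rw [ciSup_add ‹_›]

theorem le_primal (hS : SmoothStronglyConcave f Y gx gy ℓ μy L) (hμy : 0 < μy) (x : Vec d)
    {y : Vec d'} (hy : y ∈ Y) : f x y ≤ primal f Y x := by
  have := bddAbove_proxObj hS hμy ⟨y, hy⟩ 0 x x
  simp only [proxObj, zero_div, zero_mul, add_zero] at this
  exact le_ciSup this ⟨y, hy⟩

theorem primalOpt_le (hS : SmoothStronglyConcave f Y gx gy ℓ μy L) (x : Vec d) :
    primalOpt f Y ≤ primal f Y x := by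
  obtain ⟨xs, h⟩ := hS.primal_min
  exact ciInf_le ⟨primal f Y xs, by rintro _ ⟨x, rfl⟩; exact h x⟩ x

theorem proxObj_sub_le_gap (hS : SmoothStronglyConcave f Y gx gy ℓ μy L)
    (hW : WeaklyConvexInX f Y gx ρ) (hμy : 0 < μy) (hργ : ρ < γ) (c x x' : Vec d) {y y' : Vec d'}
    (hy : y ∈ Y) (hy' : y' ∈ Y) :
    proxObj f γ c x y' - proxObj f γ c x' y ≤ gap (proxObj f γ c) Y (x, y) := by
  have h1 := le_ciSup (bddAbove_proxObj hS hμy ⟨y, hy⟩ γ c x) ⟨y', hy'⟩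
  have h2 := ciInf_le (bddBelow_proxObj hS hW hργ c hy) x'
  simp only at h1
  unfold gap; simp only; linarith

theorem gap_le_iff (hS : SmoothStronglyConcave f Y gx gy ℓ μy L)
    (hW : WeaklyConvexInX f Y gx ρ) (hμy : 0 < μy) (hργ : ρ < γ) (c x : Vec d) {y : Vec d'}
    (hy : y ∈ Y) (b : ℝ) :
    gap (proxObj f γ c) Y (x, y) ≤ b ↔
      ∀ x', ∀ y' ∈ Y, proxObj f γ c x y' - proxObj f γ c x' y ≤ b := by
  have : Nonempty Y := ⟨⟨y, hy⟩⟩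
  refine ⟨fun h x' y' hy' => (proxObj_sub_le_gap hS hW hμy hργ c x x' hy hy').trans h, fun h => ?_⟩
  have h1 : ∀ x', (⨆ y' : Y, proxObj f γ c x y') - b ≤ proxObj f γ c x' y := by
    intro x'
    have : (⨆ y' : Y, proxObj f γ c x y') ≤ b + proxObj f γ c x' y :=
      ciSup_le fun y' => by linarith [h x' y' y'.2]
    linarith
  have := le_ciInf h1
  unfold gap; simp only; linarith

theorem gap_nonneg (hS : SmoothStronglyConcave f Y gx gy ℓ μy L)
    (hW : WeaklyConvexInX f Y gx ρ) (hμy : 0 < μy) (hργ : ρ < γ) (c x : Vec d) {y : Vec d'}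
    (hy : y ∈ Y) : 0 ≤ gap (proxObj f γ c) Y (x, y) := by
  simpa using proxObj_sub_le_gap hS hW hμy hργ c x x hy hy

/-- A regret bound that is quadratic in the distance to a reference point yields a bound on the
duality gap in terms of the gap at the reference point. -/
theorem gap_le_of_quadratic_regret (hS : SmoothStronglyConcave f Y gx gy ℓ μy L)
    (hW : WeaklyConvexInX f Y gx ρ) (hμy : 0 < μy) (hργ : ρ < γ) (c : Vec d) {x x₀ : Vec d}
    {y y₀ : Vec d'} (hy : y ∈ Y) (hy₀ : y₀ ∈ Y) {l A R : ℝ} (hl : 0 < l) (hl1 : l ≤ γ - ρ)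
    (hl2 : l ≤ μy) (hA : 0 ≤ A)
    (h : ∀ x', ∀ y' ∈ Y, proxObj f γ c x y' - proxObj f γ c x' y ≤
      A * (‖x' - x₀‖ ^ 2 + ‖y' - y₀‖ ^ 2) + R) :
    gap (proxObj f γ c) Y (x, y) ≤ 2 * A / l *
      (gap (proxObj f γ c) Y (x₀, y₀) + gap (proxObj f γ c) Y (x, y)) + R := by
  obtain ⟨xh, hxh⟩ := exists_min hS hW hργ c hy
  obtain ⟨yh, hyh, hyh'⟩ := hS.exists_max hμy ⟨y, hy⟩ γ c x
  have h1 := h xh yh hyh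
  have h2 : gap (proxObj f γ c) Y (x, y) ≤ proxObj f γ c x yh - proxObj f γ c xh y := by
    rw [gap_le_iff hS hW hμy hργ c x hy]
    intro x' y' hy'
    have a1 := hxh x'
    have a2 := hyh' y' hy'
    have a3 : 0 < γ - ρ := by linarith
    have a4 : 0 ≤ (γ - ρ) / 2 * ‖x' - xh‖ ^ 2 := by positivity
    have a5 : 0 ≤ μy / 2 * ‖y' - yh‖ ^ 2 := by positivity
    linarith
  have h4 := hxh x₀
  have h5 := hyh' y₀ hy₀
  have h6 := proxObj_sub_le_gap hS hW hμy hργ c x xh hy hyh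
  -- Strong convexity at the best responses bounds the left side by [h(x₀, y) - h(x, y₀)] + [h(x,
  -- yh) - h(xh, y)], where h is the regularized objective. The first bracket is at most the gap at
  -- the reference point and the second at most the gap at (x, y).
  have h7 : l / 2 * (‖xh - x₀‖ ^ 2 + ‖yh - y₀‖ ^ 2) ≤
      gap (proxObj f γ c) Y (x₀, y₀) + gap (proxObj f γ c) Y (x, y) := by
    have b1 : l / 2 * ‖xh - x₀‖ ^ 2 ≤ (γ - ρ) / 2 * ‖xh - x₀‖ ^ 2 := by gcongr
    have b2 : l / 2 * ‖yh - y₀‖ ^ 2 ≤ μy / 2 * ‖yh - y₀‖ ^ 2 := by gcongr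
    rw [norm_sub_rev x₀ xh] at h4
    rw [norm_sub_rev y₀ yh] at h5
    have b3 := proxObj_sub_le_gap hS hW hμy hργ c x₀ x hy₀ hy
    linarith
  have h8 : A * (‖xh - x₀‖ ^ 2 + ‖yh - y₀‖ ^ 2) ≤ 2 * A / l *
      (gap (proxObj f γ c) Y (x₀, y₀) + gap (proxObj f γ c) Y (x, y)) := by
    have : A * (‖xh - x₀‖ ^ 2 + ‖yh - y₀‖ ^ 2) =
      2 * A / l * (l / 2 * (‖xh - x₀‖ ^ 2 + ‖yh - y₀‖ ^ 2)) := by field_simp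
    rw [this]; gcongr
  linarith

/-- Moving the center of the regularizer to the current point. -/
theorem gap_recenter_le (hS : SmoothStronglyConcave f Y gx gy ℓ μy L)
    (hW : WeaklyConvexInX f Y gx ρ) (hμy : 0 < μy) (hγ : 0 < γ) (hργ : ρ ≤ γ / 2) (c x : Vec d)
    {y : Vec d'} (hy : y ∈ Y) :
    gap (proxObj f γ x) Y (x, y) ≤
      2 * gap (proxObj f γ c) Y (x, y) + 2 * γ * ‖x - c‖ ^ 2 := by
  have hργ' : ρ < γ := by linarith
  rw [gap_le_iff hS hW hμy hργ' x x hy]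
  intro x' y' hy'
  obtain ⟨xh, hxh⟩ := exists_min hS hW hργ' c hy
  have h1 := hxh x'
  have h2 := hxh x
  have h3 := proxObj_sub_le_gap hS hW hμy hργ' c x xh hy hy
  have h4 := proxObj_sub_le_gap hS hW hμy hργ' c x xh hy hy'
  have b1 : γ / 4 * ‖x' - xh‖ ^ 2 ≤ (γ - ρ) / 2 * ‖x' - xh‖ ^ 2 :=
    mul_le_mul_of_nonneg_right (by linarith) (sq_nonneg _)
  have b2 : γ / 4 * ‖x - xh‖ ^ 2 ≤ (γ - ρ) / 2 * ‖x - xh‖ ^ 2 :=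
    mul_le_mul_of_nonneg_right (by linarith) (sq_nonneg _)
  have e1 : proxObj f γ x x y' = proxObj f γ c x y' - γ / 2 * ‖x - c‖ ^ 2 := by simp [proxObj]
  have e2 : proxObj f γ x x' y = proxObj f γ c x' y + γ / 2 * (‖x' - x‖ ^ 2 - ‖x' - c‖ ^ 2) := by
    simp only [proxObj]; ring
  have e3 : ‖x' - x‖ ^ 2 - ‖x' - c‖ ^ 2 + ‖x - c‖ ^ 2 =
      -2 * ⟪x' - xh, x - c⟫_ℝ + 2 * ⟪x - xh, x - c⟫_ℝ := by
    have : x' - c = (x' - x) + (x - c) := by abel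
    rw [this, norm_add_sq_real]
    have : x' - x = (x' - xh) - (x - xh) := by abel
    rw [this, inner_sub_left]; ring
  -- Young's inequality for the two inner products. Each costs γ‖x - c‖². The square of x' - xh is
  -- absorbed by strong convexity at x', and that of x - xh by one further copy of the gap.
  have q1 : 0 ≤ ‖(x' - xh) - (2 : ℝ) • (x - c)‖ ^ 2 := by positivity
  have q2 : 0 ≤ ‖(x - xh) + (2 : ℝ) • (x - c)‖ ^ 2 := by positivity
  rw [norm_sub_sq_real, inner_smul_right, norm_smul, Real.norm_ofNat] at q1
  rw [norm_add_sq_real, inner_smul_right, norm_smul, Real.norm_ofNat] at q2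
  have q3 := mul_nonneg hγ.le q1
  have q4 := mul_nonneg hγ.le q2
  rw [e1, e2]
  nlinarith

/-- The gap equals P(x) + (μ/8)‖x - c‖² minus an infimum over x'. Testing the infimum at a minimizer
u of P near c bounds it by P_* + (μ/8)‖u - c‖². Quadratic growth with constant 3μ/8, admissible
because it is strictly below μ/2, makes the last term at most a third of P(c) - P_*. -/
theorem primal_progress (hS : SmoothStronglyConcave f Y gx gy ℓ μy L)
    (hW : WeaklyConvexInX f Y gx ρ) (hμy : 0 < μy) {μ : ℝ} (hμ : 0 < μ) (hρ : ρ < μ / 4)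
    (hPL : PrimalPL f Y μ) (c x : Vec d) {y : Vec d'} (hy : y ∈ Y) :
    primal f Y x - primalOpt f Y + μ / 8 * ‖x - c‖ ^ 2 ≤
      1 / 3 * (primal f Y c - primalOpt f Y) + gap (proxObj f (μ / 4) c) Y (x, y) := by
  have hc : Real.sqrt (3 * μ / 8) ^ 2 = 3 * μ / 8 := Real.sq_sqrt (by positivity)
  obtain ⟨u, hu, hu'⟩ := exists_min_near_of_PL hS.primal_differentiable (primalOpt_le hS) hPL
    (c := Real.sqrt (3 * μ / 8)) (Real.sqrt_pos.2 (by positivity)) (by rw [hc]; linarith) c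
  rw [hc] at hu'
  have h1 := iSup_proxObj hS hμy ⟨y, hy⟩ (μ / 4) c x
  have h2 := ciInf_le (bddBelow_proxObj hS hW hρ c hy) u
  have h3 := le_primal hS hμy u hy
  unfold gap
  simp only [proxObj] at h1 h2 ⊢
  rw [h1]
  linarith

/-- Recentering costs 57 · 4 = 228 copies of (μ/8)‖x - c‖², fewer than the 475 provided by
`primal_progress`. The other constants are 475/3 ≤ 159 and 475 + 2 · 57 = 589. -/
theorem lyapunov_step (hS : SmoothStronglyConcave f Y gx gy ℓ μy L)
    (hW : WeaklyConvexInX f Y gx ρ) (hμy : 0 < μy) {μ : ℝ} (hμ : 0 < μ) (hρ : ρ ≤ μ / 8)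
    (hPL : PrimalPL f Y μ) (c : Vec d) {z : Pt d d'} (hz : z.2 ∈ Y) :
    lyapunov f Y μ z ≤
      159 * (primal f Y c - primalOpt f Y) + 589 * gap (proxObj f (μ / 4) c) Y z := by
  obtain ⟨x, y⟩ := z
  have h1 := primal_progress hS hW hμy hμ (by linarith) hPL c x hz
  have h2 := gap_recenter_le hS hW hμy (γ := μ / 4) (by positivity) (by linarith) c x hz
  have h3 := primalOpt_le hS c
  have h4 : 0 ≤ μ / 8 * ‖x - c‖ ^ 2 := by positivity
  simp only at h1 h2
  unfold lyapunov
  simp only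
  linarith

/-- The regularizer vanishes at its center x₀ and is nonnegative elsewhere, so it does not increase
the gap. Both terms are then at most ε₀, and 532 = 475 + 57. -/
theorem lyapunov_initial_le (hS : SmoothStronglyConcave f Y gx gy ℓ μy L)
    (hW : WeaklyConvexInX f Y gx ρ) (hμy : 0 < μy) {μ : ℝ} (hμ : 0 < μ) (hρ : ρ < μ / 4)
    {z₀ : Pt d d'} {ε₀ : ℝ} (h₀ : InitialGap f Y z₀ ε₀) : lyapunov f Y μ z₀ ≤ 532 * ε₀ := by
  obtain ⟨x₀, y₀⟩ := z₀
  have hy := h₀.mem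
  have hg := h₀.gap_le
  have hb := h₀.bddBelow
  simp only at hy hb
  unfold gap at hg
  simp only at hg
  have h1 : ⨅ x, f x y₀ ≤ primalOpt f Y :=
    le_ciInf fun x => (ciInf_le hb x).trans (le_primal hS hμy x hy)
  have h2 : gap (proxObj f (μ / 4) x₀) Y (x₀, y₀) ≤ ε₀ := by
    rw [gap_le_iff hS hW hμy hρ x₀ x₀ hy]
    intro x' y' hy'
    have a1 := le_primal hS hμy x₀ hy'
    have a2 := ciInf_le hb x'
    have a3 : 0 ≤ μ / 4 / 2 * ‖x' - x₀‖ ^ 2 := by positivity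
    unfold primal at a1
    simp only [proxObj, sub_self, norm_zero] at a2 ⊢
    linarith
  have h3 : primal f Y x₀ - primalOpt f Y ≤ ε₀ := by
    unfold primal; linarith
  unfold lyapunov
  simp only
  linarith

/-! ### Measurability of the primal function and of the duality gap -/

theorem measurable_primal (hS : SmoothStronglyConcave f Y gx gy ℓ μy L) :
    Measurable (primal f Y) :=
  hS.primal_differentiable.continuous.measurable

/-- The supremum is P plus a quadratic and P is continuous. The infimum may be taken over a
countable dense set, by continuity in x. -/
theorem measurable_gap (hS : SmoothStronglyConcave f Y gx gy ℓ μy L)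
    (hW : WeaklyConvexInX f Y gx ρ) (hμy : 0 < μy) (hργ : ρ < γ) {Ω : Type*} [MeasurableSpace Ω]
    {c : Ω → Vec d} (hc : Measurable c) {z : Ω → Pt d d'} (hz : Measurable z)
    (hzY : ∀ ω, (z ω).2 ∈ Y) : Measurable fun ω => gap (proxObj f γ (c ω)) Y (z ω) := by
  unfold gap
  have e1 : ∀ ω, ⨆ y' : Y, proxObj f γ (c ω) (z ω).1 y' =
      primal f Y (z ω).1 + γ / 2 * ‖(z ω).1 - c ω‖ ^ 2 :=
    fun ω => iSup_proxObj hS hμy ⟨_, hzY ω⟩ γ (c ω) (z ω).1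
  have e2 : ∀ ω, ⨅ x', proxObj f γ (c ω) x' (z ω).2 =
      ⨅ n : ℕ, proxObj f γ (c ω) (TopologicalSpace.denseSeq (Vec d) n) (z ω).2 := by
    intro ω
    have hcont : Continuous fun x => proxObj f γ (c ω) x (z ω).2 := by
      have : Continuous fun x => f x (z ω).2 :=
        continuous_iff_continuousAt.2 fun x => (hS.grad_x x _ (hzY ω)).continuousAt
      unfold proxObj; fun_prop
    have hb := bddBelow_proxObj hS hW hργ (c ω) (hzY ω)
    apply le_antisymm
    · exact le_ciInf fun n => ciInf_le hb _
    · have hb' : BddBelow (Set.range fun n : ℕ =>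
          proxObj f γ (c ω) (TopologicalSpace.denseSeq (Vec d) n) (z ω).2) := by
        refine hb.mono ?_
        rintro _ ⟨n, rfl⟩; exact ⟨_, rfl⟩
      refine le_ciInf fun x => ?_
      refine (TopologicalSpace.denseRange_denseSeq (Vec d)).induction_on
        (p := fun x => (⨅ n : ℕ, proxObj f γ (c ω) (TopologicalSpace.denseSeq (Vec d) n) (z ω).2) ≤
          proxObj f γ (c ω) x (z ω).2) x (isClosed_le continuous_const hcont) fun n => ciInf_le hb' n
  simp only [e1, e2]
  have m1 := (measurable_primal hS).comp (measurable_fst.comp hz)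
  have m2 : ∀ n : ℕ, Measurable fun ω =>
      proxObj f γ (c ω) (TopologicalSpace.denseSeq (Vec d) n) (z ω).2 := by
    intro n
    unfold proxObj
    have h1 : Measurable fun ω => f (TopologicalSpace.denseSeq (Vec d) n) (z ω).2 :=
      (hS.continuousOn (TopologicalSpace.denseSeq (Vec d) n)).domRestrict.measurable.comp
        (f := fun ω => (⟨(z ω).2, hzY ω⟩ : Y)) (Measurable.subtype_mk (measurable_snd.comp hz))
    exact h1.add (by fun_prop)
  refine Measurable.sub (Measurable.add m1 ?_) (Measurable.iInf m2)
  fun_prop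

end Problem

/-! ### Averaging over an independent sample -/

section Freeze

variable {Ω 𝒳 Ξ : Type*} [MeasurableSpace Ω] [MeasurableSpace 𝒳] [MeasurableSpace Ξ]
  {Pr : Measure Ω} [IsProbabilityMeasure Pr] {X : Ω → 𝒳} {w : Ω → ℝ} {ζ : Ω → Ξ} {φ : 𝒳 → Ξ → ℝ}
  {b b' : ℝ}

theorem measurable_integral_sample (hζ : Measurable ζ) (hφ : Measurable (Function.uncurry φ)) :
    Measurable fun x => ∫ ω', φ x (ζ ω') ∂Pr := by
  have e : (fun x => ∫ ω', φ x (ζ ω') ∂Pr) = fun x => ∫ s, φ x s ∂(Pr.map ζ) := by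
    ext x
    rw [integral_map hζ.aemeasurable (hφ.of_uncurry_left.aestronglyMeasurable)]
  rw [e]
  have := Measure.isProbabilityMeasure_map (μ := Pr) hζ.aemeasurable
  exact (hφ.stronglyMeasurable.integral_prod_right (ν := Pr.map ζ)).measurable

/-- By independence the joint law is a product, so for almost every value of X the bound holds for
almost every sample. No bound away from the visited points is required. -/
theorem abs_integral_sample_le (hX : Measurable X) (hζ : Measurable ζ)
    (hind : IndepFun X ζ Pr) (hφ : Measurable (Function.uncurry φ))
    (hb : ∀ᵐ ω ∂Pr, |φ (X ω) (ζ ω)| ≤ b) :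
    ∀ᵐ ω ∂Pr, |∫ ω', φ (X ω) (ζ ω') ∂Pr| ≤ b := by
  have p1 := Measure.isProbabilityMeasure_map (μ := Pr) hζ.aemeasurable
  have p2 := Measure.isProbabilityMeasure_map (μ := Pr) hX.aemeasurable
  have hprod := (indepFun_iff_map_prod_eq_prod_map_map hX.aemeasurable hζ.aemeasurable).1 hind
  have h1 : ∀ᵐ p ∂((Pr.map X).prod (Pr.map ζ)), |φ p.1 p.2| ≤ b := by
    rw [← hprod, ae_map_iff (hX.prodMk hζ).aemeasurable]
    · exact hb
    · exact measurableSet_le (continuous_abs.measurable.comp hφ) measurable_const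
  filter_upwards [ae_of_ae_map hX.aemeasurable (Measure.ae_ae_of_ae_prod h1)] with ω hω
  rw [← integral_map (φ := ζ) hζ.aemeasurable (hφ.of_uncurry_left.aestronglyMeasurable)]
  have := norm_integral_le_of_norm_le_const (μ := Pr.map ζ) (f := φ (X ω)) (C := b) (by simpa using hω)
  simpa using this

theorem integrable_of_ae_bdd {v : Ω → ℝ} (hv : Measurable v) (hb : ∀ᵐ ω ∂Pr, |v ω| ≤ b) :
    Integrable v Pr :=
  Integrable.of_bound hv.aestronglyMeasurable b (by simpa using hb)

theorem integral_mul_sub_sample_eq_zero (hX : Measurable X) (hw : Measurable w) (hζ : Measurable ζ)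
    (hind : IndepFun (fun ω => (X ω, w ω)) ζ Pr) (hφ : Measurable (Function.uncurry φ))
    (hb : ∀ᵐ ω ∂Pr, |φ (X ω) (ζ ω)| ≤ b) (hb' : ∀ᵐ ω ∂Pr, |w ω| ≤ b') :
    ∫ ω, w ω * ((∫ ω', φ (X ω) (ζ ω') ∂Pr) - φ (X ω) (ζ ω)) ∂Pr = 0 := by
  have hXw := hX.prodMk hw
  have p1 := Measure.isProbabilityMeasure_map (μ := Pr) hζ.aemeasurable
  have p2 := Measure.isProbabilityMeasure_map (μ := Pr) hXw.aemeasurable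
  have hprod := (indepFun_iff_map_prod_eq_prod_map_map hXw.aemeasurable hζ.aemeasurable).1 hind
  have hbar := abs_integral_sample_le hX hζ (hind.comp measurable_fst measurable_id) hφ hb
  have mbar := (measurable_integral_sample (Pr := Pr) hζ hφ).comp hX
  have mφ : Measurable fun ω => φ (X ω) (ζ ω) := hφ.comp (hX.prodMk hζ)
  have mψ : Measurable fun p : (𝒳 × ℝ) × Ξ => p.1.2 * φ p.1.1 p.2 :=
    (measurable_snd.comp measurable_fst).mul
      (hφ.comp (f := fun p : (𝒳 × ℝ) × Ξ => (p.1.1, p.2)) (by fun_prop))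
  have hbd : ∀ᵐ ω ∂Pr, |w ω * φ (X ω) (ζ ω)| ≤ b' * b := by
    filter_upwards [hb, hb'] with ω h1 h2
    rw [abs_mul]
    exact mul_le_mul h2 h1 (abs_nonneg _) ((abs_nonneg _).trans h2)
  have hbd' : ∀ᵐ ω ∂Pr, |w ω * ∫ ω', φ (X ω) (ζ ω') ∂Pr| ≤ b' * b := by
    filter_upwards [hbar, hb'] with ω h1 h2
    rw [abs_mul]
    exact mul_le_mul h2 h1 (abs_nonneg _) ((abs_nonneg _).trans h2)
  have key : ∫ ω, w ω * φ (X ω) (ζ ω) ∂Pr = ∫ ω, w ω * ∫ ω', φ (X ω) (ζ ω') ∂Pr ∂Pr := by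
    have e1 : ∫ ω, w ω * φ (X ω) (ζ ω) ∂Pr =
        ∫ p, p.1.2 * φ p.1.1 p.2 ∂(Pr.map fun ω => ((X ω, w ω), ζ ω)) :=
      (integral_map (hXw.prodMk hζ).aemeasurable mψ.aestronglyMeasurable).symm
    rw [e1, hprod, integral_prod]
    · rw [integral_map hXw.aemeasurable (mψ.stronglyMeasurable.integral_prod_right').aestronglyMeasurable]
      refine integral_congr_ae (ae_of_all _ fun ω => ?_)
      simp only [integral_const_mul]
      rw [← integral_map (φ := ζ) hζ.aemeasurable (hφ.of_uncurry_left.aestronglyMeasurable)]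
    · rw [← hprod]
      exact (integrable_map_measure mψ.aestronglyMeasurable (hXw.prodMk hζ).aemeasurable).2
        (integrable_of_ae_bdd (mψ.comp (hXw.prodMk hζ)) hbd)
  simp only [mul_sub]
  exact (integral_sub (integrable_of_ae_bdd (hw.mul mbar) hbd')
    (integrable_of_ae_bdd (hw.mul mφ) hbd)).trans (sub_eq_zero.2 key.symm)

/-- Weighted form of variance ≤ second moment: with Φ the sample mean, (Φ - φ)² = φ² + 2Φ(Φ - φ) -
Φ², where the cross term has mean zero even after weighting by w and the last term is dropped. -/
theorem integral_mul_sq_sub_sample_le (hX : Measurable X) (hw : Measurable w) (hζ : Measurable ζ)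
    (hind : IndepFun (fun ω => (X ω, w ω)) ζ Pr) (hφ : Measurable (Function.uncurry φ))
    (hb : ∀ᵐ ω ∂Pr, |φ (X ω) (ζ ω)| ≤ b) (hb' : ∀ᵐ ω ∂Pr, |w ω| ≤ b') (hw0 : ∀ ω, 0 ≤ w ω) :
    ∫ ω, w ω * ((∫ ω', φ (X ω) (ζ ω') ∂Pr) - φ (X ω) (ζ ω)) ^ 2 ∂Pr ≤
      ∫ ω, w ω * φ (X ω) (ζ ω) ^ 2 ∂Pr := by
  have hbar := abs_integral_sample_le hX hζ (hind.comp measurable_fst measurable_id) hφ hb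
  have mbar := (measurable_integral_sample (Pr := Pr) hζ hφ).comp hX
  have mφ : Measurable fun ω => φ (X ω) (ζ ω) := hφ.comp (hX.prodMk hζ)
  simp only [Function.comp_def] at mbar
  set Φ : 𝒳 → ℝ := fun x => ∫ ω', φ x (ζ ω') ∂Pr with hΦ
  have mΦ : Measurable Φ := measurable_integral_sample (Pr := Pr) hζ hφ
  have hbd : ∀ᵐ ω ∂Pr, |w ω * Φ (X ω)| ≤ b' * b := by
    filter_upwards [hbar, hb'] with ω h1 h2
    rw [abs_mul]
    exact mul_le_mul h2 h1 (abs_nonneg _) ((abs_nonneg _).trans h2)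
  have h0 := integral_mul_sub_sample_eq_zero hX (hw.mul mbar) hζ
    (hind.comp (φ := fun p : 𝒳 × ℝ => (p.1, p.2 * Φ p.1)) (by fun_prop) measurable_id) hφ hb hbd
  have hint : Integrable (fun ω => w ω * Φ (X ω) * (Φ (X ω) - φ (X ω) (ζ ω))) Pr := by
    refine integrable_of_ae_bdd (b := b' * b * (b + b)) (by fun_prop) ?_
    filter_upwards [hbd, hbar, hb] with ω h1 h2 h3
    rw [abs_mul]
    refine mul_le_mul h1 ?_ (abs_nonneg _) ((abs_nonneg _).trans h1)
    exact (abs_sub _ _).trans (add_le_add h2 h3)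
  have hint2 : Integrable (fun ω => w ω * φ (X ω) (ζ ω) ^ 2) Pr := by
    refine integrable_of_ae_bdd (b := b' * b ^ 2) (by fun_prop) ?_
    filter_upwards [hb', hb] with ω h1 h2
    rw [abs_mul, abs_pow]
    exact mul_le_mul h1 (pow_le_pow_left₀ (abs_nonneg _) h2 2) (by positivity)
      ((abs_nonneg _).trans h1)
  calc ∫ ω, w ω * (Φ (X ω) - φ (X ω) (ζ ω)) ^ 2 ∂Pr
      ≤ ∫ ω, (w ω * φ (X ω) (ζ ω) ^ 2 + 2 * (w ω * Φ (X ω) * (Φ (X ω) - φ (X ω) (ζ ω)))) ∂Pr := by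
        refine integral_mono_of_nonneg (ae_of_all _ fun ω => ?_) (hint2.add (hint.const_mul 2))
          (ae_of_all _ fun ω => ?_)
        · have := hw0 ω; simp only [Pi.zero_apply]; positivity
        · have := mul_nonneg (hw0 ω) (sq_nonneg (Φ (X ω)))
          simp only; nlinarith
    _ = ∫ ω, w ω * φ (X ω) (ζ ω) ^ 2 ∂Pr := by
        rw [integral_add hint2 (hint.const_mul 2), integral_const_mul]
        simp only [Pi.mul_apply] at h0
        rw [h0]; ring

end Freeze

/-! ### Pathwise regret of an epoch -/

section Regret

variable {d d' : ℕ}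

/-- Displacement at step `t` of the auxiliary dual averaging process driven by the noise `F - g`. -/
noncomputable def ghostShift (η δ : ℝ) (g F : ℕ → Pt d d') (t : ℕ) (i : Fin d ⊕ Fin d') : ℝ :=
  -η * (∑ τ ∈ Finset.Icc 1 (t - 1), (coord (F τ) i - coord (g τ) i)) / (δ + rowNorm g (t - 1) i)

/-- The energy of the noise `F - g` in the dual norms of the regularizers. -/
noncomputable def noiseEnergy (δ : ℝ) (g F : ℕ → Pt d d') (T : ℕ) : ℝ :=
  ∑ t ∈ Finset.Icc 1 T, ∑ i, (coord (F t) i - coord (g t) i) ^ 2 / (δ + rowNorm g (t - 1) i)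

/-- The noise `F - g` tested against the difference of the iterates and the auxiliary process. -/
noncomputable def noiseDrift (η δ : ℝ) (z₀ : Pt d d') (z g F : ℕ → Pt d d') (T : ℕ) : ℝ :=
  ∑ t ∈ Finset.Icc 1 T, ∑ i, (coord (F t) i - coord (g t) i) *
    (coord (z t) i - coord z₀ i - ghostShift η δ g F t i)

theorem ghost_regret (η : ℝ) {δ : ℝ} (hδ : 0 < δ) (g F : ℕ → Pt d d') (T : ℕ)
    (u : Fin d ⊕ Fin d' → ℝ) :
    η * ∑ t ∈ Finset.Icc 1 T, ∑ i, (coord (F t) i - coord (g t) i) * (ghostShift η δ g F t i - u i) ≤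
      ∑ i, (δ + rowNorm g T i) / 2 * u i ^ 2 + η ^ 2 / 2 * noiseEnergy δ g F T := by
  unfold noiseEnergy
  rw [Finset.sum_comm, Finset.sum_comm (s := Finset.Icc 1 T), Finset.mul_sum, Finset.mul_sum,
    ← Finset.sum_add_distrib]
  refine Finset.sum_le_sum fun i _ => ?_
  exact scalar_dualAveraging_regret (fun t => coord (F t) i - coord (g t) i)
    (fun t => δ + rowNorm g t i) η (fun t => by
      have : rowNorm g t i ≤ rowNorm g (t + 1) i := rowNorm_mono g i (Nat.le_succ t)
      linarith) (fun t => by linarith [rowNorm_nonneg g t i]) T (u i)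

theorem rowNorm_le_iSup (g : ℕ → Pt d d') (t : ℕ) (i) : rowNorm g t i ≤ ⨆ i, rowNorm g t i :=
  le_ciSup (Finite.bddAbove_range _) i

theorem mPar_pos (hd : 0 < d) : 0 < mPar d d' := by
  unfold mPar; positivity

/-- Regret of the AdaGrad iterates with respect to the field `F`, estimated by `g`. -/
theorem field_regret {Y : Set (Vec d')} (hY : IsClosed Y) (hYc : Convex ℝ Y) (hd : 0 < d)
    (gr : ℕ → Pt d d' → Pt d d') {z₀ : Pt d d'} (hz₀ : z₀ ∈ feasible Y) {δ η M : ℝ} (hδ : 0 < δ)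
    (hη : 0 < η) (hM : 0 < M) {z g : ℕ → Pt d d'} (hz : z = adaIterate (feasible Y) gr z₀ δ η)
    (hgr : g = fun t => gr t (z t)) (F : ℕ → Pt d d') {T : ℕ} (hT : epochLength M δ g T ≤ T)
    (hg : ∀ t ∈ Finset.Icc 1 T, ∀ i, |coord (g t) i| ≤ δ) {w : Pt d d'} (hw : w ∈ feasible Y) :
    ∑ t ∈ Finset.Icc 1 T, ∑ i, coord (F t) i * (coord (z t) i - coord w i) ≤
      T * (mPar d d' / (M * η)) * ∑ i, (coord w i - coord z₀ i) ^ 2 +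
        (T * (η / (M * mPar d d')) + η / 2 * noiseEnergy δ g F T + noiseDrift η δ z₀ z g F T) := by
  have hm := mPar_pos (d' := d') hd
  have hspec := adaIterate_spec hY gr hz₀ hδ η
  rw [← hz] at hspec
  have h1 := dualAveraging_regret (convex_feasible hYc) g z (fun t i => δ + rowNorm g t i)
    (by rw [hz, adaIterate_one]) (fun t i => by
      have : rowNorm g t i ≤ rowNorm g (t + 1) i := rowNorm_mono g i (Nat.le_succ t)
      linarith) (fun t i => by linarith [rowNorm_nonneg g t i])
    (fun t => (hspec t).1) (fun t => by
      rw [hgr]; exact (hspec t).2) T hw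
  have h2 := ghost_regret η hδ g F T (fun i => coord w i - coord z₀ i)
  have h3 : ∑ t ∈ Finset.Icc 1 T, ∑ i, coord (g t) i ^ 2 / (δ + rowNorm g (t - 1) i) ≤
      2 * ∑ i, rowNorm g T i := by
    rw [Finset.sum_comm, Finset.mul_sum]
    exact Finset.sum_le_sum fun i _ => sum_sq_div_le_two_mul_rowNorm g hδ i T fun t ht => hg t ht i
  -- The two entries of the maximum in the stopping rule have separate roles: this one bounds the
  -- largest weight, the next one the accumulated energy.
  have hM1 : M * ((δ + ⨆ i, rowNorm g T i) / mPar d d') ≤ T :=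
    (mul_le_mul_of_nonneg_left (le_max_left _ _) hM.le).trans hT
  have hM2 : M * (mPar d d' * ∑ i, rowNorm g T i) ≤ T :=
    (mul_le_mul_of_nonneg_left (le_max_right _ _) hM.le).trans hT
  have h4 : ∑ i, (δ + rowNorm g T i) / 2 * (coord w i - coord z₀ i) ^ 2 ≤
      T * (mPar d d' / M) / 2 * ∑ i, (coord w i - coord z₀ i) ^ 2 := by
    rw [Finset.mul_sum]
    refine Finset.sum_le_sum fun i _ => ?_
    have : δ + rowNorm g T i ≤ T * (mPar d d' / M) := by
      have a1 := rowNorm_le_iSup g T i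
      have a2 : δ + ⨆ i, rowNorm g T i ≤ T * (mPar d d' / M) := by
        rw [mul_div_assoc', div_le_iff₀ hm] at hM1
        rw [mul_div_assoc', le_div_iff₀ hM]; linarith
      linarith
    gcongr
  have h5 : ∑ i, rowNorm g T i ≤ T / (M * mPar d d') := by
    rw [le_div_iff₀ (by positivity)]; linarith
  -- The comparison point w occurs in the first two sums only, and each is a regret bounded
  -- pathwise. The drift is free of w, so its mean can be taken later although w is random.
  have e : ∑ t ∈ Finset.Icc 1 T, ∑ i, coord (F t) i * (coord (z t) i - coord w i) =
      ∑ t ∈ Finset.Icc 1 T, ∑ i, coord (g t) i * (coord (z t) i - coord w i) +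
      ∑ t ∈ Finset.Icc 1 T, ∑ i, (coord (F t) i - coord (g t) i) *
        (ghostShift η δ g F t i - (coord w i - coord z₀ i)) + noiseDrift η δ z₀ z g F T := by
    simp only [noiseDrift, ← Finset.sum_add_distrib]
    refine Finset.sum_congr rfl fun t _ => Finset.sum_congr rfl fun i _ => ?_
    ring
  set S := ∑ i, (coord w i - coord z₀ i) ^ 2
  have h6 : η * (∑ t ∈ Finset.Icc 1 T, ∑ i, coord (g t) i * (coord (z t) i - coord w i) +
      ∑ t ∈ Finset.Icc 1 T, ∑ i, (coord (F t) i - coord (g t) i) *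
        (ghostShift η δ g F t i - (coord w i - coord z₀ i))) ≤
      η * (T * (mPar d d' / (M * η)) * S + (T * (η / (M * mPar d d')) + η / 2 * noiseEnergy δ g F T)) := by
    have a1 : η ^ 2 / 2 * ∑ t ∈ Finset.Icc 1 T, ∑ i, coord (g t) i ^ 2 / (δ + rowNorm g (t - 1) i) ≤
        η ^ 2 / 2 * (2 * (T / (M * mPar d d'))) := by gcongr; linarith
    have a2 : η * (T * (mPar d d' / (M * η)) * S + (T * (η / (M * mPar d d')) + η / 2 * noiseEnergy δ g F T)) =
      T * (mPar d d' / M) * S + η ^ 2 / 2 * (2 * (T / (M * mPar d d'))) + η ^ 2 / 2 * noiseEnergy δ g F T := by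
      field_simp
      ring
    rw [a2, mul_add]
    linarith
  have h7 := le_of_mul_le_mul_left h6 hη
  rw [e]; linarith

/-- The field `(∇ₓ f_k, -∇_y f_k)` of the regularized objective. -/
noncomputable def proxField (gx : Vec d → Vec d' → Vec d) (gy : Vec d → Vec d' → Vec d') (γ : ℝ)
    (c : Vec d) (z : Pt d d') : Pt d d' :=
  (gx z.1 z.2 + γ • (z.1 - c), -gy z.1 z.2)

theorem proxObj_sub_le_field {f : Vec d → Vec d' → ℝ} {Y : Set (Vec d')}
    {gx : Vec d → Vec d' → Vec d} {gy : Vec d → Vec d' → Vec d'} {ℓ L ρ μy γ : ℝ}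
    (hS : SmoothStronglyConcave f Y gx gy ℓ μy L) (hW : WeaklyConvexInX f Y gx ρ) (hμy : 0 < μy)
    (hργ : ρ < γ) (c : Vec d) {z w : Pt d d'} (hz : z ∈ feasible Y) (hw : w ∈ feasible Y) :
    proxObj f γ c z.1 w.2 - proxObj f γ c w.1 z.2 ≤
      ∑ i, coord (proxField gx gy γ c z) i * (coord z i - coord w i) := by
  have h1 := hS.proxObj_le γ c z.1 hz hw
  have h2 := hW.le_proxObj γ c w.1 z.1 hz
  have e := sum_coord_mul_coord (proxField gx gy γ c z) (z - w)
  simp only [coord_sub] at e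
  rw [e]
  simp only [proxField, Prod.fst_sub, Prod.snd_sub]
  have a1 : 0 < γ - ρ := by linarith
  have a2 : 0 ≤ (γ - ρ) / 2 * ‖w.1 - z.1‖ ^ 2 := by positivity
  have a3 : 0 ≤ μy / 2 * ‖w.2 - z.2‖ ^ 2 := by positivity
  have e1 : ⟪gx z.1 z.2 + γ • (z.1 - c), z.1 - w.1⟫_ℝ = -⟪gx z.1 z.2 + γ • (z.1 - c), w.1 - z.1⟫_ℝ := by
    rw [← inner_neg_right, neg_sub]
  have e2 : ⟪-gy z.1 z.2, z.2 - w.2⟫_ℝ = ⟪gy z.1 z.2, w.2 - z.2⟫_ℝ := by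
    rw [inner_neg_left, ← inner_neg_right, neg_sub]
  rw [e1, e2]; linarith

theorem proxObj_average_sub_le {f : Vec d → Vec d' → ℝ} {Y : Set (Vec d')}
    {gx : Vec d → Vec d' → Vec d} {gy : Vec d → Vec d' → Vec d'} {ℓ L ρ μy γ : ℝ}
    (hS : SmoothStronglyConcave f Y gx gy ℓ μy L) (hW : WeaklyConvexInX f Y gx ρ) (hμy : 0 < μy)
    (hργ : ρ < γ) (c : Vec d) {z : ℕ → Pt d d'} {T : ℕ} (hT : 0 < T) (hz : ∀ t, z t ∈ feasible Y)
    {w : Pt d d'} (hw : w ∈ feasible Y) :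
    proxObj f γ c ((1 / (T : ℝ)) • ∑ t ∈ Finset.Icc 1 T, z t).1 w.2 -
        proxObj f γ c w.1 ((1 / (T : ℝ)) • ∑ t ∈ Finset.Icc 1 T, z t).2 ≤
      1 / (T : ℝ) * ∑ t ∈ Finset.Icc 1 T, ∑ i,
        coord (proxField gx gy γ c (z t)) i * (coord (z t) i - coord w i) := by
  have hsum : ∑ t ∈ Finset.Icc 1 T, (1 / (T : ℝ)) = 1 := by
    have : (T : ℝ) ≠ 0 := by positivity
    simp [this]
  have c1 : ConvexOn ℝ Set.univ fun x => proxObj f γ c x w.2 :=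
    (StrongConvexOn.strictConvexOn (hW.strongConvexOn γ c hw) (by linarith)).convexOn
  have c2 : ConcaveOn ℝ Y (f w.1) := (StrongConcaveOn.strictConcaveOn (hS.strongConcave w.1) hμy).concaveOn
  have h1 := c1.map_sum_le (t := Finset.Icc 1 T) (w := fun _ => 1 / (T : ℝ)) (p := fun t => (z t).1)
    (fun _ _ => by positivity) hsum (fun _ _ => Set.mem_univ _)
  have h2 := c2.le_map_sum (t := Finset.Icc 1 T) (w := fun _ => 1 / (T : ℝ)) (p := fun t => (z t).2)
    (fun _ _ => by positivity) hsum (fun t _ => hz t)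
  simp only [Prod.smul_fst, Prod.smul_snd, Prod.fst_sum, Prod.snd_sum, Finset.smul_sum]
  have h3 : ∑ t ∈ Finset.Icc 1 T, (1 / (T : ℝ)) • proxObj f γ c (z t).1 w.2 -
      (∑ t ∈ Finset.Icc 1 T, (1 / (T : ℝ)) • f w.1 (z t).2 + γ / 2 * ‖w.1 - c‖ ^ 2) ≤
      1 / (T : ℝ) * ∑ t ∈ Finset.Icc 1 T, ∑ i,
        coord (proxField gx gy γ c (z t)) i * (coord (z t) i - coord w i) := by
    have : γ / 2 * ‖w.1 - c‖ ^ 2 = ∑ t ∈ Finset.Icc 1 T, (1 / (T : ℝ)) * (γ / 2 * ‖w.1 - c‖ ^ 2) := by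
      rw [← Finset.sum_mul, hsum, one_mul]
    rw [this, ← Finset.sum_add_distrib, ← Finset.sum_sub_distrib, Finset.mul_sum]
    refine Finset.sum_le_sum fun t _ => ?_
    have := proxObj_sub_le_field hS hW hμy hργ c (hz t) hw
    have h0 : (0 : ℝ) ≤ 1 / (T : ℝ) := by positivity
    have := mul_le_mul_of_nonneg_left this h0
    simp only [smul_eq_mul]
    have e : proxObj f γ c w.1 (z t).2 = f w.1 (z t).2 + γ / 2 * ‖w.1 - c‖ ^ 2 := rfl
    rw [e] at this
    linarith
  have e : proxObj f γ c w.1 (∑ t ∈ Finset.Icc 1 T, (1 / (T : ℝ)) • (z t).2) =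
    f w.1 (∑ t ∈ Finset.Icc 1 T, (1 / (T : ℝ)) • (z t).2) + γ / 2 * ‖w.1 - c‖ ^ 2 := rfl
  rw [e]
  linarith

end Regret

/-! ### Boundedness of the iterates -/

section Bounds

variable {d d' : ℕ}

/-- Comparing the objective at the iterate and at z₀: the linear coefficients are at most ηTδ and
the weights at least δ. The crude bound is deterministic and serves integrability only. -/
theorem sq_adaIterate_sub_le {Y : Set (Vec d')} (hY : IsClosed Y)
    (gr : ℕ → Pt d d' → Pt d d') {z₀ : Pt d d'} (hz₀ : z₀ ∈ feasible Y) {δ η : ℝ} (hδ : 0 < δ)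
    {T t : ℕ} (ht : t ∈ Finset.Icc 1 T)
    (hg : ∀ τ ∈ Finset.Icc 1 T, ∀ i, |coord (gr τ (adaIterate (feasible Y) gr z₀ δ η τ)) i| ≤ δ) (i) :
    (coord (adaIterate (feasible Y) gr z₀ δ η t) i - coord z₀ i) ^ 2 ≤
      ∑ _i : Fin d ⊕ Fin d', 4 * (η * T) ^ 2 := by
  obtain ⟨n, rfl⟩ : ∃ n, t = n + 1 := ⟨t - 1, by have := (Finset.mem_Icc.1 ht).1; omega⟩
  rw [Finset.mem_Icc] at ht
  have h1 := (adaIterate_spec hY gr hz₀ hδ η n).2 z₀ hz₀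
  set z := adaIterate (feasible Y) gr z₀ δ η
  simp only [quadObj, sub_self] at h1
  have h2 : ∑ i, (δ / 4 * (coord (z (n + 1)) i - coord z₀ i) ^ 2 - δ * (η * T) ^ 2) ≤ 0 := by
    rw [← sub_nonpos, ← Finset.sum_sub_distrib] at h1
    refine le_trans (Finset.sum_le_sum fun i _ => ?_) h1
    set a := ∑ τ ∈ Finset.Icc 1 n, coord (gr τ (z τ)) i
    set u := coord (z (n + 1)) i - coord z₀ i
    have ha : |a| ≤ T * δ := by
      refine (Finset.abs_sum_le_sum_abs _ _).trans ?_
      refine (Finset.sum_le_sum (g := fun _ => δ) fun τ hτ => hg τ ?_ i).trans ?_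
      · rw [Finset.mem_Icc] at hτ ⊢; omega
      · have : (n : ℝ) ≤ T := by exact_mod_cast (by omega : n ≤ T)
        simp only [Finset.sum_const, Nat.card_Icc, Nat.add_sub_cancel, nsmul_eq_mul]
        gcongr
    have ha2 : (η * a) ^ 2 ≤ δ * (δ * (η * T) ^ 2) := by
      have : a ^ 2 ≤ (T * δ) ^ 2 := sq_le_sq' (by linarith [abs_le.1 ha]) (abs_le.1 ha).2
      calc (η * a) ^ 2 = η ^ 2 * a ^ 2 := by ring
        _ ≤ η ^ 2 * (T * δ) ^ 2 := by gcongr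
        _ = _ := by ring
    have h3 : 0 ≤ rowNorm (fun τ => gr τ (z τ)) n i / 2 * u ^ 2 := by
      have := rowNorm_nonneg (fun τ => gr τ (z τ)) n i; positivity
    have h4 : 0 ≤ δ * (δ / 4 * u ^ 2 + η * a * u + δ * (η * T) ^ 2) := by
      nlinarith [sq_nonneg (δ / 2 * u + η * a)]
    have h5 := nonneg_of_mul_nonneg_right h4 hδ
    have e : coord (z (n + 1)) i = u + coord z₀ i := by simp [u]
    rw [e]
    nlinarith
  rw [Finset.sum_sub_distrib, ← Finset.mul_sum] at h2
  have h6 : (coord (z (n + 1)) i - coord z₀ i) ^ 2 ≤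
      ∑ i, (coord (z (n + 1)) i - coord z₀ i) ^ 2 :=
    Finset.single_le_sum (f := fun i => (coord (z (n + 1)) i - coord z₀ i) ^ 2)
      (fun _ _ => sq_nonneg _) (Finset.mem_univ i)
  refine h6.trans ?_
  simp only [Finset.sum_const, nsmul_eq_mul] at h2 ⊢
  have h7 : 0 < δ / 4 := by positivity
  refine le_of_mul_le_mul_left ?_ h7
  linarith

theorem abs_ghostShift_le {η δ : ℝ} (hη : 0 ≤ η) (hδ : 0 < δ) {g F : ℕ → Pt d d'} {T t : ℕ}
    (ht : t ∈ Finset.Icc 1 T) (hg : ∀ τ ∈ Finset.Icc 1 T, ∀ i, |coord (g τ) i| ≤ δ)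
    (hF : ∀ τ ∈ Finset.Icc 1 T, ∀ i, |coord (F τ) i| ≤ δ) (i) :
    |ghostShift η δ g F t i| ≤ 2 * (η * T) := by
  rw [Finset.mem_Icc] at ht
  have h0 := rowNorm_nonneg g (t - 1) i
  unfold ghostShift
  rw [abs_div, abs_of_pos (by linarith : 0 < δ + rowNorm g (t - 1) i), div_le_iff₀ (by linarith),
    abs_mul, abs_neg, abs_of_nonneg hη]
  have h1 : |∑ τ ∈ Finset.Icc 1 (t - 1), (coord (F τ) i - coord (g τ) i)| ≤ T * (2 * δ) := by
    refine (Finset.abs_sum_le_sum_abs _ _).trans ?_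
    refine (Finset.sum_le_sum (g := fun _ => 2 * δ) fun τ hτ => ?_).trans ?_
    · have hτ' : τ ∈ Finset.Icc 1 T := by rw [Finset.mem_Icc] at hτ ⊢; omega
      refine (abs_sub _ _).trans ?_
      linarith [hg τ hτ' i, hF τ hτ' i]
    · have : ((t - 1 : ℕ) : ℝ) ≤ T := by exact_mod_cast (by omega : t - 1 ≤ T)
      simp only [Finset.sum_const, Nat.card_Icc, Nat.add_sub_cancel, nsmul_eq_mul]
      gcongr
  calc η * |∑ τ ∈ Finset.Icc 1 (t - 1), (coord (F τ) i - coord (g τ) i)| ≤ η * (T * (2 * δ)) := by gcongr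
    _ = 2 * (η * T) * δ := by ring
    _ ≤ 2 * (η * T) * (δ + rowNorm g (t - 1) i) := by gcongr; linarith

end Bounds

/-! ### Expected regret of an epoch -/

section Epoch

variable {d d' : ℕ} {Y : Set (Vec d')} {gx : Vec d → Vec d' → Vec d} {gy : Vec d → Vec d' → Vec d'}
  {Ω Ξ : Type*} [MeasurableSpace Ξ] {G : Pt d d' → Ξ → Pt d d'}

/-- The sample `ζ` gives unbiased stochastic gradients. -/
def UnbiasedSample [MeasurableSpace Ω] (Pr : Measure Ω) (Y : Set (Vec d'))
    (gx : Vec d → Vec d' → Vec d) (gy : Vec d → Vec d' → Vec d') (G : Pt d d' → Ξ → Pt d d')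
    (ζ : Ω → Ξ) : Prop :=
  Measurable ζ ∧ ∀ z ∈ feasible Y, Integrable (fun ω => G z (ζ ω)) Pr ∧
    ∫ ω, G z (ζ ω) ∂Pr = (gx z.1 z.2, -gy z.1 z.2)

theorem UnbiasedSample.integral_coord_proxGrad [MeasurableSpace Ω] {Pr : Measure Ω}
    [IsProbabilityMeasure Pr] {ζ : Ω → Ξ} (hζ : UnbiasedSample Pr Y gx gy G ζ) (γ : ℝ) (c : Vec d)
    {z : Pt d d'} (hz : z ∈ feasible Y) (i) :
    ∫ ω, coord (proxGrad G γ c (ζ ω) z) i ∂Pr = coord (proxField gx gy γ c z) i := by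
  obtain ⟨h1, h2⟩ := hζ.2 z hz
  unfold proxGrad
  simp only [← coordL_apply]
  have h3 : Integrable (fun _ : Ω => ((γ • (z.1 - c), 0) : Pt d d')) Pr := integrable_const _
  refine ((coordL i).integral_comp_comm (h1.add h3)).trans (congrArg (coordL i) ?_)
  refine (integral_add h1 h3).trans ?_
  rw [h2]
  simp [proxField]

/-- The field is the mean of the oracle over a sample, so its measurability is inherited from `G`
through a parametrized integral. -/
theorem measurable_coord_proxField {Ω' : Type*} [MeasurableSpace Ω'] {Pr : Measure Ω'}
    [IsProbabilityMeasure Pr] {ζ : Ω' → Ξ} (hζ : UnbiasedSample Pr Y gx gy G ζ)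
    (hG : Measurable (Function.uncurry G)) (γ : ℝ) [MeasurableSpace Ω] {c : Ω → Vec d}
    (hc : Measurable c) {z : Ω → Pt d d'} (hz : Measurable z) (hzY : ∀ ω, z ω ∈ feasible Y) (i) :
    Measurable fun ω => coord (proxField gx gy γ (c ω) (z ω)) i := by
  simp only [← hζ.integral_coord_proxGrad γ _ (hzY _)]
  have hφ : Measurable (Function.uncurry fun (p : Vec d × Pt d d') (s : Ξ) =>
      coord (proxGrad G γ p.1 s p.2) i) :=
    (measurable_coord i).comp ((measurable_proxGrad hG γ).comp
      (f := fun q : (Vec d × Pt d d') × Ξ => (q.1.1, q.2, q.1.2)) (by fun_prop))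
  exact (measurable_integral_sample (Pr := Pr) hζ.1 hφ).comp (hc.prodMk hz)

/-- The σ-algebra `m` on Ω is arbitrary, so that the lemma yields measurability with respect to the
past of step t. The sample `ζ` lives on its own space because it is not measurable for that past. -/
theorem measurable_epoch_state {Ω' : Type*} [MeasurableSpace Ω'] {Pr : Measure Ω'}
    [IsProbabilityMeasure Pr] {ζ : Ω' → Ξ} (hζ : UnbiasedSample Pr Y gx gy G ζ)
    (hY : IsClosed Y) (hYc : Convex ℝ Y) (hG : Measurable (Function.uncurry G))
    (γ : ℝ) {δ : ℝ} (hδ : 0 < δ) (η : ℝ) (m : MeasurableSpace Ω) {s : ℕ → Ω → Ξ} {z₀ : Ω → Pt d d'}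
    (hz₀ : Measurable z₀) (hne : Y.Nonempty) (hz₀Y : ∀ ω, z₀ ω ∈ feasible Y) (t : ℕ)
    (hs : ∀ τ, 1 ≤ τ → τ < t → Measurable (s τ)) :
    Measurable (fun ω => epochIterate Y G γ δ η (fun τ => s τ ω) (z₀ ω) t) ∧
    (∀ i, Measurable fun ω =>
      rowNorm (epochGrad Y G γ δ η (fun τ => s τ ω) (z₀ ω)) (t - 1) i) ∧
    ∀ i, Measurable fun ω => ghostShift η δ (epochGrad Y G γ δ η (fun τ => s τ ω) (z₀ ω))
      (fun τ => proxField gx gy γ (z₀ ω).1 (epochIterate Y G γ δ η (fun τ => s τ ω) (z₀ ω) τ)) t i := by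
  have h1 : ∀ τ ≤ t, Measurable fun ω => epochIterate Y G γ δ η (fun τ => s τ ω) (z₀ ω) τ :=
    fun τ hτ => measurable_epochIterate hY hYc hne hG γ hδ η hz₀ τ fun σ h1 h2 => hs σ h1 (by omega)
  have h2 : ∀ τ ∈ Finset.Icc 1 (t - 1), Measurable fun ω =>
      epochGrad Y G γ δ η (fun τ => s τ ω) (z₀ ω) τ := by
    intro τ hτ
    rw [Finset.mem_Icc] at hτ
    exact measurable_epochGrad hY hYc hne hG γ hδ η hz₀ τ hτ.1 fun σ h1 h2 => hs σ h1 (by omega)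
  have h3 : ∀ τ ≤ t, ∀ i, Measurable fun ω => coord (proxField gx gy γ (z₀ ω).1
      (epochIterate Y G γ δ η (fun τ => s τ ω) (z₀ ω) τ)) i :=
    fun τ hτ i => measurable_coord_proxField hζ hG γ (measurable_fst.comp hz₀) (h1 τ hτ)
      (fun ω => adaIterate_mem hY _ (hz₀Y ω) hδ η τ) i
  refine ⟨h1 t le_rfl, measurable_rowNorm h2, fun i => ?_⟩
  unfold ghostShift
  refine Measurable.div (Measurable.const_mul ?_ _) ((measurable_rowNorm h2 i).const_add δ)
  refine Finset.measurable_fun_sum _ fun τ hτ => ?_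
  have hτ' := Finset.mem_Icc.1 hτ
  exact (h3 τ (by omega) i).sub ((measurable_coord i).comp (h2 τ hτ))

theorem indepFun_of_measurable_of_indep {mΩ : MeasurableSpace Ω} {Pr : Measure Ω} {𝒳 : Type*}
    [MeasurableSpace 𝒳] (m : MeasurableSpace Ω) {X : Ω → 𝒳} {ζ : Ω → Ξ} (hX : Measurable[m] X)
    (hind : Indep m (MeasurableSpace.comap ζ inferInstance) Pr) : IndepFun X ζ Pr := by
  rw [IndepFun_iff_Indep]
  exact indep_of_indep_of_le_left hind hX.comap_le

/-- In an epoch, the noise has mean zero along the iterates, and its energy is at most that of the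
stochastic gradients. -/
theorem integral_noise [mΩ : MeasurableSpace Ω] {Pr : Measure Ω} [IsProbabilityMeasure Pr]
    (hY : IsClosed Y) (hYc : Convex ℝ Y) (hG : Measurable (Function.uncurry G))
    (γ : ℝ) {δ η : ℝ} (hδ : 0 < δ) (hη : 0 ≤ η) {s : ℕ → Ω → Ξ}
    (hs : ∀ t, UnbiasedSample Pr Y gx gy G (s t)) (ℱ : ℕ → MeasurableSpace Ω) (hℱ : ∀ t, ℱ t ≤ mΩ)
    (hsℱ : ∀ τ t, 1 ≤ τ → τ < t → Measurable[ℱ t] (s τ))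
    (hind : ∀ t, Indep (ℱ t) (MeasurableSpace.comap (s t) inferInstance) Pr)
    {z₀ : Ω → Pt d d'} (hz₀ : ∀ t, Measurable[ℱ t] z₀) (hz₀Y : ∀ ω, z₀ ω ∈ feasible Y)
    (hne : Y.Nonempty) {T : ℕ} {z g F : Ω → ℕ → Pt d d'}
    (hz : z = fun ω => epochIterate Y G γ δ η (fun τ => s τ ω) (z₀ ω))
    (hg : g = fun ω => epochGrad Y G γ δ η (fun τ => s τ ω) (z₀ ω))
    (hF : F = fun ω t => proxField gx gy γ (z₀ ω).1 (z ω t))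
    (hbd : ∀ᵐ ω ∂Pr, ∀ t ∈ Finset.Icc 1 T, ∀ i, |coord (g ω t) i| ≤ δ) :
    (Integrable (fun ω => noiseDrift η δ (z₀ ω) (z ω) (g ω) (F ω) T) Pr ∧
      ∫ ω, noiseDrift η δ (z₀ ω) (z ω) (g ω) (F ω) T ∂Pr = 0) ∧
    Integrable (fun ω => noiseEnergy δ (g ω) (F ω) T) Pr ∧
      ∫ ω, noiseEnergy δ (g ω) (F ω) T ∂Pr ≤
        ∫ ω, ∑ t ∈ Finset.Icc 1 T, ∑ i, coord (g ω t) i ^ 2 / (δ + rowNorm (g ω) (t - 1) i) ∂Pr := by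
  subst hz
  have hgF : ∀ ω t i, coord (g ω t) i = coord (proxGrad G γ (z₀ ω).1 (s t ω)
    (epochIterate Y G γ δ η (fun τ => s τ ω) (z₀ ω) t)) i := by intro ω t i; rw [hg]; rfl
  set X : ℕ → Ω → Vec d × Pt d d' := fun t ω =>
    ((z₀ ω).1, epochIterate Y G γ δ η (fun τ => s τ ω) (z₀ ω) t) with hX
  set φ : Fin d ⊕ Fin d' → Vec d × Pt d d' → Ξ → ℝ := fun i p σ =>
    coord (proxGrad G γ p.1 σ p.2) i with hφ
  have hXY : ∀ t ω, (X t ω).2 ∈ feasible Y := fun t ω => adaIterate_mem hY _ (hz₀Y ω) hδ η t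
  have mφ : ∀ i, Measurable (Function.uncurry (φ i)) := fun i =>
    (measurable_coord i).comp ((measurable_proxGrad hG γ).comp
      (f := fun q : (Vec d × Pt d d') × Ξ => (q.1.1, q.2, q.1.2)) (by fun_prop))
  have hFφ : ∀ ω t i, coord (F ω t) i = ∫ ω', φ i (X t ω) (s t ω') ∂Pr := by
    intro ω t i
    rw [hF]
    exact ((hs t).integral_coord_proxGrad γ _ (hXY t ω) i).symm
  have hstate := fun t => measurable_epoch_state (hs 0) hY hYc hG γ hδ η (ℱ t) (hz₀ t) hne hz₀Y t
    fun τ h1 h2 => hsℱ τ t h1 h2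
  have mX : ∀ t, Measurable[ℱ t] (X t) := fun t =>
    Measurable.prodMk (measurable_fst.comp (hz₀ t)) (hstate t).1
  have mX' : ∀ t, Measurable (X t) := fun t => (mX t).mono (hℱ t) le_rfl
  have hindX : ∀ t, IndepFun (X t) (s t) Pr := fun t =>
    indepFun_of_measurable_of_indep (ℱ t) (mX t) (hind t)
  have hb : ∀ t ∈ Finset.Icc 1 T, ∀ i, ∀ᵐ ω ∂Pr, |φ i (X t ω) (s t ω)| ≤ δ := by
    intro t ht i
    filter_upwards [hbd] with ω h
    have := h t ht i
    rwa [hgF] at this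
  -- The true field inherits the bound δ along the iterates, as the mean of bounded gradients over
  -- an independent sample.
  have hFb : ∀ᵐ ω ∂Pr, ∀ t ∈ Finset.Icc 1 T, ∀ i, |coord (F ω t) i| ≤ δ := by
    simp only [hFφ]
    rw [ae_all_iff]; intro t
    by_cases ht : t ∈ Finset.Icc 1 T
    · simp only [ht, forall_const]
      rw [ae_all_iff]; intro i
      exact abs_integral_sample_le (mX' t) (hs t).1 (hindX t) (mφ i) (hb t ht i)
    · simp [ht]
  have mg : ∀ t i, Measurable fun ω => coord (g ω t) i := by
    intro t i
    simp only [hgF]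
    exact (mφ i).comp ((mX' t).prodMk (hs t).1)
  have mF : ∀ t i, Measurable fun ω => coord (F ω t) i := by
    intro t i
    simp only [hFφ]
    exact (measurable_integral_sample (hs t).1 (mφ i)).comp (mX' t)
  set w : ℕ → Fin d ⊕ Fin d' → Ω → ℝ := fun t i ω =>
    coord (epochIterate Y G γ δ η (fun τ => s τ ω) (z₀ ω) t) i - coord (z₀ ω) i -
      ghostShift η δ (g ω) (F ω) t i with hw
  have mw : ∀ t i, Measurable[ℱ t] (w t i) := by
    intro t i
    have h3 := (hstate t).2.2 i
    have h1 : Measurable[ℱ t] fun ω => coord (epochIterate Y G γ δ η (fun τ => s τ ω) (z₀ ω) t) i :=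
      (measurable_coord i).comp (hstate t).1
    have h2 : Measurable[ℱ t] fun ω => coord (z₀ ω) i := (measurable_coord i).comp (hz₀ t)
    simp only [hw, hg, hF]
    exact Measurable.sub (Measurable.sub h1 h2) h3
  set B : ℝ := Real.sqrt (∑ _i : Fin d ⊕ Fin d', 4 * (η * T) ^ 2) + 2 * (η * T) with hB
  have hwb : ∀ t ∈ Finset.Icc 1 T, ∀ i, ∀ᵐ ω ∂Pr, |w t i ω| ≤ B := by
    intro t ht i
    filter_upwards [hbd, hFb] with ω h1 h2
    refine (abs_sub _ _).trans (add_le_add ?_ (abs_ghostShift_le hη hδ ht h1 h2 i))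
    refine Real.abs_le_sqrt (sq_adaIterate_sub_le hY _ (hz₀Y ω) hδ ht ?_ i)
    intro τ hτ j
    have := h1 τ hτ j
    rwa [hgF] at this
  set v : ℕ → Fin d ⊕ Fin d' → Ω → ℝ := fun t i ω => 1 / (δ + rowNorm (g ω) (t - 1) i) with hv
  have mv : ∀ t i, Measurable[ℱ t] (v t i) := by
    intro t i
    have h3 := (hstate t).2.1 i
    simp only [hv, hg]
    exact Measurable.div measurable_const (Measurable.const_add h3 δ)
  have hv0 : ∀ t i ω, 0 ≤ v t i ω := by
    intro t i ω
    have := rowNorm_nonneg (g ω) (t - 1) i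
    simp only [hv]; positivity
  have hvb : ∀ t i, ∀ᵐ ω ∂Pr, |v t i ω| ≤ 1 / δ := by
    intro t i
    refine ae_of_all _ fun ω => ?_
    rw [abs_of_nonneg (hv0 t i ω)]
    have := rowNorm_nonneg (g ω) (t - 1) i
    exact one_div_le_one_div_of_le hδ (by linarith)
  have hindw : ∀ t (u : Ω → ℝ), Measurable[ℱ t] u →
      IndepFun (fun ω => (X t ω, u ω)) (s t) Pr := fun t u hu =>
    indepFun_of_measurable_of_indep (ℱ t) (Measurable.prodMk (mX t) hu) (hind t)
  have hdrift : ∀ t ∈ Finset.Icc 1 T, ∀ i,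
      Integrable (fun ω => (coord (F ω t) i - coord (g ω t) i) * w t i ω) Pr ∧
      ∫ ω, (coord (F ω t) i - coord (g ω t) i) * w t i ω ∂Pr = 0 := by
    intro t ht i
    have mw' := (mw t i).mono (hℱ t) le_rfl
    refine ⟨integrable_of_ae_bdd (b := (δ + δ) * B) (((mF t i).sub (mg t i)).mul mw') ?_, ?_⟩
    · filter_upwards [hbd, hFb, hwb t ht i] with ω h1 h2 h3
      rw [abs_mul]
      exact mul_le_mul ((abs_sub _ _).trans (add_le_add (h2 t ht i) (h1 t ht i))) h3 (abs_nonneg _)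
        (by positivity)
    · have := integral_mul_sub_sample_eq_zero (mX' t) mw' (hs t).1 (hindw t _ (mw t i)) (mφ i)
        (hb t ht i) (hwb t ht i)
      simp only [mul_comm _ (w t i _), hFφ, hgF]
      exact this
  have henergy : ∀ t ∈ Finset.Icc 1 T, ∀ i,
      Integrable (fun ω => (coord (F ω t) i - coord (g ω t) i) ^ 2 /
        (δ + rowNorm (g ω) (t - 1) i)) Pr ∧
      Integrable (fun ω => coord (g ω t) i ^ 2 / (δ + rowNorm (g ω) (t - 1) i)) Pr ∧
      ∫ ω, (coord (F ω t) i - coord (g ω t) i) ^ 2 / (δ + rowNorm (g ω) (t - 1) i) ∂Pr ≤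
        ∫ ω, coord (g ω t) i ^ 2 / (δ + rowNorm (g ω) (t - 1) i) ∂Pr := by
    intro t ht i
    have mv' := (mv t i).mono (hℱ t) le_rfl
    have e1 : ∀ ω (a : ℝ), a / (δ + rowNorm (g ω) (t - 1) i) = v t i ω * a := by
      intro ω a; simp only [hv]; ring
    simp only [e1]
    refine ⟨integrable_of_ae_bdd (b := 1 / δ * (δ + δ) ^ 2)
      (mv'.mul (((mF t i).sub (mg t i)).pow_const 2)) ?_,
      integrable_of_ae_bdd (b := 1 / δ * δ ^ 2) (mv'.mul ((mg t i).pow_const 2)) ?_, ?_⟩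
    · filter_upwards [hbd, hFb, hvb t i] with ω h1 h2 h3
      rw [abs_mul, abs_pow]
      exact mul_le_mul h3 (pow_le_pow_left₀ (abs_nonneg _)
        ((abs_sub _ _).trans (add_le_add (h2 t ht i) (h1 t ht i))) 2) (by positivity) (by positivity)
    · filter_upwards [hbd, hvb t i] with ω h1 h3
      rw [abs_mul, abs_pow]
      exact mul_le_mul h3 (pow_le_pow_left₀ (abs_nonneg _) (h1 t ht i) 2) (by positivity)
        (by positivity)
    · have := integral_mul_sq_sub_sample_le (mX' t) mv' (hs t).1 (hindw t _ (mv t i)) (mφ i)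
        (hb t ht i) (hvb t i) (hv0 t i)
      simp only [hFφ, hgF]
      exact this
  refine ⟨⟨?_, ?_⟩, ?_, ?_⟩
  · exact integrable_finsetSum _ fun t ht => integrable_finsetSum _ fun i _ => (hdrift t ht i).1
  · unfold noiseDrift
    rw [integral_finsetSum _ fun t ht => integrable_finsetSum _ fun i _ => (hdrift t ht i).1]
    refine Finset.sum_eq_zero fun t ht => ?_
    rw [integral_finsetSum _ fun i _ => (hdrift t ht i).1]
    exact Finset.sum_eq_zero fun i _ => (hdrift t ht i).2
  · exact integrable_finsetSum _ fun t ht => integrable_finsetSum _ fun i _ => (henergy t ht i).1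
  · unfold noiseEnergy
    rw [integral_finsetSum _ fun t ht => integrable_finsetSum _ fun i _ => (henergy t ht i).1,
      integral_finsetSum _ fun t ht => integrable_finsetSum _ fun i _ => (henergy t ht i).2.1]
    refine Finset.sum_le_sum fun t ht => ?_
    rw [integral_finsetSum _ fun i _ => (henergy t ht i).1,
      integral_finsetSum _ fun i _ => (henergy t ht i).2.1]
    exact Finset.sum_le_sum fun i _ => (henergy t ht i).2.2

end Epoch

section Stages

variable {d d' : ℕ} {f : Vec d → Vec d' → ℝ} {Y : Set (Vec d')}
  {gx : Vec d → Vec d' → Vec d} {gy : Vec d → Vec d' → Vec d'} {ℓ L ρ μ μy γ : ℝ}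
  {Ω Ξ : Type*} [MeasurableSpace Ξ] {G : Pt d d' → Ξ → Pt d d'}

/-! ### The duality gap after an epoch -/

theorem one_le_of_epochLength_le (hd : 0 < d) {M δ : ℝ} (hM : 0 < M) (hδ : 0 < δ)
    {g : ℕ → Pt d d'} {T : ℕ} (h : epochLength M δ g T ≤ T) : 1 ≤ T := by
  have hm := mPar_pos (d' := d') hd
  have h1 : M * ((δ + ⨆ i, rowNorm g T i) / mPar d d') ≤ T :=
    (mul_le_mul_of_nonneg_left (le_max_left _ _) hM.le).trans h
  have h2 : 0 ≤ ⨆ i, rowNorm g T i := Real.iSup_nonneg fun i => rowNorm_nonneg g T i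
  have h3 : 0 < M * ((δ + ⨆ i, rowNorm g T i) / mPar d d') := by positivity
  have : (0 : ℝ) < T := by linarith
  exact_mod_cast this

/-- The inequality holds pathwise and only the remainder R is averaged, since the maximization over
comparison points must precede the expectation. The two halves of the bound on the mean of R come
from the energy of g and from that of the noise. -/
theorem epoch_gap [mΩ : MeasurableSpace Ω] {Pr : Measure Ω} [IsProbabilityMeasure Pr]
    (hS : SmoothStronglyConcave f Y gx gy ℓ μy L) (hW : WeaklyConvexInX f Y gx ρ) (hμy : 0 < μy)
    (hργ : ρ < γ) {l : ℝ} (hl : 0 < l) (hl1 : l ≤ γ - ρ) (hl2 : l ≤ μy)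
    (hd : 0 < d) (hG : Measurable (Function.uncurry G))
    {δ η M : ℝ} (hδ : 0 < δ) (hη : 0 < η) (hM : 0 < M) {s : ℕ → Ω → Ξ}
    (hs : ∀ t, UnbiasedSample Pr Y gx gy G (s t)) (ℱ : ℕ → MeasurableSpace Ω) (hℱ : ∀ t, ℱ t ≤ mΩ)
    (hsℱ : ∀ τ t, 1 ≤ τ → τ < t → Measurable[ℱ t] (s τ))
    (hind : ∀ t, Indep (ℱ t) (MeasurableSpace.comap (s t) inferInstance) Pr)
    {z₀ : Ω → Pt d d'} (hz₀ : ∀ t, Measurable[ℱ t] z₀) (hz₀Y : ∀ ω, z₀ ω ∈ feasible Y)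
    {T : ℕ}
    (hT : ∀ᵐ ω ∂Pr, epochLength M δ (epochGrad Y G γ δ η (fun τ => s τ ω) (z₀ ω)) T ≤ T)
    (hbd : ∀ᵐ ω ∂Pr, ∀ t ∈ Finset.Icc 1 T, ∀ i,
      |coord (epochGrad Y G γ δ η (fun τ => s τ ω) (z₀ ω) t) i| ≤ δ) :
    ∃ R : Ω → ℝ, Integrable R Pr ∧ ∫ ω, R ω ∂Pr ≤ 2 * (η / (M * mPar d d')) ∧
      ∀ᵐ ω ∂Pr, gap (proxObj f γ (z₀ ω).1) Y ((1 / (T : ℝ)) • ∑ t ∈ Finset.Icc 1 T,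
          epochIterate Y G γ δ η (fun τ => s τ ω) (z₀ ω) t) ≤
        2 * (mPar d d' / (M * η)) / l * (gap (proxObj f γ (z₀ ω).1) Y (z₀ ω) +
          gap (proxObj f γ (z₀ ω).1) Y ((1 / (T : ℝ)) • ∑ t ∈ Finset.Icc 1 T,
            epochIterate Y G γ δ η (fun τ => s τ ω) (z₀ ω) t)) + R ω := by
  obtain ⟨ω₀, hω₀⟩ := hT.exists
  have hne : Y.Nonempty := ⟨_, hz₀Y ω₀⟩
  have hT1 := one_le_of_epochLength_le hd hM hδ hω₀
  have hT0 : (0 : ℝ) < T := by exact_mod_cast hT1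
  have hm := mPar_pos (d' := d') hd
  set z : Ω → ℕ → Pt d d' := fun ω => epochIterate Y G γ δ η (fun τ => s τ ω) (z₀ ω) with hz
  set g : Ω → ℕ → Pt d d' := fun ω => epochGrad Y G γ δ η (fun τ => s τ ω) (z₀ ω) with hg
  set F : Ω → ℕ → Pt d d' := fun ω t => proxField gx gy γ (z₀ ω).1 (z ω t) with hF
  obtain ⟨⟨idr, ed⟩, ie, ee⟩ := integral_noise hS.closed hS.convex hG γ hδ hη.le hs ℱ hℱ hsℱ hind hz₀ hz₀Y
    hne (T := T) hz hg hF hbd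
  have ee2 : ∫ ω, ∑ t ∈ Finset.Icc 1 T, ∑ i, coord (g ω t) i ^ 2 /
      (δ + rowNorm (g ω) (t - 1) i) ∂Pr ≤ 2 * (T / (M * mPar d d')) := by
    have : ∫ _ω, 2 * (T / (M * mPar d d')) ∂Pr = 2 * (T / (M * mPar d d')) := by simp
    rw [← this]
    refine integral_mono_of_nonneg (ae_of_all _ fun ω => Finset.sum_nonneg fun t _ =>
      Finset.sum_nonneg fun i _ => ?_) (integrable_const _) ?_
    · have := rowNorm_nonneg (g ω) (t - 1) i; positivity
    · filter_upwards [hT, hbd] with ω h1 h2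
      have h3 : M * (mPar d d' * ∑ i, rowNorm (g ω) T i) ≤ T :=
        (mul_le_mul_of_nonneg_left (le_max_right _ _) hM.le).trans h1
      have h4 : ∑ i, rowNorm (g ω) T i ≤ T / (M * mPar d d') := by
        rw [le_div_iff₀ (by positivity)]; linarith
      rw [Finset.sum_comm]
      refine (Finset.sum_le_sum fun i _ => sum_sq_div_le_two_mul_rowNorm (g ω) hδ i T
        fun t ht => h2 t ht i).trans ?_
      rw [← Finset.mul_sum]
      linarith
  refine ⟨fun ω => 1 / (T : ℝ) * (T * (η / (M * mPar d d')) + η / 2 * noiseEnergy δ (g ω) (F ω) T +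
    noiseDrift η δ (z₀ ω) (z ω) (g ω) (F ω) T), ?_, ?_, ?_⟩
  · exact (((integrable_const _).add (ie.const_mul _)).add idr).const_mul _
  · have ie' : Integrable (fun ω => T * (η / (M * mPar d d')) +
        η / 2 * noiseEnergy δ (g ω) (F ω) T) Pr := (integrable_const _).add (ie.const_mul _)
    rw [integral_const_mul, integral_add ie' idr,
      integral_add (integrable_const _) (ie.const_mul _), integral_const_mul (η / 2), ed]
    simp only [integral_const, probReal_univ, one_smul, add_zero]
    have := ee.trans ee2
    calc _ ≤ 1 / (T : ℝ) * (T * (η / (M * mPar d d')) + η / 2 * (2 * (T / (M * mPar d d')))) := by gcongr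
      _ = _ := by field_simp; ring
  · filter_upwards [hT, hbd] with ω h1 h2
    have hzY : ∀ t, z ω t ∈ feasible Y := fun t => adaIterate_mem hS.closed _ (hz₀Y ω) hδ η t
    have hzb : ((1 / (T : ℝ)) • ∑ t ∈ Finset.Icc 1 T, z ω t) ∈ feasible Y := by
      rw [Finset.smul_sum]
      refine (convex_feasible hS.convex).sum_mem (fun _ _ => by positivity) ?_ fun t _ => hzY t
      simp [hT0.ne']
    refine gap_le_of_quadratic_regret hS hW hμy hργ (z₀ ω).1 hzb (hz₀Y ω) hl hl1 hl2
      (by positivity) fun x' y' hy' => ?_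
    have hw : ((x', y') : Pt d d') ∈ feasible Y := hy'
    have a1 := proxObj_average_sub_le hS hW hμy hργ (z₀ ω).1 hT1 hzY hw
    have a2 := field_regret hS.closed hS.convex hd _ (hz₀Y ω) hδ hη hM (z := z ω) (g := g ω) rfl rfl
      (F ω) h1 h2 hw
    refine a1.trans ((mul_le_mul_of_nonneg_left a2 (by positivity)).trans (le_of_eq ?_))
    have e := sum_coord_sq ((x', y') - z₀ ω)
    simp only [coord_sub] at e
    rw [e]
    simp only [Prod.fst_sub, Prod.snd_sub]
    field_simp

/-! ### The history of the samples -/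

/-- The σ-algebra of the samples drawn before step `t` of epoch `k`. -/
abbrev pastSamples (ξ : ℕ → ℕ → Ω → Ξ) (k t : ℕ) : MeasurableSpace Ω :=
  ⨆ p ∈ {p : ℕ × ℕ | p.1 < k ∨ p.1 = k ∧ p.2 < t}, MeasurableSpace.comap (ξ p.1 p.2) inferInstance

theorem measurable_pastSamples (ξ : ℕ → ℕ → Ω → Ξ) {k t j τ : ℕ} (h : j < k ∨ j = k ∧ τ < t) :
    Measurable[pastSamples ξ k t] (ξ j τ) := by
  refine measurable_iff_comap_le.2 ?_
  exact le_iSup₂_of_le (f := fun (p : ℕ × ℕ) (_ : p ∈ {p : ℕ × ℕ | p.1 < k ∨ p.1 = k ∧ p.2 < t}) =>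
    MeasurableSpace.comap (ξ p.1 p.2) inferInstance) (j, τ) h le_rfl

theorem pastSamples_le [mΩ : MeasurableSpace Ω] {ξ : ℕ → ℕ → Ω → Ξ} (hξ : ∀ k t, Measurable (ξ k t))
    (k t : ℕ) : pastSamples ξ k t ≤ mΩ :=
  iSup₂_le fun p _ => (hξ p.1 p.2).comap_le

theorem indep_pastSamples [MeasurableSpace Ω] {Pr : Measure Ω} {ξ : ℕ → ℕ → Ω → Ξ}
    (hξ : ∀ k t, Measurable (ξ k t)) (hind : iIndepFun (fun p : ℕ × ℕ => ξ p.1 p.2) Pr) (k t : ℕ) :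
    Indep (pastSamples ξ k t) (MeasurableSpace.comap (ξ k t) inferInstance) Pr := by
  have h := indep_iSup_of_disjoint (fun p : ℕ × ℕ => (hξ p.1 p.2).comap_le) hind
    (S := {p : ℕ × ℕ | p.1 < k ∨ p.1 = k ∧ p.2 < t}) (T := {(k, t)}) (by
      rw [Set.disjoint_singleton_right]
      simp)
  simpa [pastSamples] using h

/-! ### The Lyapunov function over the stages -/

theorem lam_pos (hμ : 0 < μ) (hμy : 0 < μy) : 0 < lam μ μy := lt_min (by positivity) hμy

theorem stepSize_pos {η₀ : ℝ} (h : 0 < η₀) (k : ℕ) : 0 < stepSize η₀ k := by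
  unfold stepSize; positivity

theorem MPar_pos (hd : 0 < d) (hμ : 0 < μ) (hμy : 0 < μy) {η₀ : ℝ} (h : 0 < η₀) (k : ℕ) :
    0 < MPar d d' μ μy η₀ k := by
  have := mPar_pos (d' := d') hd
  have := lam_pos hμ hμy
  unfold MPar; positivity

theorem MPar_mul_stepSize (hμ : 0 < μ) (hμy : 0 < μy) {η₀ : ℝ} (h : 0 < η₀) (k : ℕ) :
    MPar d d' μ μy η₀ k * stepSize η₀ k = 384 * mPar d d' / lam μ μy := by
  have := lam_pos hμ hμy
  unfold MPar stepSize
  rw [neg_div, Real.exp_neg]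
  field_simp

theorem stepSize_sq (η₀ : ℝ) (k : ℕ) :
    stepSize η₀ (k + 1) ^ 2 = η₀ ^ 2 * Real.exp (-(k : ℝ) / 16) := by
  unfold stepSize
  rw [mul_pow, ← Real.exp_nat_mul]
  push_cast
  congr 2; ring

theorem pes_epoch_gap [mΩ : MeasurableSpace Ω] {Pr : Measure Ω} [IsProbabilityMeasure Pr]
    (hS : SmoothStronglyConcave f Y gx gy ℓ μy L) (hW : WeaklyConvexInX f Y gx ρ) (hμ : 0 < μ)
    (hμy : 0 < μy) (hρ : ρ ≤ μ / 8) (hd : 0 < d) {ξ : ℕ → ℕ → Ω → Ξ}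
    (hO : UnbiasedOracle Pr Y gx gy G ξ) {δ η₀ : ℝ} (hδ : 0 < δ) (hη₀ : 0 < η₀) {T : ℕ → ℕ}
    {z : ℕ → Ω → Pt d d'} {g : ℕ → Ω → ℕ → Pt d d'} {z₀ : Pt d d'}
    (hz : z = fun k ω => pesPoint Y G (μ / 4) δ (stepSize η₀) T (fun k t => ξ k t ω) z₀ k)
    (hg : g = fun k ω t => pesGrad Y G (μ / 4) δ (stepSize η₀) T (fun k t => ξ k t ω) z₀ k t)
    {k : ℕ} (hzY : ∀ ω, z k ω ∈ feasible Y)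
    (hT : ∀ᵐ ω ∂Pr, epochLength (MPar d d' μ μy η₀ (k + 1)) δ (g (k + 1) ω) (T (k + 1)) ≤ T (k + 1))
    (hbd : ∀ᵐ ω ∂Pr, ∀ t ∈ Finset.Icc 1 (T (k + 1)), ∀ i, |coord (g (k + 1) ω t) i| ≤ δ) :
    ∃ R : Ω → ℝ, Integrable R Pr ∧
      ∫ ω, R ω ∂Pr ≤ stepSize η₀ (k + 1) ^ 2 * lam μ μy / (192 * mPar d d' ^ 2) ∧
      ∀ᵐ ω ∂Pr, gap (proxObj f (μ / 4) (z k ω).1) Y (z (k + 1) ω) ≤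
        1 / 192 * (gap (proxObj f (μ / 4) (z k ω).1) Y (z k ω) +
          gap (proxObj f (μ / 4) (z k ω).1) Y (z (k + 1) ω)) + R ω := by
  have hlp := lam_pos hμ hμy
  have hl1 : lam μ μy ≤ μ / 4 - ρ := (min_le_left _ _).trans (by linarith)
  have hl2 : lam μ μy ≤ μy := min_le_right _ _
  have hm := mPar_pos (d' := d') hd
  have hη := stepSize_pos hη₀ (k + 1)
  have hM := MPar_pos (d' := d') hd hμ hμy hη₀ (k + 1)
  have hMη := MPar_mul_stepSize (d := d) (d' := d') hμ hμy hη₀ (k + 1)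
  subst hz hg
  have hs : ∀ t, UnbiasedSample Pr Y gx gy G (ξ (k + 1) t) := fun t =>
    ⟨hO.measurable_sample _ t, fun z hz => ⟨hO.integrable _ t z hz, hO.unbiased _ t z hz⟩⟩
  have hne : Y.Nonempty := by
    obtain ⟨ω, -⟩ := hT.exists
    exact ⟨_, hzY ω⟩
  obtain ⟨R, hR1, hR2, hR3⟩ := epoch_gap hS hW hμy (γ := μ / 4) (by linarith) hlp hl1 hl2 hd
    hO.measurable_G hδ hη hM hs (fun t => pastSamples ξ (k + 1) t)
    (fun t => pastSamples_le hO.measurable_sample _ t)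
    (fun τ t _ h => measurable_pastSamples ξ (Or.inr ⟨rfl, h⟩))
    (fun t => indep_pastSamples hO.measurable_sample hO.indep _ t)
    (z₀ := fun ω => pesPoint Y G (μ / 4) δ (stepSize η₀) T (fun k t => ξ k t ω) z₀ k)
    (fun t => @measurable_pesPoint d d' Ω Ξ (pastSamples ξ (k + 1) t) _ Y hS.closed hS.convex hne G
      hO.measurable_G (μ / 4) δ hδ (stepSize η₀) T ξ z₀ k fun j hj τ =>
        measurable_pastSamples ξ (Or.inl (by omega))) hzY hT hbd
  refine ⟨R, hR1, hR2.trans (le_of_eq ?_), ?_⟩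
  · have : MPar d d' μ μy η₀ (k + 1) = 384 * mPar d d' / lam μ μy / stepSize η₀ (k + 1) := by
      rw [eq_div_iff hη.ne', hMη]
    rw [this]
    field_simp
    norm_num
  · have : 2 * (mPar d d' / (MPar d d' μ μy η₀ (k + 1) * stepSize η₀ (k + 1))) / lam μ μy = 1 / 192 := by
      rw [hMη]; field_simp; norm_num
    rw [this] at hR3
    exact hR3

/-- Integrability is carried through the induction, because the next gap and primal value are
dominated by the current ones plus R. -/
theorem pes_lyapunov [mΩ : MeasurableSpace Ω] {Pr : Measure Ω} [IsProbabilityMeasure Pr]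
    (hS : SmoothStronglyConcave f Y gx gy ℓ μy L) (hW : WeaklyConvexInX f Y gx ρ) (hμ : 0 < μ)
    (hμy : 0 < μy) (hρ : ρ ≤ μ / 8) (hPL : PrimalPL f Y μ) (hd : 0 < d) {ξ : ℕ → ℕ → Ω → Ξ}
    (hO : UnbiasedOracle Pr Y gx gy G ξ) {δ η₀ ε₀ : ℝ} (hδ : 0 < δ) (hη₀ : 0 < η₀) {T : ℕ → ℕ}
    {z : ℕ → Ω → Pt d d'} {g : ℕ → Ω → ℕ → Pt d d'} {z₀ : Pt d d'} (h₀ : InitialGap f Y z₀ ε₀)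
    (hz : z = fun k ω => pesPoint Y G (μ / 4) δ (stepSize η₀) T (fun k t => ξ k t ω) z₀ k)
    (hg : g = fun k ω t => pesGrad Y G (μ / 4) δ (stepSize η₀) T (fun k t => ξ k t ω) z₀ k t)
    {K : ℕ}
    (hT : ∀ k ∈ Finset.Icc 1 K, ∀ᵐ ω ∂Pr, epochLength (MPar d d' μ μy η₀ k) δ (g k ω) (T k) ≤ T k)
    (hbd : ∀ k ∈ Finset.Icc 1 K, ∀ᵐ ω ∂Pr, ∀ t ∈ Finset.Icc 1 (T k), ∀ i, |coord (g k ω t) i| ≤ δ)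
    {k : ℕ} (hk : k ≤ K) :
    Integrable (fun ω => primal f Y (z k ω).1 - primalOpt f Y) Pr ∧
    Integrable (fun ω => gap (proxObj f (μ / 4) (z k ω).1) Y (z k ω)) Pr ∧
    ∫ ω, lyapunov f Y μ (z k ω) ∂Pr ≤ Real.exp (-(k : ℝ) / 16) *
      (532 * ε₀ + 4 * k * (η₀ ^ 2 * lam μ μy / mPar d d' ^ 2) * Real.exp (1 / 16)) := by
  have hm := mPar_pos (d' := d') hd
  have hlp := lam_pos hμ hμy
  have hργ : ρ < μ / 4 := by linarith
  have hz₀Y : z₀ ∈ feasible Y := h₀.mem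
  have hzY : ∀ k ≤ K, ∀ ω, z k ω ∈ feasible Y := by
    intro k hk ω
    rw [hz]
    refine pesPoint_mem hS.closed hS.convex G _ hδ _ T _ hz₀Y k fun j hj => ?_
    obtain ⟨ω', h⟩ := (hT j (Finset.Icc_subset_Icc_right hk hj)).exists
    exact one_le_of_epochLength_le hd (MPar_pos hd hμ hμy hη₀ j) hδ h
  have mz : ∀ k, Measurable (z k) := by
    intro k
    rw [hz]
    exact measurable_pesPoint hS.closed hS.convex ⟨_, hz₀Y⟩ hO.measurable_G _ hδ _ T z₀ k
      fun j _ t => hO.measurable_sample j t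
  induction k with
  | zero =>
    have e : ∀ ω, z 0 ω = z₀ := by intro ω; rw [hz]; rfl
    simp only [e]
    refine ⟨integrable_const _, integrable_const _, ?_⟩
    simpa using lyapunov_initial_le hS hW hμy hμ hργ h₀
  | succ k ih =>
    obtain ⟨i1, i2, i3⟩ := ih (by omega)
    have hk' : k + 1 ∈ Finset.Icc 1 K := by rw [Finset.mem_Icc]; omega
    obtain ⟨R, hR1, hR2, hR3⟩ := pes_epoch_gap hS hW hμ hμy hρ hd hO hδ hη₀ hz hg
      (hzY k (by omega)) (hT _ hk') (hbd _ hk')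
    have y1 := hzY k (by omega)
    have y2 := hzY (k + 1) hk
    have p1 : ∀ ω, 0 ≤ primal f Y (z k ω).1 - primalOpt f Y :=
      fun ω => sub_nonneg.2 (primalOpt_le hS _)
    have p2 : ∀ ω, 0 ≤ primal f Y (z (k + 1) ω).1 - primalOpt f Y :=
      fun ω => sub_nonneg.2 (primalOpt_le hS _)
    have g1 : ∀ ω, 0 ≤ gap (proxObj f (μ / 4) (z k ω).1) Y (z k ω) :=
      fun ω => gap_nonneg hS hW hμy hργ _ _ (y1 ω)
    have g2 : ∀ ω, 0 ≤ gap (proxObj f (μ / 4) (z k ω).1) Y (z (k + 1) ω) :=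
      fun ω => gap_nonneg hS hW hμy hργ _ _ (y2 ω)
    have g3 : ∀ ω, 0 ≤ gap (proxObj f (μ / 4) (z (k + 1) ω).1) Y (z (k + 1) ω) :=
      fun ω => gap_nonneg hS hW hμy hργ _ _ (y2 ω)
    have hprog : ∀ ω, primal f Y (z (k + 1) ω).1 - primalOpt f Y +
        μ / 8 * ‖(z (k + 1) ω).1 - (z k ω).1‖ ^ 2 ≤
        1 / 3 * (primal f Y (z k ω).1 - primalOpt f Y) +
          gap (proxObj f (μ / 4) (z k ω).1) Y (z (k + 1) ω) :=
      fun ω => primal_progress hS hW hμy hμ hργ hPL _ _ (y2 ω)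
    have hrec : ∀ ω, gap (proxObj f (μ / 4) (z (k + 1) ω).1) Y (z (k + 1) ω) ≤
        2 * gap (proxObj f (μ / 4) (z k ω).1) Y (z (k + 1) ω) +
          2 * (μ / 4) * ‖(z (k + 1) ω).1 - (z k ω).1‖ ^ 2 :=
      fun ω => gap_recenter_le hS hW hμy (by positivity) (by linarith) _ _ (y2 ω)
    -- The gap of the output is moved to the left pathwise, before integrating; its integrability is
    -- deduced from this bound.
    have hR3' : ∀ᵐ ω ∂Pr, gap (proxObj f (μ / 4) (z k ω).1) Y (z (k + 1) ω) ≤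
        1 / 191 * (gap (proxObj f (μ / 4) (z k ω).1) Y (z k ω) + 192 * R ω) := by
      filter_upwards [hR3] with ω h; linarith
    have iR : Integrable (fun ω => 1 / 191 *
        (gap (proxObj f (μ / 4) (z k ω).1) Y (z k ω) + 192 * R ω)) Pr :=
      (i2.add (hR1.const_mul 192)).const_mul _
    have m1 : Measurable fun ω => gap (proxObj f (μ / 4) (z k ω).1) Y (z (k + 1) ω) :=
      measurable_gap hS hW hμy hργ (measurable_fst.comp (mz k)) (mz (k + 1)) y2
    have m2 : Measurable fun ω => gap (proxObj f (μ / 4) (z (k + 1) ω).1) Y (z (k + 1) ω) :=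
      measurable_gap hS hW hμy hργ (measurable_fst.comp (mz (k + 1))) (mz (k + 1)) y2
    have m3 : Measurable fun ω => primal f Y (z (k + 1) ω).1 - primalOpt f Y :=
      ((measurable_primal hS).comp (measurable_fst.comp (mz (k + 1)))).sub_const _
    have j1 : Integrable (fun ω => gap (proxObj f (μ / 4) (z k ω).1) Y (z (k + 1) ω)) Pr := by
      refine iR.mono' m1.aestronglyMeasurable ?_
      filter_upwards [hR3'] with ω h
      rwa [Real.norm_of_nonneg (g2 ω)]
    have j2 : Integrable (fun ω => primal f Y (z (k + 1) ω).1 - primalOpt f Y) Pr := by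
      refine ((i1.const_mul (1 / 3)).add j1).mono' m3.aestronglyMeasurable (ae_of_all _ fun ω => ?_)
      rw [Real.norm_of_nonneg (p2 ω)]
      have := hprog ω
      have : 0 ≤ μ / 8 * ‖(z (k + 1) ω).1 - (z k ω).1‖ ^ 2 := by positivity
      simp only [Pi.add_apply]; linarith
    have j3 : Integrable (fun ω => gap (proxObj f (μ / 4) (z (k + 1) ω).1) Y (z (k + 1) ω)) Pr := by
      refine ((i1.const_mul (4 / 3)).add (j1.const_mul 6)).mono' m2.aestronglyMeasurable
        (ae_of_all _ fun ω => ?_)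
      rw [Real.norm_of_nonneg (g3 ω)]
      have := hprog ω
      have := hrec ω
      have := p2 ω
      simp only [Pi.add_apply]; linarith
    refine ⟨j2, j3, ?_⟩
    have b1 : ∫ ω, lyapunov f Y μ (z (k + 1) ω) ∂Pr ≤
        159 * ∫ ω, (primal f Y (z k ω).1 - primalOpt f Y) ∂Pr +
        589 * ∫ ω, gap (proxObj f (μ / 4) (z k ω).1) Y (z (k + 1) ω) ∂Pr := by
      rw [← integral_const_mul, ← integral_const_mul,
        ← integral_add (i1.const_mul _) (j1.const_mul _)]
      refine integral_mono ((j2.const_mul 475).add (j3.const_mul 57))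
        ((i1.const_mul _).add (j1.const_mul _)) fun ω => ?_
      exact lyapunov_step hS hW hμy hμ hρ hPL _ (y2 ω)
    have b2 : ∫ ω, gap (proxObj f (μ / 4) (z k ω).1) Y (z (k + 1) ω) ∂Pr ≤
        1 / 191 * (∫ ω, gap (proxObj f (μ / 4) (z k ω).1) Y (z k ω) ∂Pr + 192 * ∫ ω, R ω ∂Pr) := by
      rw [← integral_const_mul, ← integral_add i2 (hR1.const_mul _), ← integral_const_mul]
      exact integral_mono_ae j1 iR hR3'
    have b3 : ∫ ω, lyapunov f Y μ (z k ω) ∂Pr =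
        475 * ∫ ω, (primal f Y (z k ω).1 - primalOpt f Y) ∂Pr +
        57 * ∫ ω, gap (proxObj f (μ / 4) (z k ω).1) Y (z k ω) ∂Pr := by
      rw [← integral_const_mul, ← integral_const_mul,
        ← integral_add (i1.const_mul _) (i2.const_mul _)]
      rfl
    have n1 : 0 ≤ ∫ ω, (primal f Y (z k ω).1 - primalOpt f Y) ∂Pr := integral_nonneg p1
    have n2 : 0 ≤ ∫ ω, gap (proxObj f (μ / 4) (z k ω).1) Y (z k ω) ∂Pr := integral_nonneg g1
    -- The Lyapunov function contracts even by 1/2, since 159 ≤ 475/2 and 589/191 ≤ 57/2. The slower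
    -- rate e^{-1/16} matches the decay of η_k², and 589/191 ≤ 4 bounds the noise coefficient.
    have hq : (1 : ℝ) / 2 ≤ Real.exp (-1 / 16) := by
      have := Real.add_one_le_exp (-1 / 16 : ℝ); linarith
    rw [stepSize_sq] at hR2
    set V := η₀ ^ 2 * lam μ μy / mPar d d' ^ 2 with hV
    have hV0 : 0 ≤ V := by positivity
    have eV : η₀ ^ 2 * Real.exp (-(k : ℝ) / 16) * lam μ μy / (192 * mPar d d' ^ 2) =
        1 / 192 * (V * Real.exp (-(k : ℝ) / 16)) := by rw [hV]; field_simp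
    rw [eV] at hR2
    have hVe : 0 ≤ V * Real.exp (-(k : ℝ) / 16) := by positivity
    set I := ∫ ω, lyapunov f Y μ (z k ω) ∂Pr
    have hI : 0 ≤ I := by rw [b3]; positivity
    have b4 : ∫ ω, lyapunov f Y μ (z (k + 1) ω) ∂Pr ≤
        Real.exp (-1 / 16) * I + 4 * (V * Real.exp (-(k : ℝ) / 16)) := by
      have : 1 / 2 * I ≤ Real.exp (-1 / 16) * I := by gcongr
      linarith
    have b5 := mul_le_mul_of_nonneg_left i3 (Real.exp_pos (-1 / 16)).le
    have ex1 : Real.exp (-((k + 1 : ℕ) : ℝ) / 16) = Real.exp (-1 / 16) * Real.exp (-(k : ℝ) / 16) := by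
      rw [← Real.exp_add]; congr 1; push_cast; ring
    have ex2 : Real.exp (-1 / 16) * Real.exp (1 / 16) = 1 := by
      rw [← Real.exp_add]; norm_num
    refine (b4.trans (add_le_add_left b5 _)).trans (le_of_eq ?_)
    rw [ex1]
    push_cast
    linear_combination (-4 * V * Real.exp (-(k : ℝ) / 16)) * ex2

theorem pes_lyapunov_le [mΩ : MeasurableSpace Ω] {Pr : Measure Ω} [IsProbabilityMeasure Pr]
    (hS : SmoothStronglyConcave f Y gx gy ℓ μy L) (hW : WeaklyConvexInX f Y gx ρ) (hμ : 0 < μ)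
    (hμy : 0 < μy) (hρ : ρ ≤ μ / 8) (hPL : PrimalPL f Y μ) (hd : 0 < d) {ξ : ℕ → ℕ → Ω → Ξ}
    (hO : UnbiasedOracle Pr Y gx gy G ξ) {δ η₀ ε₀ ε : ℝ} (hδ : 0 < δ) (hη₀ : 0 < η₀) (hε : 0 < ε)
    {T : ℕ → ℕ}
    {z : ℕ → Ω → Pt d d'} {g : ℕ → Ω → ℕ → Pt d d'} {z₀ : Pt d d'} (h₀ : InitialGap f Y z₀ ε₀)
    (hz : z = fun k ω => pesPoint Y G (μ / 4) δ (stepSize η₀) T (fun k t => ξ k t ω) z₀ k)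
    (hg : g = fun k ω t => pesGrad Y G (μ / 4) δ (stepSize η₀) T (fun k t => ξ k t ω) z₀ k t)
    {K : ℕ}
    (hT : ∀ k ∈ Finset.Icc 1 K, ∀ᵐ ω ∂Pr, epochLength (MPar d d' μ μy η₀ k) δ (g k ω) (T k) ≤ T k)
    (hbd : ∀ k ∈ Finset.Icc 1 K, ∀ᵐ ω ∂Pr, ∀ t ∈ Finset.Icc 1 (T k), ∀ i, |coord (g k ω t) i| ≤ δ)
    (hK : EnoughStages d d' μ μy η₀ ε₀ ε K) :
    Integrable (fun ω => lyapunov f Y μ (z K ω)) Pr ∧ ∫ ω, lyapunov f Y μ (z K ω) ∂Pr ≤ ε := by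
  obtain ⟨i1, i2, i3⟩ := pes_lyapunov hS hW hμ hμy hρ hPL hd hO hδ hη₀ h₀ hz hg hT hbd le_rfl
  refine ⟨(i1.const_mul 475).add (i2.const_mul 57), i3.trans ?_⟩
  obtain ⟨k1, k2⟩ := hK
  have hm := mPar_pos (d' := d') hd
  have he : Real.exp (1 / 16) ≤ 2 := by
    have h1 := Real.add_one_le_exp (-1 / 16 : ℝ)
    have h2 : Real.exp (-1 / 16) * Real.exp (1 / 16) = 1 := by rw [← Real.exp_add]; norm_num
    nlinarith [Real.exp_pos (1 / 16 : ℝ)]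
  have h3 : η₀ ^ 2 * lam μ μy / mPar d d' ^ 2 * K * Real.exp (-(K : ℝ) / 16) ≤ ε / 16 := by
    have : η₀ ^ 2 * lam μ μy / mPar d d' ^ 2 * K * Real.exp (-(K : ℝ) / 16) =
      η₀ ^ 2 * lam μ μy * K * Real.exp (-(K : ℝ) / 16) / mPar d d' ^ 2 := by ring
    rw [this, div_le_iff₀ (by positivity)]; linarith
  have h4 : η₀ ^ 2 * lam μ μy / mPar d d' ^ 2 * K * Real.exp (-(K : ℝ) / 16) * Real.exp (1 / 16) ≤
      ε / 16 * 2 := mul_le_mul h3 he (Real.exp_pos _).le (by positivity)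
  have e : Real.exp (-(K : ℝ) / 16) *
      (532 * ε₀ + 4 * K * (η₀ ^ 2 * lam μ μy / mPar d d' ^ 2) * Real.exp (1 / 16)) =
      532 / 1200 * (1200 * ε₀ * Real.exp (-(K : ℝ) / 16)) + 4 * (η₀ ^ 2 * lam μ μy / mPar d d' ^ 2 * K *
        Real.exp (-(K : ℝ) / 16) * Real.exp (1 / 16)) := by ring
  rw [e]; linarith

end Stages

section Complexity

/-! ### The number of iterations -/

/-- As 1 ≤ x^α, dividing by x^α gives x^{1-α} ≤ 1 + 2A. The exponent 1/(1-α) is at most 2 for α ≤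
1/2, whence the factor 2² = 4. -/
theorem le_of_le_one_add_mul_rpow {x A α : ℝ} (hx : 1 ≤ x) (hA : 0 ≤ A) (hα : 0 < α)
    (hα2 : α ≤ 1 / 2) (h : x ≤ 1 + A * (1 + x ^ α)) :
    x ≤ 4 * (1 + (4 * A ^ 2) ^ (1 / (2 * (1 - α)))) := by
  have hα1 : 0 < 1 - α := by linarith
  have hx0 : 0 < x := by linarith
  set p := 1 / (1 - α) with hp
  have hp1 : 1 ≤ p := by rw [hp, le_div_iff₀ hα1]; linarith
  have hp2 : p ≤ 2 := by rw [hp, div_le_iff₀ hα1]; linarith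
  have h1 : 1 ≤ x ^ α := Real.one_le_rpow hx hα.le
  have h2 : x ^ (1 - α) ≤ 1 + 2 * A := by
    rw [Real.rpow_sub hx0, Real.rpow_one, div_le_iff₀ (by positivity)]
    nlinarith
  have h3 : x ≤ (1 + 2 * A) ^ p := by
    calc x = (x ^ (1 - α)) ^ p := by
          rw [← Real.rpow_mul hx0.le, hp, mul_one_div_cancel hα1.ne', Real.rpow_one]
      _ ≤ _ := Real.rpow_le_rpow (by positivity) h2 (by linarith)
  have e : (4 * A ^ 2) ^ (1 / (2 * (1 - α))) = (2 * A) ^ p := by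
    have : 4 * A ^ 2 = (2 * A) ^ (2 : ℝ) := by
      rw [Real.rpow_two]; ring
    rw [this, ← Real.rpow_mul (by positivity)]
    congr 1
    rw [hp]; field_simp
  rw [e]
  have h4 : (1 + 2 * A) ^ p ≤ (2 * max 1 (2 * A)) ^ p := by
    refine Real.rpow_le_rpow (by positivity) ?_ (by linarith)
    linarith [le_max_left 1 (2 * A), le_max_right 1 (2 * A)]
  have h5 : (2 * max 1 (2 * A)) ^ p = 2 ^ p * max 1 (2 * A) ^ p :=
    Real.mul_rpow (by norm_num) (by positivity)
  have h6 : (2 : ℝ) ^ p ≤ 4 := by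
    calc (2 : ℝ) ^ p ≤ 2 ^ (2 : ℝ) := Real.rpow_le_rpow_of_exponent_le (by norm_num) hp2
      _ = 4 := by norm_num
  have h7 : max 1 (2 * A) ^ p ≤ 1 + (2 * A) ^ p := by
    have : 0 ≤ (2 * A) ^ p := by positivity
    rcases max_cases 1 (2 * A) with hm | hm <;> rw [hm.1]
    · rw [Real.one_rpow]; linarith
    · linarith
  rw [h5] at h4
  refine (h3.trans h4).trans ?_
  exact mul_le_mul h6 h7 (by positivity) (by norm_num)

theorem sum_range_pow_le {r : ℝ} (hr : 33 / 32 ≤ r) (n : ℕ) :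
    ∑ j ∈ Finset.range (n + 1), r ^ j ≤ 33 * r ^ n := by
  induction n with
  | zero => norm_num
  | succ n ih =>
    rw [Finset.sum_range_succ, pow_succ]
    have : 0 < r ^ n := by positivity
    nlinarith

/-! ### Length of a single epoch -/

variable {d d' : ℕ}

theorem mPar_sq (hd : 0 < d) : mPar d d' ^ 2 = 1 / ((d : ℝ) + d') := by
  unfold mPar
  rw [div_pow, one_pow, Real.sq_sqrt (by positivity)]

theorem epochLength_le (hd : 0 < d) {M δ B : ℝ} (hM : 0 < M) (hδ : 0 < δ) {g : ℕ → Pt d d'}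
    {n : ℕ} (hg : ∀ i, rowNorm g n i ≤ B) : epochLength M δ g n ≤ M / mPar d d' * (δ + B) := by
  have hm := mPar_pos (d' := d') hd
  have : Nonempty (Fin d ⊕ Fin d') := ⟨Sum.inl ⟨0, hd⟩⟩
  have h1 : ⨆ i, rowNorm g n i ≤ B := ciSup_le hg
  have h2 : ∑ i, rowNorm g n i ≤ ((d : ℝ) + d') * B := by
    refine (Finset.sum_le_sum fun i _ => hg i).trans (le_of_eq ?_)
    simp
  have h3 : mPar d d' * ((d : ℝ) + d') = 1 / mPar d d' := by
    rw [eq_div_iff hm.ne']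
    have := mPar_sq (d' := d') hd
    have h0 : (0 : ℝ) < (d : ℝ) + d' := by positivity
    rw [eq_div_iff h0.ne'] at this
    linarith
  have h4 : mPar d d' * ∑ i, rowNorm g n i ≤ (δ + B) / mPar d d' := by
    calc mPar d d' * ∑ i, rowNorm g n i ≤ mPar d d' * (((d : ℝ) + d') * B) := by gcongr
      _ = B / mPar d d' := by rw [← mul_assoc, h3]; ring
      _ ≤ _ := by gcongr; linarith
  unfold epochLength
  rw [div_mul_eq_mul_div, mul_div_assoc]
  refine mul_le_mul_of_nonneg_left (max_le ?_ h4) hM.le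
  gcongr

/-- By minimality the rule fails at T - 1 on a set that is not null, so some ω violates it and also
satisfies the almost sure row bound at T. Monotonicity carries that bound to T - 1, giving T - 1 <
(M/m)(δ + δT^α). -/
theorem isLeast_epochLength_le {Ω : Type*} [MeasurableSpace Ω] {Pr : Measure Ω} (hd : 0 < d)
    {M δ α : ℝ} (hM : 0 < M) (hδ : 0 < δ) (hα : 0 < α) (hα2 : α ≤ 1 / 2)
    {g : Ω → ℕ → Pt d d'} {T : ℕ}
    (hT : IsLeast {n : ℕ | ∀ᵐ ω ∂Pr, epochLength M δ (g ω) n ≤ n} T)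
    (hg : ∀ᵐ ω ∂Pr, ∀ i, rowNorm (g ω) T i ≤ δ * (T : ℝ) ^ α) :
    (T : ℝ) ≤ 4 * (1 + (4 * (M / mPar d d' * δ) ^ 2) ^ (1 / (2 * (1 - α)))) := by
  have hm := mPar_pos (d' := d') hd
  rcases Nat.eq_zero_or_pos T with rfl | hpos
  · simp only [Nat.cast_zero]; positivity
  have hnot : T - 1 ∉ {n : ℕ | ∀ᵐ ω ∂Pr, epochLength M δ (g ω) n ≤ n} := by
    intro h
    have := hT.2 h
    omega
  simp only [Set.mem_ofPred_eq] at hnot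
  obtain ⟨ω, h1, h2⟩ := ((Filter.not_eventually.1 hnot).and_eventually hg).exists
  rw [not_le] at h1
  have h3 := epochLength_le hd hM hδ (g := g ω) (n := T - 1) fun i =>
    (rowNorm_mono (g ω) i (Nat.sub_le T 1)).trans (h2 i)
  have h4 : ((T - 1 : ℕ) : ℝ) = (T : ℝ) - 1 := by rw [Nat.cast_sub hpos]; simp
  rw [h4] at h1
  refine le_of_le_one_add_mul_rpow (by exact_mod_cast hpos) (by positivity) hα hα2 ?_
  have e : M / mPar d d' * δ * (1 + (T : ℝ) ^ α) = M / mPar d d' * (δ + δ * (T : ℝ) ^ α) := by ring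
  rw [e]; linarith

/-! ### Number of stages and total number of iterations -/

variable {μ μy η₀ δ : ℝ}

theorem MPar_sq (hd : 0 < d) (hμ : 0 < μ) (hμy : 0 < μy) (hη₀ : 0 < η₀) (k : ℕ) :
    4 * (MPar d d' μ μy η₀ (k + 1) / mPar d d' * δ) ^ 2 =
      768 ^ 2 * (δ ^ 2 / (η₀ ^ 2 * lam μ μy ^ 2)) * Real.exp ((k : ℝ) / 16) := by
  have hm := mPar_pos (d' := d') hd
  have hl := lam_pos hμ hμy
  have e : Real.exp ((k : ℝ) / 16) = Real.exp ((((k + 1 : ℕ) : ℝ) - 1) / 32) ^ 2 := by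
    rw [← Real.exp_nat_mul]; congr 1; push_cast; ring
  unfold MPar
  rw [e]
  field_simp
  ring

theorem min_div_eight_le_lam (hμy : 0 ≤ μy) : min μ μy / 8 ≤ lam μ μy :=
  le_min (by linarith [min_le_left μ μy]) (by
    have := min_le_right μ μy
    linarith)

theorem lam_le_min (hμ : 0 ≤ μ) : lam μ μy ≤ min μ μy :=
  min_le_min (by linarith) le_rfl

/-- The growth of the step sizes up to a stage that is not enough. -/
theorem exp_lt_of_not_enoughStages (hd : 0 < d) {ε₀ ε : ℝ} (hε : 0 < ε) {n : ℕ}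
    (h : ¬ EnoughStages d d' μ μy η₀ ε₀ ε n) :
    Real.exp ((n : ℝ) / 16) < 1200 * (ε₀ / ε) ∨
      Real.exp ((n : ℝ) / 16) < 16 * (η₀ ^ 2 * lam μ μy * ((d : ℝ) + d') / ε) * n := by
  have he : Real.exp (-(n : ℝ) / 16) = (Real.exp ((n : ℝ) / 16))⁻¹ := by
    rw [neg_div, Real.exp_neg]
  have h0 : (0 : ℝ) < (d : ℝ) + d' := by positivity
  unfold EnoughStages at h
  rw [not_and_or, not_le, not_le, he, mPar_sq hd, ← div_eq_mul_inv, ← div_eq_mul_inv,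
    lt_div_iff₀ (Real.exp_pos _), lt_div_iff₀ (Real.exp_pos _)] at h
  rcases h with h | h
  · left
    rw [mul_div_assoc', lt_div_iff₀ hε]; linarith
  · right
    rw [mul_div_assoc', div_mul_eq_mul_div, lt_div_iff₀ hε]
    rw [div_mul_eq_mul_div, one_mul, div_mul_eq_mul_div, div_lt_iff₀ h0] at h
    linarith

/-- Numerical constants become powers of y because y ≥ 2: 1200 ≤ 2¹¹ and 512 = 2⁹. In the second
case n ≤ 32 e^{n/32} cancels half of the exponential, leading to e^{n/32} ≤ y¹⁰; the final 2 log y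
covers the summand 1. -/
theorem stages_le_log {y u v : ℝ} {n : ℕ} (hu : u ≤ y) (hv : v ≤ y) (hy : 2 ≤ y)
    (h : Real.exp ((n : ℝ) / 16) < 1200 * u ∨ Real.exp ((n : ℝ) / 16) < 16 * v * n) :
    (n : ℝ) + 1 ≤ 322 * Real.log y := by
  have hl2 : 1 ≤ 2 * Real.log y := by
    have h1 := Real.log_two_gt_d9
    have h2 := Real.log_le_log (by norm_num) hy
    linarith
  have hy0 : 0 < y := by linarith
  suffices (n : ℝ) ≤ 320 * Real.log y by linarith
  rcases h with h | h
  · have h1 : Real.exp ((n : ℝ) / 16) ≤ y ^ 12 := by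
      have : (2 : ℝ) ^ 11 ≤ y ^ 11 := by gcongr
      nlinarith
    have h2 : (n : ℝ) / 16 ≤ Real.log (y ^ 12) := (Real.le_log_iff_exp_le (by positivity)).2 h1
    rw [Real.log_pow] at h2
    push_cast at h2
    linarith
  · have e : Real.exp ((n : ℝ) / 16) = Real.exp ((n : ℝ) / 32) * Real.exp ((n : ℝ) / 32) := by
      rw [← Real.exp_add]; ring_nf
    have h1 : (n : ℝ) ≤ 32 * Real.exp ((n : ℝ) / 32) := by
      have := Real.add_one_le_exp ((n : ℝ) / 32); linarith
    have h2 : 16 * v * n ≤ 16 * y * (32 * Real.exp ((n : ℝ) / 32)) := by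
      have : 16 * v * n ≤ 16 * y * n := by gcongr
      refine this.trans ?_
      gcongr
    have h3 : Real.exp ((n : ℝ) / 32) ≤ y ^ 10 := by
      have h4 : Real.exp ((n : ℝ) / 32) ≤ 512 * y := by
        refine le_of_mul_le_mul_right (a := Real.exp ((n : ℝ) / 32)) ?_ (Real.exp_pos _)
        linarith
      have : (2 : ℝ) ^ 9 ≤ y ^ 9 := by gcongr
      nlinarith
    have h4 : (n : ℝ) / 32 ≤ Real.log (y ^ 10) := (Real.le_log_iff_exp_le (by positivity)).2 h3
    rw [Real.log_pow] at h4
    push_cast at h4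
    linarith

theorem sum_epochLengths_le (hd : 0 < d) (hμ : 0 < μ) (hμy : 0 < μy) (hη₀ : 0 < η₀)
    {ε₀ ε α : ℝ} (hε₀ : 0 < ε₀) (hε : 0 < ε) (hα : 0 < α) (hα2 : α ≤ 1 / 2) {T : ℕ → ℕ} {K : ℕ}
    (hT : ∀ k ∈ Finset.Icc 1 K, (T k : ℝ) ≤
      4 * (1 + (4 * (MPar d d' μ μy η₀ k / mPar d d' * δ) ^ 2) ^ (1 / (2 * (1 - α)))))
    (hK : IsLeast {K' : ℕ | EnoughStages d d' μ μy η₀ ε₀ ε K'} K) :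
    ∑ k ∈ Finset.Icc 1 K, (T k : ℝ) ≤
      1932000000000000 * (1 + max (δ ^ 2 * ε₀ / (η₀ ^ 2 * min μ μy ^ 2 * ε))
        (δ ^ 2 * ((d : ℝ) + d') / (min μ μy * ε)) ^ (1 / (2 * (1 - α)))) *
        Real.log (2 + ε₀ / ε + η₀ ^ 2 * min μ μy * ((d : ℝ) + d') / ε) := by
  have h0 : (0 : ℝ) < (d : ℝ) + d' := by positivity
  have hmin : 0 < min μ μy := lt_min hμ hμy
  have hl := lam_pos hμ hμy
  have hl1 := min_div_eight_le_lam (μ := μ) hμy.le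
  have hl2 : lam μ μy ≤ min μ μy := lam_le_min hμ.le
  have hα1 : 0 < 1 - α := by linarith
  set q := 1 / (2 * (1 - α)) with hq
  have hq1 : 1 / 2 ≤ q := by rw [hq, div_le_div_iff₀ (by norm_num) (by positivity)]; linarith
  have hq2 : q ≤ 1 := by rw [hq, div_le_iff₀ (by positivity)]; linarith
  set X := max (δ ^ 2 * ε₀ / (η₀ ^ 2 * min μ μy ^ 2 * ε)) (δ ^ 2 * ((d : ℝ) + d') / (min μ μy * ε))
    with hX
  have hX0 : 0 ≤ X := le_max_of_le_left (by positivity)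
  set y := 2 + ε₀ / ε + η₀ ^ 2 * min μ μy * ((d : ℝ) + d') / ε with hy
  have hy2 : 2 ≤ y := by
    have : 0 ≤ ε₀ / ε := by positivity
    have : 0 ≤ η₀ ^ 2 * min μ μy * ((d : ℝ) + d') / ε := by positivity
    linarith
  have hlog : 0 ≤ Real.log y := Real.log_nonneg (by linarith)
  have hXq : 0 ≤ X ^ q := by positivity
  obtain _ | n := K
  · simp only [Finset.Icc_eq_empty (show ¬ (1 ≤ 0) by omega), Finset.sum_empty]
    positivity
  have hnot : ¬ EnoughStages d d' μ μy η₀ ε₀ ε n := fun h => by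
    have := hK.2 h
    omega
  have hexp := exp_lt_of_not_enoughStages hd hε hnot
  have hstages : (n : ℝ) + 1 ≤ 322 * Real.log y := by
    refine stages_le_log ?_ ?_ hy2 hexp
    · have : 0 ≤ η₀ ^ 2 * min μ μy * ((d : ℝ) + d') / ε := by positivity
      linarith
    · have h1 : η₀ ^ 2 * lam μ μy * ((d : ℝ) + d') / ε ≤ η₀ ^ 2 * min μ μy * ((d : ℝ) + d') / ε := by
        gcongr
      have : 0 ≤ ε₀ / ε := by positivity
      linarith
  set D := δ ^ 2 / (η₀ ^ 2 * lam μ μy ^ 2) with hD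
  have hD0 : 0 ≤ D := by positivity
  -- Each way in which stage n = K - 1 is not enough yields one entry of the maximum X. The loss
  -- comes from λ ≥ min{μ, μ_y}/8: 76800 = 1200 · 8² in the first case, 128 = 16 · 8 in the second.
  have hDX : D * Real.exp ((n : ℝ) / 16) ≤ 76800 * ((n : ℝ) + 1) * X := by
    rcases hexp with h | h
    · have h1 : D * (1200 * (ε₀ / ε)) ≤ 76800 * X := by
        have a1 : D ≤ δ ^ 2 / (η₀ ^ 2 * (min μ μy / 8) ^ 2) := by rw [hD]; gcongr
        calc D * (1200 * (ε₀ / ε)) ≤ δ ^ 2 / (η₀ ^ 2 * (min μ μy / 8) ^ 2) * (1200 * (ε₀ / ε)) := by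
              gcongr
          _ = 76800 * (δ ^ 2 * ε₀ / (η₀ ^ 2 * min μ μy ^ 2 * ε)) := by field_simp; ring
          _ ≤ 76800 * X := by gcongr; exact le_max_left _ _
      have h2 : D * Real.exp ((n : ℝ) / 16) ≤ D * (1200 * (ε₀ / ε)) := by gcongr
      have h3 : 0 ≤ (n : ℝ) * X := by positivity
      linarith
    · have h1 : D * (16 * (η₀ ^ 2 * lam μ μy * ((d : ℝ) + d') / ε) * n) ≤ 128 * n * X := by
        calc D * (16 * (η₀ ^ 2 * lam μ μy * ((d : ℝ) + d') / ε) * n)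
            = 16 * n * (δ ^ 2 * ((d : ℝ) + d') / (lam μ μy * ε)) := by rw [hD]; field_simp
          _ ≤ 16 * n * (δ ^ 2 * ((d : ℝ) + d') / (min μ μy / 8 * ε)) := by gcongr
          _ = 128 * n * (δ ^ 2 * ((d : ℝ) + d') / (min μ μy * ε)) := by field_simp; ring
          _ ≤ 128 * n * X := by gcongr; exact le_max_right _ _
      have h2 : D * Real.exp ((n : ℝ) / 16) ≤ D * (16 * (η₀ ^ 2 * lam μ μy * ((d : ℝ) + d') / ε) * n) := by
        gcongr
      have h3 : 0 ≤ (n : ℝ) * X := by positivity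
      linarith
  have hDq : (D * Real.exp ((n : ℝ) / 16)) ^ q ≤ 76800 * ((n : ℝ) + 1) * X ^ q := by
    calc (D * Real.exp ((n : ℝ) / 16)) ^ q ≤ (76800 * ((n : ℝ) + 1) * X) ^ q :=
          Real.rpow_le_rpow (by positivity) hDX (by linarith)
      _ = (76800 * ((n : ℝ) + 1)) ^ q * X ^ q := Real.mul_rpow (by positivity) hX0
      _ ≤ (76800 * ((n : ℝ) + 1)) ^ (1 : ℝ) * X ^ q := by
          gcongr
          have : (0 : ℝ) ≤ n := Nat.cast_nonneg n
          linarith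
      _ = _ := by rw [Real.rpow_one]
  have hterm : ∀ j ∈ Finset.range (n + 1), (T (j + 1) : ℝ) ≤
      4 + 4 * 768 ^ 2 * D ^ q * Real.exp (q / 16) ^ j := by
    intro j hj
    have h1 := hT (j + 1) (by rw [Finset.mem_range] at hj; rw [Finset.mem_Icc]; omega)
    rw [MPar_sq hd hμ hμy hη₀, ← hD] at h1
    rw [Real.mul_rpow (by positivity) (Real.exp_pos _).le, Real.mul_rpow (by positivity) hD0,
      ← Real.exp_mul] at h1
    have h2 : ((768 : ℝ) ^ 2) ^ q ≤ 768 ^ 2 := by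
      calc ((768 : ℝ) ^ 2) ^ q ≤ (768 ^ 2) ^ (1 : ℝ) :=
            Real.rpow_le_rpow_of_exponent_le (by norm_num) hq2
        _ = _ := by rw [Real.rpow_one]
    have h3 : Real.exp ((j : ℝ) / 16 * q) = Real.exp (q / 16) ^ j := by
      rw [← Real.exp_nat_mul]; congr 1; ring
    rw [h3] at h1
    have h4 : ((768 : ℝ) ^ 2) ^ q * D ^ q * Real.exp (q / 16) ^ j ≤
      768 ^ 2 * D ^ q * Real.exp (q / 16) ^ j := by gcongr
    linarith
  -- Since q ≥ 1/2, the ratio is at least 1 + 1/32, so the geometric sum is at most 33 times its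
  -- last term.
  have hgeom := sum_range_pow_le (r := Real.exp (q / 16)) (by
    have := Real.add_one_le_exp (q / 16); linarith) n
  have hDexp : D ^ q * Real.exp (q / 16) ^ n = (D * Real.exp ((n : ℝ) / 16)) ^ q := by
    rw [Real.mul_rpow hD0 (Real.exp_pos _).le, ← Real.exp_mul, ← Real.exp_nat_mul]
    congr 2; ring
  have hreindex : ∑ k ∈ Finset.Icc 1 (n + 1), (T k : ℝ) =
      ∑ j ∈ Finset.range (n + 1), (T (j + 1) : ℝ) := by
    rw [← Finset.Ico_add_one_right_eq_Icc, Finset.sum_Ico_eq_sum_range]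
    simp [add_comm]
  rw [hreindex]
  have hsum : ∑ j ∈ Finset.range (n + 1), (T (j + 1) : ℝ) ≤
      4 * ((n : ℝ) + 1) + 4 * 768 ^ 2 * D ^ q * (33 * Real.exp (q / 16) ^ n) := by
    refine (Finset.sum_le_sum hterm).trans ?_
    rw [Finset.sum_add_distrib, ← Finset.mul_sum]
    have : 4 * 768 ^ 2 * D ^ q * ∑ j ∈ Finset.range (n + 1), Real.exp (q / 16) ^ j ≤
      4 * 768 ^ 2 * D ^ q * (33 * Real.exp (q / 16) ^ n) := by gcongr
    simp only [Finset.sum_const, Finset.card_range, nsmul_eq_mul]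
    push_cast
    linarith
  -- The constant absorbs 77856768 · 76800 < 6 · 10¹² together with the 4 per stage. The factor n +
  -- 1 is what becomes the logarithm.
  have hfin : ∑ j ∈ Finset.range (n + 1), (T (j + 1) : ℝ) ≤
      6000000000000 * (1 + X ^ q) * ((n : ℝ) + 1) := by
    have e : 4 * 768 ^ 2 * D ^ q * (33 * Real.exp (q / 16) ^ n) =
      77856768 * (D ^ q * Real.exp (q / 16) ^ n) := by ring
    rw [e, hDexp] at hsum
    have h1 : (0 : ℝ) ≤ n := Nat.cast_nonneg n
    have h2 : 0 ≤ (n : ℝ) * X ^ q := by positivity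
    nlinarith
  refine hfin.trans ?_
  calc 6000000000000 * (1 + X ^ q) * ((n : ℝ) + 1)
      ≤ 6000000000000 * (1 + X ^ q) * (322 * Real.log y) := by gcongr
    _ = _ := by ring

theorem log_two_add_add_le {u : ℝ} (hu : 0 ≤ u) : Real.log (2 + u + u) ≤ 2 * Real.log (2 + u) := by
  have h : Real.log ((2 + u) ^ 2) = 2 * Real.log (2 + u) := by rw [Real.log_pow]; norm_num
  rw [← h]
  exact Real.log_le_log (by positivity) (by nlinarith)

end Complexity

end PES

theorem mainTheorem11 :
    ∃ C : ℝ, 0 < C ∧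
    ∀ (d d' : ℕ) (_ : 0 < d) (_ : 0 < d')
      -- the problem
      (f : PES.Vec d → PES.Vec d' → ℝ) (Y : Set (PES.Vec d'))
      (gx : PES.Vec d → PES.Vec d' → PES.Vec d) (gy : PES.Vec d → PES.Vec d' → PES.Vec d')
      (ℓ L ρ μ μy : ℝ) (_ : 0 < μ) (_ : 0 < μy) (_ : 0 < ρ) (_ : ρ ≤ ℓ) (_ : ρ ≤ μ / 8)
      (_ : PES.SmoothStronglyConcave f Y gx gy ℓ μy L)
      (_ : PES.PrimalPL f Y μ)
      (_ : PES.WeaklyConvexInX f Y gx ρ)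
      -- the initial point and the target accuracy
      (z₀ : PES.Pt d d') (ε₀ ε : ℝ) (_ : 0 < ε₀) (_ : 0 < ε)
      (_ : PES.InitialGap f Y z₀ ε₀)
      -- the stochastic oracle
      (Ω : Type*) (Ξ : Type*) (_ : MeasurableSpace Ω) (_ : MeasurableSpace Ξ)
      (Pr : MeasureTheory.Measure Ω) (_ : MeasureTheory.IsProbabilityMeasure Pr)
      (G : PES.Pt d d' → Ξ → PES.Pt d d') (ξ : ℕ → ℕ → Ω → Ξ)
      (_ : PES.UnbiasedOracle Pr Y gx gy G ξ)
      -- the parameters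
      (δ α η₀ : ℝ) (_ : 0 < δ) (_ : 0 < α) (_ : α ≤ 1 / 2) (_ : 0 < η₀) (T : ℕ → ℕ) (K : ℕ)
      -- `z k ω` is the output of epoch `k`, `g k ω t` is the stochastic gradient of its step `t`
      (z : ℕ → Ω → PES.Pt d d') (g : ℕ → Ω → ℕ → PES.Pt d d')
      (_ : z = fun k ω =>
        PES.pesPoint Y G (μ / 4) δ (PES.stepSize η₀) T (fun k t => ξ k t ω) z₀ k)
      (_ : g = fun k ω t =>
        PES.pesGrad Y G (μ / 4) δ (PES.stepSize η₀) T (fun k t => ξ k t ω) z₀ k t)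
      -- the epoch lengths
      (_ : ∀ k ∈ Finset.Icc 1 K, IsLeast
        {n : ℕ | ∀ᵐ ω ∂Pr, PES.epochLength (PES.MPar d d' μ μy η₀ k) δ (g k ω) n ≤ n} (T k))
      -- the bounds on the stochastic gradients
      (_ : ∀ k ∈ Finset.Icc 1 K, ∀ᵐ ω ∂Pr, ∀ t ∈ Finset.Icc 1 (T k), ∀ i,
        |PES.coord (g k ω t) i| ≤ δ)
      (_ : ∀ k ∈ Finset.Icc 1 K, ∀ᵐ ω ∂Pr, ∀ i,
        PES.rowNorm (g k ω) (T k) i ≤ δ * (T k : ℝ) ^ α),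
      -- the Lyapunov function after `K` stages
      (PES.EnoughStages d d' μ μy η₀ ε₀ ε K →
        MeasureTheory.Integrable (fun ω => PES.lyapunov f Y μ (z K ω)) Pr ∧
          ∫ ω, PES.lyapunov f Y μ (z K ω) ∂Pr ≤ ε) ∧
      -- the total number of iterations
      (IsLeast {K' : ℕ | PES.EnoughStages d d' μ μy η₀ ε₀ ε K'} K →
        (∑ k ∈ Finset.Icc 1 K, (T k : ℝ) ≤
          C * (1 + max (δ ^ 2 * ε₀ / (η₀ ^ 2 * min μ μy ^ 2 * ε))
              (δ ^ 2 * ((d : ℝ) + d') / (min μ μy * ε)) ^ (1 / (2 * (1 - α)))) *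
            Real.log (2 + ε₀ / ε + η₀ ^ 2 * min μ μy * ((d : ℝ) + d') / ε)) ∧
        (η₀ = Real.sqrt (ε₀ / (((d : ℝ) + d') * min μ μy)) →
          ∑ k ∈ Finset.Icc 1 K, (T k : ℝ) ≤
            C * (1 + (δ ^ 2 * ((d : ℝ) + d') / (min μ μy * ε)) ^ (1 / (2 * (1 - α)))) *
              Real.log (2 + ε₀ / ε))) 
:= by
  -- Twice the constant of `sum_epochLengths_le`: for the special η₀ both extra terms in the
  -- logarithm equal ε₀/ε, and `log_two_add_add_le` costs a factor 2.
  refine ⟨3864000000000000, by norm_num, ?_⟩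
  intro d d' hd hd' f Y gx gy ℓ L ρ μ μy hμ hμy hρ0 hρℓ hρ hS hPL hW z₀ ε₀ ε hε₀ hε h₀ Ω Ξ _ _ Pr _
    G ξ hO δ α η₀ hδ hα hα2 hη₀ T K z g hz hg hT hbd hrow
  refine ⟨fun hK => PES.pes_lyapunov_le hS hW hμ hμy hρ hPL hd hO hδ hη₀ hε h₀ hz hg
    (fun k hk => (hT k hk).1) hbd hK, fun hK => ?_⟩
  have hsum := PES.sum_epochLengths_le hd hμ hμy hη₀ hε₀ hε hα hα2 (δ := δ) (fun k hk =>
    PES.isLeast_epochLength_le hd (PES.MPar_pos hd hμ hμy hη₀ k) hδ hα hα2 (hT k hk) (hrow k hk)) hK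
  have h0 : (0 : ℝ) < (d : ℝ) + d' := by positivity
  have hmin : 0 < min μ μy := lt_min hμ hμy
  have hu : 0 ≤ ε₀ / ε := by positivity
  have hv : 0 ≤ η₀ ^ 2 * min μ μy * ((d : ℝ) + d') / ε := by positivity
  constructor
  · refine hsum.trans ?_
    have hlog : 0 ≤ Real.log (2 + ε₀ / ε + η₀ ^ 2 * min μ μy * ((d : ℝ) + d') / ε) :=
      Real.log_nonneg (by linarith)
    gcongr
    norm_num
  · intro hη
    have hsq : η₀ ^ 2 = ε₀ / (((d : ℝ) + d') * min μ μy) := by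
      rw [hη, Real.sq_sqrt (by positivity)]
    have e1 : δ ^ 2 * ε₀ / (η₀ ^ 2 * min μ μy ^ 2 * ε) = δ ^ 2 * ((d : ℝ) + d') / (min μ μy * ε) := by
      rw [hsq]; field_simp
    have e2 : η₀ ^ 2 * min μ μy * ((d : ℝ) + d') / ε = ε₀ / ε := by
      rw [hsq]; field_simp
    rw [e1, e2, max_self] at hsum
    refine hsum.trans ?_
    calc _ ≤ 1932000000000000 *
          (1 + (δ ^ 2 * ((d : ℝ) + d') / (min μ μy * ε)) ^ (1 / (2 * (1 - α)))) *
            (2 * Real.log (2 + ε₀ / ε)) := by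
          gcongr
          exact PES.log_two_add_add_le hu
      _ = _ := by ring
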